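/- **Setting.** For $s\ge 0$ bosonic modes let $\mathcal H=L^2(\mathbb R^s)$, with canonical observables $Q=(q_1,p_1,\dots,q_s,p_s)^\top$, $q_j\psi(\xi)=\xi_j\psi(\xi)$, $p_j=-i\,\partial/\partial\xi_j$ (so $[q_j,p_k]=i\delta_{jk}$), and Weyl operators $W(z)=\exp(iQ^\top z)$, $z=(x_1,y_1,\dots,x_s,y_s)^\top\in\mathbb R^{2s}$. For a density operator $\rho$, the Jordan product is $\mathcal E_\rho A=\tfrac12(\rho A+A\rho)$, the weighted inner product on bounded operators is $\langle B,A\rangle_\rho=\operatorname{tr}B^\dagger\mathcal E_\rho A$, and $L_2(\rho)$ is the completion of the bounded operators in the norm $\|A\|_\rho=\sqrt{\langle A,A\rangle_\rho}$; an unbounded symmetric operator $A$ with $\sqrt\rho\,\mathcal H\subseteq\operatorname{dom}A$ and $A\sqrt\rho$ Hilbert–Schmidt is identified with the element of $L_2(\rho)$ (unique if it exists) whose distance to every bounded $X$ is given by $\|X-A\|_\rho^2=\tfrac12\|(X-A)\sqrt\rho\|_{HS}^2+\tfrac12\|(X^\dagger-A)\sqrt\rho\|_{HS}^2$. For a density operator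 $\sigma$ on $\mathcal H_1$ and a channel (completely positive trace-preserving map) $\mathcal F$ from trace-class operators on $\mathcal H_1$ to trace-class operators on $\mathcal H_2$, with Hilbert–Schmidt adjoint $\mathcal F^*$ (extended by continuity to $L_2(\mathcal F\sigma)\to L_2(\sigma)$), the divergence of $A\in L_2(\sigma)$ and $B\in L_2(\mathcal F\sigma)$ is $$D_{\sigma,\mathcal F}(A,B)=\|A\|_\sigma^2-2\operatorname{Re}\langle\mathcal F^*B,A\rangle_\sigma+\|B\|_{\mathcal F\sigma}^2,$$ and the generalized conditional expectation (GCE) $\mathcal F_*A$ is the unique minimizer of $D_{\sigma,\mathcal F}(A,\cdot)$ over $L_2(\mathcal F\sigma)$. **Proposition.** Let $\mathcal H_1$ and $\mathcal H_2$ be the Hilbert spaces of $s$ and $t$ bosonic modes, with canonical observables $Q,\tilde Q$ and Weyl operators $W,\tilde W$. Let $\sigma$ be a Gaussian state on $\mathcal H_1$, i.e. for some $m\in\mathbb R^{2s}$ and symmetric $\Sigma\in\mathbb R^{2s\times 2s}$, $$\operatorname{tr}\sigma W(z)=\exp\bigl(im^\top z-\tfrac12z^\top\Sigma z\bigr)\qquad(z\in\mathbb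 R^{2s}),$$ and let $\mathcal F$ be a Gaussian channel, i.e. for some $F\in\mathbb R^{2t\times 2s}$, $l\in\mathbb R^{2t}$ and symmetric $R\in\mathbb R^{2t\times 2t}$, $$\mathcal F^*\tilde W(\zeta)=\exp\bigl(il^\top\zeta-\tfrac12\zeta^\top R\zeta\bigr)\,W(F^\top\zeta)\qquad(\zeta\in\mathbb R^{2t}).$$ Let $u\in\mathbb R^{2s}$ and $A=u^\top Q$. Then $F\Sigma F^\top+R$ is invertible and, with $K=\Sigma F^\top(F\Sigma F^\top+R)^{-1}$, the operators $A$ and $u^\top[m+K(\tilde Q-Fm-l)]$ define elements of $L_2(\sigma)$ and $L_2(\mathcal F\sigma)$ respectively, the GCE of $A$ is $$\mathcal F_*A=u^\top\bigl[m+K(\tilde Q-Fm-l)\bigr],$$ and the minimum divergence is $$D_{\sigma,\mathcal F}(A,\mathcal F_*A)=u^\top(\Sigma-KF\Sigma)u.$$ These are the formulas of the classical linear Gaussian model: if $X\sim N(m,\Sigma)$ and $Z\sim N(l,R)$ are independent random vectors on any probability space and $Y=FX+Z$, then, almost surely, $\mathbb E[u^\top X\mid Y]=u^\top[m+K(Y-Fm-l)]$,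 and $\mathbb E\bigl[(\mathbb E[u^\top X\mid Y]-u^\top X)^2\bigr]=u^\top(\Sigma-KF\Sigma)u$. -/

import Mathlib

open MeasureTheory ProbabilityTheory
open scoped InnerProductSpace ComplexOrder ContDiff Matrix

namespace GaussianGCE

/-! ## Trace-class operators, density operators -/

section TraceClass

variable {H : Type*} [NormedAddCommGroup H] [InnerProductSpace ℂ H] [CompleteSpace H]

/-- Index type of a fixed Hilbert basis of `H`. -/
def BasisIndex (H : Type*) [NormedAddCommGroup H] [InnerProductSpace ℂ H] [CompleteSpace H] :
    Type _ :=
  ↥(Classical.choose (exists_hilbertBasis ℂ H))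

/-- A fixed Hilbert basis of `H`.  The trace of a trace-class operator does not depend on it. -/
noncomputable def basis (H : Type*) [NormedAddCommGroup H] [InnerProductSpace ℂ H]
    [CompleteSpace H] : HilbertBasis (BasisIndex H) ℂ H :=
  Classical.choose (Classical.choose_spec (exists_hilbertBasis ℂ H))

/-- The trace `∑ᵢ ⟪eᵢ, T eᵢ⟫`. -/
noncomputable def trace (T : H →L[ℂ] H) : ℂ :=
  ∑' i, ⟪basis H i, T (basis H i)⟫_ℂ

/-- `T` is positive-semidefinite and its trace is finite. -/
def FiniteTrace (T : H →L[ℂ] H) : Prop :=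
  T.IsPositive ∧ Summable fun i => ⟪basis H i, T (basis H i)⟫_ℂ

/-- The trace-class operators: the linear span of the positive operators of finite trace. -/
def traceClass (H : Type*) [NormedAddCommGroup H] [InnerProductSpace ℂ H] [CompleteSpace H] :
    Submodule ℂ (H →L[ℂ] H) :=
  Submodule.span ℂ {T | FiniteTrace T}

/-- Hilbert-Schmidt operators. -/
def IsHS (X : H →L[ℂ] H) : Prop := Summable fun i => ‖X (basis H i)‖ ^ 2

theorem hasSum_norm_sq_basis (x : H) :
    HasSum (fun j => ‖⟪basis H j, x⟫_ℂ‖ ^ 2) (‖x‖ ^ 2) := by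
  have h := ((basis H).hasSum_inner_mul_inner x x).mapL Complex.reCLM
  have e1 : Complex.reCLM ⟪x, x⟫_ℂ = ‖x‖ ^ 2 := inner_self_eq_norm_sq (𝕜 := ℂ) x
  rw [e1] at h
  convert h using 2 with j
  rw [← inner_conj_symm x, Complex.conj_mul']
  simp [← Complex.ofReal_pow]

theorem IsHS.summable_prod {X : H →L[ℂ] H} (hX : IsHS X) :
    Summable fun p : BasisIndex H × BasisIndex H => ‖⟪basis H p.2, X (basis H p.1)⟫_ℂ‖ ^ 2 := by
  refine (summable_prod_of_nonneg (f := fun p : BasisIndex H × BasisIndex H =>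
    ‖⟪basis H p.2, X (basis H p.1)⟫_ℂ‖ ^ 2) (fun _ => sq_nonneg _)).2 ⟨fun i => ?_, ?_⟩
  · exact (hasSum_norm_sq_basis (X (basis H i))).summable
  · have h : Summable fun i => ‖X (basis H i)‖ ^ 2 := hX
    exact h.congr fun i => ((hasSum_norm_sq_basis (X (basis H i))).tsum_eq).symm

theorem isHS_star {X : H →L[ℂ] H} (hX : IsHS X) : IsHS (star X) := by
  have h := hX.summable_prod.prod_symm
  rw [summable_prod_of_nonneg (fun _ => by positivity)] at h
  refine h.2.congr fun j => ?_
  rw [← (hasSum_norm_sq_basis (star X (basis H j))).tsum_eq]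
  refine tsum_congr fun i => ?_
  rw [ContinuousLinearMap.star_eq_adjoint, ContinuousLinearMap.adjoint_inner_right,
    norm_inner_symm]
  rfl

theorem isHS_mul_left {X : H →L[ℂ] H} (hX : IsHS X) (B : H →L[ℂ] H) : IsHS (B * X) := by
  have h : Summable fun i => ‖X (basis H i)‖ ^ 2 := hX
  refine Summable.of_nonneg_of_le (fun _ => by positivity) (fun i => ?_) (h.mul_left (‖B‖ ^ 2))
  rw [← mul_pow]
  exact pow_le_pow_left₀ (norm_nonneg _) (B.le_opNorm _) 2

theorem isHS_mul_right {X : H →L[ℂ] H} (hX : IsHS X) (B : H →L[ℂ] H) : IsHS (X * B) := by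
  simpa using isHS_star (isHS_mul_left (isHS_star hX) (star B))

theorem summable_trace_of_HS {X Y : H →L[ℂ] H} (hX : IsHS X) (hY : IsHS Y) :
    Summable fun i => ⟪basis H i, (star X * Y) (basis H i)⟫_ℂ := by
  refine Summable.of_norm_bounded (hX.add hY) fun i => ?_
  have e : ⟪basis H i, (star X * Y) (basis H i)⟫_ℂ = ⟪X (basis H i), Y (basis H i)⟫_ℂ := by
    rw [ContinuousLinearMap.star_eq_adjoint, mul_apply_eq_comp,
      ContinuousLinearMap.adjoint_inner_right]
  rw [e]
  refine (norm_inner_le_norm _ _).trans ?_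
  nlinarith [sq_nonneg (‖X (basis H i)‖ - ‖Y (basis H i)‖), sq_nonneg (‖X (basis H i)‖),
    sq_nonneg ‖Y (basis H i)‖]

theorem trace_star_mul_comm_of_HS {X Y : H →L[ℂ] H} (hX : IsHS X) (hY : IsHS Y) :
    trace (star X * Y) = trace (Y * star X) := by
  have hs : Summable (Function.uncurry fun i j : BasisIndex H =>
      ⟪X (basis H i), basis H j⟫_ℂ * ⟪basis H j, Y (basis H i)⟫_ℂ) := by
    refine Summable.of_norm_bounded (hX.summable_prod.add hY.summable_prod) fun p => ?_
    obtain ⟨i, j⟩ := p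
    simp only [Function.uncurry, norm_mul]
    rw [norm_inner_symm (X (basis H i))]
    nlinarith [sq_nonneg (‖⟪basis H j, X (basis H i)⟫_ℂ‖ - ‖⟪basis H j, Y (basis H i)⟫_ℂ‖),
      sq_nonneg ‖⟪basis H j, X (basis H i)⟫_ℂ‖, sq_nonneg ‖⟪basis H j, Y (basis H i)⟫_ℂ‖]
  unfold trace
  calc ∑' i, ⟪basis H i, (star X * Y) (basis H i)⟫_ℂ
      = ∑' i, ∑' j, ⟪X (basis H i), basis H j⟫_ℂ * ⟪basis H j, Y (basis H i)⟫_ℂ := by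
        refine tsum_congr fun i => ?_
        rw [(basis H).tsum_inner_mul_inner, ContinuousLinearMap.star_eq_adjoint,
          mul_apply_eq_comp, ContinuousLinearMap.adjoint_inner_right]
    _ = ∑' j, ∑' i, ⟪X (basis H i), basis H j⟫_ℂ * ⟪basis H j, Y (basis H i)⟫_ℂ :=
        (hs.tsum_comm).symm
    _ = _ := by
        refine tsum_congr fun j => ?_
        rw [mul_apply_eq_comp, ← ContinuousLinearMap.adjoint_inner_left,
          ← (basis H).tsum_inner_mul_inner]
        refine tsum_congr fun i => ?_
        rw [ContinuousLinearMap.adjoint_inner_left, ContinuousLinearMap.star_eq_adjoint,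
          ContinuousLinearMap.adjoint_inner_right, mul_comm]

theorem FiniteTrace.exists_sqrt {T : H →L[ℂ] H} (hT : FiniteTrace T) :
    ∃ S : H →L[ℂ] H, star S = S ∧ IsHS S ∧ T = S * S := by
  have hT0 : 0 ≤ T := (ContinuousLinearMap.nonneg_iff_isPositive T).2 hT.1
  have hs : star (CFC.sqrt T) = CFC.sqrt T := (CFC.sqrt_nonneg T).isSelfAdjoint
  have hm : CFC.sqrt T * CFC.sqrt T = T := CFC.sqrt_mul_sqrt_self T hT0
  refine ⟨CFC.sqrt T, hs, ?_, hm.symm⟩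
  generalize CFC.sqrt T = S at hs hm
  subst hm
  refine (hT.2.mapL Complex.reCLM).congr fun i => ?_
  have e : ⟪basis H i, (S * S) (basis H i)⟫_ℂ = ⟪S (basis H i), S (basis H i)⟫_ℂ := by
    conv_rhs => rw [← hs, ContinuousLinearMap.star_eq_adjoint,
      ContinuousLinearMap.adjoint_inner_left, ← ContinuousLinearMap.star_eq_adjoint, hs]
    rfl
  rw [e]
  exact inner_self_eq_norm_sq (𝕜 := ℂ) _

theorem IsHS.finiteTrace {X : H →L[ℂ] H} (hX : IsHS X) : FiniteTrace (star X * X) :=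
  ⟨(ContinuousLinearMap.nonneg_iff_isPositive _).1 (star_mul_self_nonneg X),
    summable_trace_of_HS hX hX⟩

theorem FiniteTrace.mem {T : H →L[ℂ] H} (hT : FiniteTrace T) : T ∈ traceClass H :=
  Submodule.subset_span hT

theorem FiniteTrace.conj {T : H →L[ℂ] H} (hT : FiniteTrace T) (B : H →L[ℂ] H) :
    FiniteTrace (B * T * star B) := by
  obtain ⟨S, hS, hHS, rfl⟩ := hT.exists_sqrt
  have := (isHS_mul_right hHS (star B)).finiteTrace
  simpa [hS, mul_assoc] using this

theorem mul_mem_traceClass (B : H →L[ℂ] H) {T : H →L[ℂ] H} (hT : T ∈ traceClass H) :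
    B * T ∈ traceClass H := by
  unfold traceClass at hT
  induction hT using Submodule.span_induction with
  | mem T hT =>
    have e : B * T = (1 / 4 : ℂ) • ((B + 1) * T * star (B + 1)
        - (B - 1) * T * star (B - 1)
        + Complex.I • ((B + Complex.I • 1) * T * star (B + Complex.I • 1))
        - Complex.I • ((B - Complex.I • 1) * T * star (B - Complex.I • 1))) := by
      simp only [star_add, star_sub, star_smul, star_one, add_mul, mul_add, sub_mul, mul_sub,
        mul_one, one_mul, smul_mul_assoc, mul_smul_comm, Complex.star_def, Complex.conj_I]
      match_scalars <;> ring_nf <;> simp <;> ring_nf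
    rw [e]
    exact Submodule.smul_mem _ _ (Submodule.sub_mem _ (Submodule.add_mem _ (Submodule.sub_mem _
      (hT.conj _).mem (hT.conj _).mem) (Submodule.smul_mem _ _ (hT.conj _).mem))
      (Submodule.smul_mem _ _ (hT.conj _).mem))
  | zero => simp
  | add x y _ _ hx hy => rw [mul_add]; exact Submodule.add_mem _ hx hy
  | smul a x _ hx => rw [mul_smul_comm]; exact Submodule.smul_mem _ _ hx

theorem star_mem_traceClass {T : H →L[ℂ] H} (hT : T ∈ traceClass H) :
    star T ∈ traceClass H := by
  unfold traceClass at hT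
  induction hT using Submodule.span_induction with
  | mem T hT =>
    have : star T = T := hT.1.isSelfAdjoint
    rw [this]; exact hT.mem
  | zero => simp
  | add x y _ _ hx hy => rw [star_add]; exact Submodule.add_mem _ hx hy
  | smul a x _ hx => rw [star_smul]; exact Submodule.smul_mem _ _ hx

theorem mem_traceClass_mul (B : H →L[ℂ] H) {T : H →L[ℂ] H} (hT : T ∈ traceClass H) :
    T * B ∈ traceClass H := by
  simpa using star_mem_traceClass (mul_mem_traceClass (star B) (star_mem_traceClass hT))

theorem summable_of_mem_traceClass {T : H →L[ℂ] H} (hT : T ∈ traceClass H) :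
    Summable fun i => ⟪basis H i, T (basis H i)⟫_ℂ := by
  unfold traceClass at hT
  induction hT using Submodule.span_induction with
  | mem T hT => exact hT.2
  | zero => simp
  | add x y _ _ hx hy => simpa [inner_add_right] using hx.add hy
  | smul a x _ hx => simpa [inner_smul_right] using hx.mul_left a

theorem finiteTrace_of_mem {T : H →L[ℂ] H} (hT : T ∈ traceClass H) (h0 : T.IsPositive) :
    FiniteTrace T :=
  ⟨h0, summable_of_mem_traceClass hT⟩

theorem trace_add {S T : H →L[ℂ] H} (hS : S ∈ traceClass H) (hT : T ∈ traceClass H) :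
    trace (S + T) = trace S + trace T := by
  unfold trace
  rw [← (summable_of_mem_traceClass hS).tsum_add (summable_of_mem_traceClass hT)]
  simp

theorem trace_smul (a : ℂ) (T : H →L[ℂ] H) : trace (a • T) = a * trace T := by
  unfold trace
  simp [tsum_mul_left]

/-- The trace as a linear functional on the trace-class operators. -/
noncomputable def traceLin (H : Type*) [NormedAddCommGroup H] [InnerProductSpace ℂ H]
    [CompleteSpace H] : traceClass H →ₗ[ℂ] ℂ where
  toFun T := trace (T : H →L[ℂ] H)
  map_add' S T := trace_add S.2 T.2
  map_smul' a _ := trace_smul a _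

theorem trace_star (T : H →L[ℂ] H) : trace (star T) = starRingEnd ℂ (trace T) := by
  unfold trace
  rw [Complex.conj_tsum]
  refine tsum_congr fun i => ?_
  rw [ContinuousLinearMap.star_eq_adjoint, ContinuousLinearMap.adjoint_inner_right,
    inner_conj_symm]

theorem trace_mul_comm (B : H →L[ℂ] H) {T : H →L[ℂ] H} (hT : T ∈ traceClass H) :
    trace (B * T) = trace (T * B) := by
  unfold traceClass at hT
  induction hT using Submodule.span_induction with
  | mem T hT =>
    obtain ⟨S, hS, hHS, rfl⟩ := hT.exists_sqrt
    have h1 := trace_star_mul_comm_of_HS hHS (isHS_mul_left hHS B)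
    have h2 := trace_star_mul_comm_of_HS hHS (isHS_mul_right hHS B)
    rw [hS] at h1 h2
    rw [← mul_assoc, ← h1, ← mul_assoc, mul_assoc S S B, h2, mul_assoc]
  | zero => simp
  | add x y hx hy h1 h2 =>
    rw [mul_add, add_mul, trace_add (mul_mem_traceClass B hx) (mul_mem_traceClass B hy),
      trace_add (mem_traceClass_mul B hx) (mem_traceClass_mul B hy), h1, h2]
  | smul a x _ hx => rw [mul_smul_comm, smul_mul_assoc, trace_smul, trace_smul, hx]

theorem trace_nonneg {T : H →L[ℂ] H} (hT : T.IsPositive) : 0 ≤ trace T :=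
  tsum_nonneg fun i => hT.inner_nonneg_right (basis H i)

theorem norm_trace_mul_le (B : H →L[ℂ] H) {T : H →L[ℂ] H} (hT : FiniteTrace T) :
    ‖trace (B * T)‖ ≤ ‖B‖ * (trace T).re := by
  obtain ⟨S, hS, hHS, rfl⟩ := hT.exists_sqrt
  have hHS' : Summable fun i => ‖S (basis H i)‖ ^ 2 := hHS
  have hin : ∀ x y, ⟪x, S y⟫_ℂ = ⟪S x, y⟫_ℂ := fun x y => by
    conv_lhs => rw [← hS, ContinuousLinearMap.star_eq_adjoint,
      ContinuousLinearMap.adjoint_inner_right]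
  have e1 : trace (B * (S * S)) = ∑' i, ⟪S (basis H i), B (S (basis H i))⟫_ℂ := by
    have h := trace_star_mul_comm_of_HS hHS (isHS_mul_left hHS B)
    rw [hS] at h
    rw [← mul_assoc, ← h]
    exact tsum_congr fun i => hin _ _
  have e2 : (trace (S * S)).re = ∑' i, ‖S (basis H i)‖ ^ 2 := by
    unfold trace
    rw [Complex.re_tsum hT.2]
    refine tsum_congr fun i => ?_
    rw [mul_apply_eq_comp, hin]
    exact inner_self_eq_norm_sq (𝕜 := ℂ) _
  rw [e1, e2, ← tsum_mul_left]
  refine tsum_of_norm_bounded ((hHS'.mul_left ‖B‖).hasSum) fun i => ?_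
  refine (norm_inner_le_norm _ _).trans ?_
  nlinarith [B.le_opNorm (S (basis H i)), norm_nonneg (S (basis H i))]

theorem mul_rankOne_trace (B : H →L[ℂ] H) (x y : H) :
    trace (B * InnerProductSpace.rankOne ℂ y x) = ⟪x, B y⟫_ℂ := by
  rw [← (basis H).tsum_inner_mul_inner]
  refine tsum_congr fun i => ?_
  rw [mul_apply_eq_comp]
  simp

theorem finiteTrace_rankOne_self (x : H) : FiniteTrace (InnerProductSpace.rankOne ℂ x x) := by
  refine ⟨InnerProductSpace.isPositive_rankOne_self x, ?_⟩
  refine ((basis H).hasSum_inner_mul_inner x x).summable.congr fun i => ?_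
  simp

theorem rankOne_polarization (x y : H) : InnerProductSpace.rankOne ℂ y x = (1 / 4 : ℂ) •
    (InnerProductSpace.rankOne ℂ (y + x) (y + x) - InnerProductSpace.rankOne ℂ (y - x) (y - x)
      + Complex.I • InnerProductSpace.rankOne ℂ (y + Complex.I • x) (y + Complex.I • x)
      - Complex.I • InnerProductSpace.rankOne ℂ (y - Complex.I • x) (y - Complex.I • x)) := by
  simp only [map_add, map_sub, map_smulₛₗ, add_apply,
    sub_apply, smul_apply, Complex.conj_I,
    RingHom.id_apply]
  match_scalars <;> ring_nf <;> simp <;> ring_nf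

theorem rankOne_mem (x y : H) : InnerProductSpace.rankOne ℂ y x ∈ traceClass H := by
  rw [rankOne_polarization]
  exact Submodule.smul_mem _ _ (Submodule.sub_mem _ (Submodule.add_mem _ (Submodule.sub_mem _
    (finiteTrace_rankOne_self _).mem (finiteTrace_rankOne_self _).mem)
    (Submodule.smul_mem _ _ (finiteTrace_rankOne_self _).mem))
    (Submodule.smul_mem _ _ (finiteTrace_rankOne_self _).mem))

end TraceClass

/-! ## The Jordan product and the weighted operator space `L₂(ρ)` -/

section States

variable {H : Type*} [NormedAddCommGroup H] [InnerProductSpace ℂ H] [CompleteSpace H]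

/-- A density operator: positive-semidefinite, trace class, of unit trace. -/
structure DensityOperator (H : Type*) [NormedAddCommGroup H] [InnerProductSpace ℂ H]
    [CompleteSpace H] where
  toOp : H →L[ℂ] H
  isPositive : toOp.IsPositive
  mem_traceClass : toOp ∈ traceClass H
  trace_eq_one : trace toOp = 1

/-- The Jordan product `𝓔_ρ A = (ρ A + A ρ) / 2`. -/
noncomputable def jordan (ρ : DensityOperator H) (A : H →L[ℂ] H) : H →L[ℂ] H :=
  (1 / 2 : ℂ) • (ρ.toOp * A + A * ρ.toOp)

/-- The weighted inner product `⟨B, A⟩_ρ = Tr B† 𝓔_ρ A` on bounded operators. -/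
noncomputable def wInner (ρ : DensityOperator H) (B A : H →L[ℂ] H) : ℂ :=
  trace (star B * jordan ρ A)

theorem jordan_mem (ρ : DensityOperator H) (A : H →L[ℂ] H) : jordan ρ A ∈ traceClass H :=
  Submodule.smul_mem _ _ (Submodule.add_mem _ (mem_traceClass_mul A ρ.mem_traceClass)
    (mul_mem_traceClass A ρ.mem_traceClass))

theorem wInner_eq (ρ : DensityOperator H) (B A : H →L[ℂ] H) :
    wInner ρ B A = (1 / 2) * (trace (star B * ρ.toOp * A) + trace (A * ρ.toOp * star B)) := by
  have h1 : star B * ρ.toOp * A ∈ traceClass H :=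
    mem_traceClass_mul A (mul_mem_traceClass _ ρ.mem_traceClass)
  have h2 : A * ρ.toOp ∈ traceClass H := mul_mem_traceClass _ ρ.mem_traceClass
  unfold wInner jordan
  rw [mul_smul_comm, trace_smul, mul_add, ← mul_assoc, trace_add h1 (mul_mem_traceClass _ h2),
    trace_mul_comm _ h2]

theorem wInner_self_eq (ρ : DensityOperator H) (A : H →L[ℂ] H) : wInner ρ A A =
    (1 / 2) * (trace (star (star A) * star A * ρ.toOp) + trace (star A * A * ρ.toOp)) := by
  rw [wInner_eq, ← trace_mul_comm _ (mul_mem_traceClass A ρ.mem_traceClass), mul_assoc (star A),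
    trace_mul_comm _ (mem_traceClass_mul A ρ.mem_traceClass), star_star, mul_assoc,
    ← trace_mul_comm _ ρ.mem_traceClass, mul_assoc, mul_assoc]

/-- The pre-inner-product structure on the bounded operators given by `⟨B, A⟩_ρ`. -/
@[reducible]
noncomputable def wCore (ρ : DensityOperator H) :
    PreInnerProductSpace.Core ℂ (H →L[ℂ] H) where
  inner B A := wInner ρ B A
  conj_inner_symm B A := by
    have hρ : star ρ.toOp = ρ.toOp := ρ.isPositive.isSelfAdjoint
    rw [wInner_eq, wInner_eq, map_mul, map_add, ← trace_star, ← trace_star]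
    simp [mul_assoc, hρ, Complex.conj_ofNat]
  re_inner_nonneg A := by
    have h1 := trace_nonneg (((finiteTrace_of_mem ρ.mem_traceClass ρ.isPositive).conj (star A)).1)
    have h2 := trace_nonneg (((finiteTrace_of_mem ρ.mem_traceClass ρ.isPositive).conj A).1)
    rw [star_star] at h1
    have h : 0 ≤ wInner ρ A A := by
      rw [wInner_eq]
      exact mul_nonneg (by norm_num [Complex.le_def]) (add_nonneg h1 h2)
    exact (Complex.le_def.1 h).1
  add_left A B C := by
    unfold wInner
    rw [star_add, add_mul, trace_add (mul_mem_traceClass _ (jordan_mem ρ C))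
      (mul_mem_traceClass _ (jordan_mem ρ C))]
  smul_left A B r := by
    unfold wInner
    rw [star_smul, smul_mul_assoc, trace_smul]
    rfl

/-- The bounded operators `𝓞(H)`, carrying the seminorm `‖A‖_ρ = √⟨A, A⟩_ρ`. -/
def WOp (_ρ : DensityOperator H) : Type _ := H →L[ℂ] H

noncomputable instance instAddCommGroupWOp (ρ : DensityOperator H) : AddCommGroup (WOp ρ) :=
  inferInstanceAs (AddCommGroup (H →L[ℂ] H))

noncomputable instance instModuleWOp (ρ : DensityOperator H) : Module ℂ (WOp ρ) :=
  inferInstanceAs (Module ℂ (H →L[ℂ] H))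

noncomputable instance instSeminormedWOp (ρ : DensityOperator H) :
    SeminormedAddCommGroup (WOp ρ) :=
  @InnerProductSpace.Core.toSeminormedAddCommGroup ℂ (WOp ρ) _ (instAddCommGroupWOp ρ)
    (instModuleWOp ρ) (wCore ρ)

noncomputable instance instInnerWOp (ρ : DensityOperator H) : InnerProductSpace ℂ (WOp ρ) :=
  @InnerProductSpace.ofCore ℂ (WOp ρ) _ (instAddCommGroupWOp ρ) (instModuleWOp ρ) (wCore ρ)

/-- `L₂(ρ)`: the completion of the bounded operators with respect to `‖·‖_ρ`. -/
abbrev L2 (ρ : DensityOperator H) : Type _ := UniformSpace.Completion (WOp ρ)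

/-- The element of `L₂(ρ)` given by a bounded operator. -/
noncomputable def toL2 (ρ : DensityOperator H) (A : H →L[ℂ] H) : L2 ρ :=
  ((show WOp ρ from A : WOp ρ) : UniformSpace.Completion (WOp ρ))

theorem wOp_norm_sq (ρ : DensityOperator H) (A : WOp ρ) :
    ‖A‖ ^ 2 = (wInner ρ A A).re :=
  norm_sq_eq_re_inner (𝕜 := ℂ) A

/-- The element `a` of `L₂(ρ)` is the class of the (in general unbounded) symmetric operator `A`.
This means that `√ρ H ⊆ dom A` and that the distance of `a` from every bounded operator `X` is
`‖X - A‖_ρ`, where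
`‖X - A‖²_ρ = ½ Tr (X - A) ρ (X - A)† + ½ Tr (X - A)† ρ (X - A)
  = ½ ∑ᵢ (‖(X - A) √ρ eᵢ‖² + ‖(X† - A) √ρ eᵢ‖²)`.
As the bounded operators are dense in `L₂(ρ)`, there is at most one such `a`. -/
def Represents (ρ : DensityOperator H) (A : H →ₗ.[ℂ] H) (a : L2 ρ) : Prop :=
  ∃ hA : ∀ v, CFC.sqrt ρ.toOp v ∈ A.domain, ∀ X : H →L[ℂ] H,
    HasSum (fun i => (1 / 2) *
        (‖X (CFC.sqrt ρ.toOp (basis H i)) - A ⟨CFC.sqrt ρ.toOp (basis H i), hA _⟩‖ ^ 2 +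
          ‖star X (CFC.sqrt ρ.toOp (basis H i)) -
            A ⟨CFC.sqrt ρ.toOp (basis H i), hA _⟩‖ ^ 2))
      (‖toL2 ρ X - a‖ ^ 2)

theorem Represents.unique {ρ : DensityOperator H} {A : H →ₗ.[ℂ] H} {a a' : L2 ρ}
    (h : Represents ρ A a) (h' : Represents ρ A a') : a = a' := by
  obtain ⟨_, h⟩ := h
  obtain ⟨_, h'⟩ := h'
  have key : ∀ b : L2 ρ, ‖b - a‖ = ‖b - a'‖ := by
    intro b
    induction b using UniformSpace.Completion.induction_on with
    | hp => exact isClosed_eq (by fun_prop) (by fun_prop)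
    | ih X =>
      have e := (h X).unique (h' X)
      exact (pow_left_inj₀ (norm_nonneg _) (norm_nonneg _) two_ne_zero).1 e
  have := key a
  rw [sub_self, norm_zero] at this
  exact sub_eq_zero.1 (norm_eq_zero.1 this.symm)

end States

/-! ## Quantum channels, the divergence and the generalized conditional expectation -/

section Channels

variable {H₁ H₂ : Type*} [NormedAddCommGroup H₁] [InnerProductSpace ℂ H₁] [CompleteSpace H₁]
  [NormedAddCommGroup H₂] [InnerProductSpace ℂ H₂] [CompleteSpace H₂]

/-- Positivity of an `n × n` block operator `(T i j)` on `H ⊕ ⋯ ⊕ H`. -/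
def BlockPositive {H : Type*} [NormedAddCommGroup H] [InnerProductSpace ℂ H] {n : ℕ}
    (T : Fin n → Fin n → (H →L[ℂ] H)) : Prop :=
  ∀ x : Fin n → H, 0 ≤ ∑ i, ∑ j, ⟪x i, T i j (x j)⟫_ℂ

/-- A quantum channel: a completely positive trace-preserving linear map `𝓕` between the spaces of
trace-class operators. -/
structure QuantumChannel (H₁ H₂ : Type*) [NormedAddCommGroup H₁] [InnerProductSpace ℂ H₁]
    [CompleteSpace H₁] [NormedAddCommGroup H₂] [InnerProductSpace ℂ H₂] [CompleteSpace H₂] where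
  toLin : traceClass H₁ →ₗ[ℂ] traceClass H₂
  completely_positive : ∀ (n : ℕ) (T : Fin n → Fin n → traceClass H₁),
    BlockPositive (fun i j => (T i j : H₁ →L[ℂ] H₁)) →
      BlockPositive (fun i j => (toLin (T i j) : H₂ →L[ℂ] H₂))
  trace_preserving : ∀ T : traceClass H₁,
    trace (toLin T : H₂ →L[ℂ] H₂) = trace (T : H₁ →L[ℂ] H₁)

theorem isPositive_of_inner {H : Type*} [NormedAddCommGroup H] [InnerProductSpace ℂ H]
    {T : H →L[ℂ] H} (h : ∀ x, 0 ≤ ⟪x, T x⟫_ℂ) : T.IsPositive := by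
  rw [ContinuousLinearMap.isPositive_iff_complex]
  intro x
  have h1 := h x
  rw [Complex.le_def] at h1
  have h2 : ⟪T x, x⟫_ℂ = starRingEnd ℂ ⟪x, T x⟫_ℂ := (inner_conj_symm _ _).symm
  have h3 : (⟪x, T x⟫_ℂ).im = 0 := h1.2.symm
  have h4 : ⟪T x, x⟫_ℂ = ⟪x, T x⟫_ℂ := by rw [h2, Complex.conj_eq_iff_im.2 h3]
  rw [h4]
  refine ⟨?_, h1.1⟩
  apply Complex.ext
  · simp
  · simp [h3]

namespace QuantumChannel

variable (𝓕 : QuantumChannel H₁ H₂)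

theorem isPositive_toLin {T : traceClass H₁} (hT : (T : H₁ →L[ℂ] H₁).IsPositive) :
    (𝓕.toLin T : H₂ →L[ℂ] H₂).IsPositive := by
  refine isPositive_of_inner fun x => ?_
  have h := 𝓕.completely_positive 1 (fun _ _ => T) (fun y => by
    simpa using hT.inner_nonneg_right (y 0)) (fun _ => x)
  simpa using h

/-- The output density operator `𝓕σ`. -/
noncomputable def apply (σ : DensityOperator H₁) : DensityOperator H₂ where
  toOp := 𝓕.toLin ⟨σ.toOp, σ.mem_traceClass⟩
  isPositive := 𝓕.isPositive_toLin σ.isPositive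
  mem_traceClass := (𝓕.toLin ⟨σ.toOp, σ.mem_traceClass⟩).2
  trace_eq_one := by rw [𝓕.trace_preserving]; exact σ.trace_eq_one

theorem toLin_star (T : traceClass H₁) :
    (𝓕.toLin ⟨star (T : H₁ →L[ℂ] H₁), star_mem_traceClass T.2⟩ : H₂ →L[ℂ] H₂) =
      star (𝓕.toLin T : H₂ →L[ℂ] H₂) := by
  obtain ⟨T, hT⟩ := T
  have key : ∀ T, T ∈ traceClass H₁ → ∀ (h1 : T ∈ traceClass H₁) (h2 : star T ∈ traceClass H₁),
      (𝓕.toLin ⟨star T, h2⟩ : H₂ →L[ℂ] H₂) = star (𝓕.toLin ⟨T, h1⟩ : H₂ →L[ℂ] H₂) := by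
    intro T hT
    unfold traceClass at hT
    induction hT using Submodule.span_induction with
    | mem T hT =>
      intro h1 h2
      have e : star T = T := hT.1.isSelfAdjoint
      have e2 : star (𝓕.toLin ⟨T, h1⟩ : H₂ →L[ℂ] H₂) = 𝓕.toLin ⟨T, h1⟩ :=
        (𝓕.isPositive_toLin (T := ⟨T, h1⟩) hT.1).isSelfAdjoint
      rw [e2]
      congr 2
      exact Subtype.ext e
    | zero =>
      intro h1 h2
      have e1 : (⟨star 0, h2⟩ : traceClass H₁) = 0 := Subtype.ext (star_zero _)
      have e2 : (⟨0, h1⟩ : traceClass H₁) = 0 := rfl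
      rw [e1, e2]; simp
    | add x y hx hy ihx ihy =>
      intro h1 h2
      have e1 : (⟨star (x + y), h2⟩ : traceClass H₁) =
        ⟨star x, star_mem_traceClass hx⟩ + ⟨star y, star_mem_traceClass hy⟩ :=
        Subtype.ext (star_add _ _)
      have e2 : (⟨x + y, h1⟩ : traceClass H₁) = ⟨x, hx⟩ + ⟨y, hy⟩ := rfl
      rw [e1, e2, map_add, map_add, Submodule.coe_add, Submodule.coe_add, star_add,
        ihx hx _, ihy hy _]
    | smul a x hx ih =>
      intro h1 h2
      have e1 : (⟨star (a • x), h2⟩ : traceClass H₁) =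
        (star a) • ⟨star x, star_mem_traceClass hx⟩ :=
        Subtype.ext (star_smul _ _)
      have e2 : (⟨a • x, h1⟩ : traceClass H₁) = a • ⟨x, hx⟩ := rfl
      rw [e1, e2, map_smul, map_smul, Submodule.coe_smul, Submodule.coe_smul, star_smul,
        ih hx _]
  exact key T hT _ _

/-- The Hilbert-Schmidt inner product `⟨B, A⟩_HS = Tr B† A`. -/
noncomputable def _root_.GaussianGCE.hsInner {H : Type*} [NormedAddCommGroup H]
    [InnerProductSpace ℂ H] [CompleteSpace H] (B A : H →L[ℂ] H) : ℂ :=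
  trace (star B * A)

/-- `|y⟩⟨x|` as a trace-class operator. -/
noncomputable def _root_.GaussianGCE.ketBra {H : Type*} [NormedAddCommGroup H]
    [InnerProductSpace ℂ H] [CompleteSpace H] (x y : H) : traceClass H :=
  ⟨InnerProductSpace.rankOne ℂ y x, rankOne_mem x y⟩

/-- `T ↦ ⟨B, 𝓕 T⟩_HS` as a linear functional. -/
noncomputable def dualFunctional (B : H₂ →L[ℂ] H₂) : traceClass H₁ →ₗ[ℂ] ℂ where
  toFun T := hsInner B (𝓕.toLin T : H₂ →L[ℂ] H₂)
  map_add' S T := by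
    unfold hsInner
    rw [map_add, Submodule.coe_add, mul_add,
      trace_add (mul_mem_traceClass _ (𝓕.toLin S).2) (mul_mem_traceClass _ (𝓕.toLin T).2)]
  map_smul' a T := by
    unfold hsInner
    rw [map_smul, Submodule.coe_smul, mul_smul_comm, trace_smul]
    rfl

theorem norm_dualFunctional_le (B : H₂ →L[ℂ] H₂) {T : traceClass H₁}
    (hT : (T : H₁ →L[ℂ] H₁).IsPositive) :
    ‖𝓕.dualFunctional B T‖ ≤ ‖B‖ * (trace (T : H₁ →L[ℂ] H₁)).re := by
  have h := norm_trace_mul_le (star B) (finiteTrace_of_mem (𝓕.toLin T).2 (𝓕.isPositive_toLin hT))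
  rwa [norm_star, 𝓕.trace_preserving] at h

theorem norm_dualFunctional_ketBra_self (B : H₂ →L[ℂ] H₂) (x : H₁) :
    ‖𝓕.dualFunctional B (ketBra x x)‖ ≤ ‖B‖ * ‖x‖ ^ 2 := by
  have h := 𝓕.norm_dualFunctional_le B (T := ketBra x x) (finiteTrace_rankOne_self x).1
  have e : trace (InnerProductSpace.rankOne ℂ x x) = ⟪x, x⟫_ℂ := by
    simpa using mul_rankOne_trace 1 x x
  have e2 : (trace (ketBra x x : H₁ →L[ℂ] H₁)).re = ‖x‖ ^ 2 := by
    change (trace (InnerProductSpace.rankOne ℂ x x)).re = _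
    rw [e]
    exact inner_self_eq_norm_sq (𝕜 := ℂ) x
  rwa [e2] at h

theorem norm_dualFunctional_ketBra_le (B : H₂ →L[ℂ] H₂) (x y : H₁) :
    ‖𝓕.dualFunctional B (ketBra x y)‖ ≤ ‖B‖ * (‖x‖ + ‖y‖) ^ 2 := by
  have e : (ketBra x y : traceClass H₁) = (1 / 4 : ℂ) • (ketBra (y + x) (y + x)
      - ketBra (y - x) (y - x) + Complex.I • ketBra (y + Complex.I • x) (y + Complex.I • x)
      - Complex.I • ketBra (y - Complex.I • x) (y - Complex.I • x)) :=
    Subtype.ext (rankOne_polarization x y)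
  have hb : ∀ v : H₁, ‖v‖ ≤ ‖x‖ + ‖y‖ →
      ‖𝓕.dualFunctional B (ketBra v v)‖ ≤ ‖B‖ * (‖x‖ + ‖y‖) ^ 2 := fun v hv =>
    (𝓕.norm_dualFunctional_ketBra_self B v).trans (by gcongr)
  have n1 : ‖Complex.I • x‖ = ‖x‖ := by simp [norm_smul]
  have h1 := hb (y + x) ((norm_add_le _ _).trans (by linarith))
  have h2 := hb (y - x) ((norm_sub_le _ _).trans (by linarith))
  have h3 := hb (y + Complex.I • x) ((norm_add_le _ _).trans (by linarith))
  have h4 := hb (y - Complex.I • x) ((norm_sub_le _ _).trans (by linarith))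
  rw [e, map_smul, map_sub, map_add, map_sub, map_smul, map_smul, norm_smul]
  have t1 := norm_sub_le (𝓕.dualFunctional B (ketBra (y + x) (y + x))
    - 𝓕.dualFunctional B (ketBra (y - x) (y - x))
    + Complex.I • 𝓕.dualFunctional B (ketBra (y + Complex.I • x) (y + Complex.I • x)))
    (Complex.I • 𝓕.dualFunctional B (ketBra (y - Complex.I • x) (y - Complex.I • x)))
  have t2 := norm_add_le (𝓕.dualFunctional B (ketBra (y + x) (y + x))
    - 𝓕.dualFunctional B (ketBra (y - x) (y - x)))
    (Complex.I • 𝓕.dualFunctional B (ketBra (y + Complex.I • x) (y + Complex.I • x)))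
  have t3 := norm_sub_le (𝓕.dualFunctional B (ketBra (y + x) (y + x)))
    (𝓕.dualFunctional B (ketBra (y - x) (y - x)))
  simp only [norm_smul, Complex.norm_I, one_mul] at t1 t2
  have n4 : ‖(1 / 4 : ℂ)‖ = 1 / 4 := by norm_num
  rw [n4]
  linarith

theorem exists_adjoint (B : H₂ →L[ℂ] H₂) : ∃ C : H₁ →L[ℂ] H₁, ∀ T : traceClass H₁,
    hsInner C (T : H₁ →L[ℂ] H₁) = hsInner B (𝓕.toLin T : H₂ →L[ℂ] H₂) := by
  let g : H₁ →ₗ⋆[ℂ] H₁ →ₗ[ℂ] ℂ := LinearMap.mk₂'ₛₗ (starRingEnd ℂ) (RingHom.id ℂ)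
    (fun x y => 𝓕.dualFunctional B (ketBra x y))
    (fun x x' y => by
      rw [← map_add]; congr 1; exact Subtype.ext (by simp [ketBra]))
    (fun c x y => by
      rw [← map_smul]; congr 1; exact Subtype.ext (by simp [ketBra]))
    (fun x y y' => by
      rw [← map_add]; congr 1; exact Subtype.ext (by simp [ketBra]))
    (fun c x y => by
      rw [RingHom.id_apply, ← map_smul]; congr 1; exact Subtype.ext (by simp [ketBra]))
  have hg : ∀ x y, ‖g x y‖ ≤ (4 * ‖B‖) * ‖x‖ * ‖y‖ := by
    intro x y
    rcases eq_or_ne x 0 with rfl | hx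
    · simp
    rcases eq_or_ne y 0 with rfl | hy
    · simp
    have hx' : (‖x‖ : ℂ) ≠ 0 := by simpa using hx
    have hy' : (‖y‖ : ℂ) ≠ 0 := by simpa using hy
    have e : g x y = (‖x‖ : ℂ) * (‖y‖ : ℂ) *
        g ((‖x‖ : ℂ)⁻¹ • x) ((‖y‖ : ℂ)⁻¹ • y) := by
      rw [LinearMap.map_smulₛₗ₂, map_smul]
      simp only [map_inv₀, Complex.conj_ofReal, smul_eq_mul]
      field_simp
    have h : ‖g ((‖x‖ : ℂ)⁻¹ • x) ((‖y‖ : ℂ)⁻¹ • y)‖ ≤ ‖B‖ * (1 + 1) ^ 2 := by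
      have h := 𝓕.norm_dualFunctional_ketBra_le B ((‖x‖ : ℂ)⁻¹ • x) ((‖y‖ : ℂ)⁻¹ • y)
      rwa [norm_smul, norm_smul, norm_inv, norm_inv, Complex.norm_real, Complex.norm_real,
        norm_norm, norm_norm, inv_mul_cancel₀ (by simpa using hx),
        inv_mul_cancel₀ (by simpa using hy)] at h
    rw [e, norm_mul, norm_mul, Complex.norm_real, Complex.norm_real, norm_norm, norm_norm]
    calc ‖x‖ * ‖y‖ * _ ≤ ‖x‖ * ‖y‖ * (‖B‖ * (1 + 1) ^ 2) := by gcongr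
      _ = _ := by ring
  let C : H₁ →L[ℂ] H₁ :=
    InnerProductSpace.continuousLinearMapOfBilin (LinearMap.mkContinuous₂ g (4 * ‖B‖) hg)
  have hC : ∀ x y, ⟪C x, y⟫_ℂ = 𝓕.dualFunctional B (ketBra x y) := fun x y =>
    InnerProductSpace.continuousLinearMapOfBilin_apply _ x y
  refine ⟨C, ?_⟩
  have key : ∀ T, T ∈ traceClass H₁ → ∀ (h : T ∈ traceClass H₁),
      hsInner C T = 𝓕.dualFunctional B ⟨T, h⟩ := by
    intro T hT
    unfold traceClass at hT
    induction hT using Submodule.span_induction with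
    | mem T hT =>
      intro h
      obtain ⟨S, hS, hHS, rfl⟩ := hT.exists_sqrt
      have hin : ∀ x y, ⟪x, S y⟫_ℂ = ⟪S x, y⟫_ℂ := fun x y => by
        conv_lhs => rw [← hS, ContinuousLinearMap.star_eq_adjoint,
          ContinuousLinearMap.adjoint_inner_right]
      let P : Finset (BasisIndex H₁) → traceClass H₁ := fun F =>
        ∑ i ∈ F, ketBra (S (basis H₁ i)) (S (basis H₁ i))
      -- the functional of the partial sums converges to the left-hand side
      have h1 : Filter.Tendsto (fun F => 𝓕.dualFunctional B (P F)) Filter.atTop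
          (nhds (hsInner C (S * S))) := by
        have hs := summable_trace_of_HS hHS (isHS_mul_left hHS (star C))
        have e := trace_star_mul_comm_of_HS hHS (isHS_mul_left hHS (star C))
        rw [hS] at hs e
        have hs2 := hs.hasSum
        change HasSum _ (trace (S * (star C * S))) at hs2
        rw [e, mul_assoc] at hs2
        refine Filter.Tendsto.congr (fun F => ?_) hs2
        simp only [P, map_sum]
        refine Finset.sum_congr rfl fun i _ => ?_
        rw [mul_apply_eq_comp, hin, mul_apply_eq_comp, ContinuousLinearMap.star_eq_adjoint,
          ContinuousLinearMap.adjoint_inner_right, hC]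
      have htr : HasSum (fun i => ⟪S (basis H₁ i), S (basis H₁ i)⟫_ℂ) (trace (S * S)) := by
        have h3 : HasSum (fun i => ⟪basis H₁ i, (S * S) (basis H₁ i)⟫_ℂ) (trace (S * S)) :=
          hT.2.hasSum
        simpa only [mul_apply_eq_comp, ContinuousLinearMap.comp_apply, hin] using h3
      have hpos : ∀ F, ((⟨S * S, h⟩ - P F : traceClass H₁) : H₁ →L[ℂ] H₁).IsPositive := by
        intro F
        refine isPositive_of_inner fun x => ?_
        have e1 : ⟪x, ((⟨S * S, h⟩ - P F : traceClass H₁) : H₁ →L[ℂ] H₁) x⟫_ℂ =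
            ((‖S x‖ ^ 2 - ∑ i ∈ F, ‖⟪basis H₁ i, S x⟫_ℂ‖ ^ 2 : ℝ) : ℂ) := by
          have e2 : ((P F : traceClass H₁) : H₁ →L[ℂ] H₁) x =
              ∑ i ∈ F, ⟪S (basis H₁ i), x⟫_ℂ • S (basis H₁ i) := by
            simp [P, ketBra]
          rw [Submodule.coe_sub, sub_apply, e2, inner_sub_right, inner_sum]
          change ⟪x, S (S x)⟫_ℂ - _ = _
          rw [hin, inner_self_eq_norm_sq_to_K]
          push_cast
          congr 1
          refine Finset.sum_congr rfl fun i _ => ?_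
          rw [inner_smul_right, hin, ← hin (basis H₁ i) x, ← inner_conj_symm (S x) (basis H₁ i),
            Complex.mul_conj']
        rw [e1, Complex.zero_le_real, sub_nonneg]
        exact sum_le_hasSum F (fun _ _ => sq_nonneg _) (hasSum_norm_sq_basis (S x))
      have htz : Filter.Tendsto (fun F => ‖B‖ * (trace ((⟨S * S, h⟩ - P F : traceClass H₁) :
          H₁ →L[ℂ] H₁)).re) Filter.atTop (nhds 0) := by
        have h4 : Filter.Tendsto (fun F => ‖B‖ * (trace (S * S) -
            ∑ i ∈ F, ⟪S (basis H₁ i), S (basis H₁ i)⟫_ℂ).re) Filter.atTop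
            (nhds (‖B‖ * (trace (S * S) - trace (S * S)).re)) :=
          ((Complex.continuous_re.tendsto _).comp (htr.const_sub _)).const_mul _
        rw [sub_self, Complex.zero_re, mul_zero] at h4
        refine h4.congr fun F => ?_
        have e3 : trace ((⟨S * S, h⟩ - P F : traceClass H₁) : H₁ →L[ℂ] H₁) =
            trace (S * S) - ∑ i ∈ F, ⟪S (basis H₁ i), S (basis H₁ i)⟫_ℂ := by
          change traceLin H₁ (⟨S * S, h⟩ - P F) = _
          rw [map_sub]
          simp only [P, map_sum]
          congr 1
          refine Finset.sum_congr rfl fun i _ => ?_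
          change trace (InnerProductSpace.rankOne ℂ _ _) = _
          simpa using mul_rankOne_trace 1 (S (basis H₁ i)) (S (basis H₁ i))
        rw [e3]
      have h2 : Filter.Tendsto (fun F => 𝓕.dualFunctional B (P F)) Filter.atTop
          (nhds (𝓕.dualFunctional B ⟨S * S, h⟩)) := by
        rw [tendsto_iff_norm_sub_tendsto_zero]
        refine squeeze_zero (fun _ => norm_nonneg _) (fun F => ?_) htz
        rw [norm_sub_rev, ← map_sub]
        exact 𝓕.norm_dualFunctional_le B (hpos F)
      exact tendsto_nhds_unique h1 h2
    | zero =>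
      intro h
      have e : (⟨0, h⟩ : traceClass H₁) = 0 := rfl
      rw [e, map_zero]
      simp [hsInner, trace]
    | add x y hx hy ihx ihy =>
      intro h
      have e : (⟨x + y, h⟩ : traceClass H₁) = ⟨x, hx⟩ + ⟨y, hy⟩ := rfl
      rw [e, map_add, ← ihx hx, ← ihy hy]
      unfold hsInner
      rw [mul_add, trace_add (mul_mem_traceClass _ hx) (mul_mem_traceClass _ hy)]
    | smul a x hx ih =>
      intro h
      have e : (⟨a • x, h⟩ : traceClass H₁) = a • ⟨x, hx⟩ := rfl
      rw [e, map_smul, ← ih hx]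
      unfold hsInner
      rw [mul_smul_comm, trace_smul]
      rfl
  exact fun T => key T.1 T.2 T.2

theorem _root_.GaussianGCE.hsInner_add_left {H : Type*} [NormedAddCommGroup H]
    [InnerProductSpace ℂ H] [CompleteSpace H] (C D : H →L[ℂ] H) (T : traceClass H) :
    hsInner (C + D) (T : H →L[ℂ] H) = hsInner C (T : H →L[ℂ] H) + hsInner D (T : H →L[ℂ] H) := by
  unfold hsInner
  rw [star_add, add_mul, trace_add (mul_mem_traceClass _ T.2) (mul_mem_traceClass _ T.2)]

theorem _root_.GaussianGCE.hsInner_ketBra {H : Type*} [NormedAddCommGroup H]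
    [InnerProductSpace ℂ H] [CompleteSpace H] (C : H →L[ℂ] H) (x y : H) :
    hsInner C (ketBra x y : H →L[ℂ] H) = ⟪C x, y⟫_ℂ := by
  unfold hsInner ketBra
  rw [mul_rankOne_trace, ContinuousLinearMap.star_eq_adjoint,
    ContinuousLinearMap.adjoint_inner_right]

theorem adjoint_unique {C C' : H₁ →L[ℂ] H₁}
    (h : ∀ T : traceClass H₁, hsInner C (T : H₁ →L[ℂ] H₁) = hsInner C' (T : H₁ →L[ℂ] H₁)) :
    C = C' := by
  refine ContinuousLinearMap.ext fun x => ext_inner_right ℂ fun y => ?_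
  rw [← hsInner_ketBra, ← hsInner_ketBra, h]

/-- The Hilbert-Schmidt adjoint `𝓕*` on the bounded operators:
`⟨𝓕* B, T⟩_HS = ⟨B, 𝓕 T⟩_HS` for all trace-class `T`. -/
noncomputable def adj (B : H₂ →L[ℂ] H₂) : H₁ →L[ℂ] H₁ :=
  Classical.choose (𝓕.exists_adjoint B)

theorem hsInner_adj (B : H₂ →L[ℂ] H₂) (T : traceClass H₁) :
    hsInner (𝓕.adj B) (T : H₁ →L[ℂ] H₁) = hsInner B (𝓕.toLin T : H₂ →L[ℂ] H₂) :=
  Classical.choose_spec (𝓕.exists_adjoint B) T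

theorem adj_add (A B : H₂ →L[ℂ] H₂) : 𝓕.adj (A + B) = 𝓕.adj A + 𝓕.adj B := by
  refine adjoint_unique fun T => ?_
  rw [hsInner_add_left, hsInner_adj, hsInner_adj, hsInner_adj, hsInner_add_left]

theorem adj_smul (c : ℂ) (B : H₂ →L[ℂ] H₂) : 𝓕.adj (c • B) = c • 𝓕.adj B := by
  refine adjoint_unique fun T => ?_
  have e1 : hsInner (c • 𝓕.adj B) (T : H₁ →L[ℂ] H₁) = star c * hsInner (𝓕.adj B) T := by
    unfold hsInner; rw [star_smul, smul_mul_assoc, trace_smul]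
  have e2 : hsInner (c • B) (𝓕.toLin T : H₂ →L[ℂ] H₂) = star c * hsInner B (𝓕.toLin T) := by
    unfold hsInner; rw [star_smul, smul_mul_assoc, trace_smul]
  rw [e1, hsInner_adj, hsInner_adj, e2]

theorem adj_star (B : H₂ →L[ℂ] H₂) : 𝓕.adj (star B) = star (𝓕.adj B) := by
  refine adjoint_unique fun T => ?_
  have h := 𝓕.hsInner_adj B ⟨star (T : H₁ →L[ℂ] H₁), star_mem_traceClass T.2⟩
  rw [𝓕.hsInner_adj]
  rw [𝓕.toLin_star] at h
  unfold hsInner at h ⊢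
  have h2 := congrArg (starRingEnd ℂ) h
  rw [← trace_star, ← trace_star, star_mul, star_mul, star_star, star_star, star_star,
    star_star] at h2
  rw [star_star, star_star, trace_mul_comm _ T.2, trace_mul_comm _ (𝓕.toLin T).2]
  exact h2.symm

theorem trace_adj_mul_self_le (σ : DensityOperator H₁) (B : H₂ →L[ℂ] H₂) :
    (trace (star (𝓕.adj B) * 𝓕.adj B * σ.toOp)).re ≤
      (trace (star B * B * (𝓕.apply σ).toOp)).re := by
  set C := 𝓕.adj B with hC
  have hσ : star σ.toOp = σ.toOp := σ.isPositive.isSelfAdjoint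
  let X : Fin 2 → (H₁ →L[ℂ] H₁) := ![C, 1]
  let T : Fin 2 → Fin 2 → traceClass H₁ := fun i j =>
    ⟨X i * σ.toOp * star (X j), mem_traceClass_mul _ (mul_mem_traceClass _ σ.mem_traceClass)⟩
  have hT : BlockPositive (fun i j => (T i j : H₁ →L[ℂ] H₁)) := by
    intro x
    have e : ∑ i, ∑ j, ⟪x i, (T i j : H₁ →L[ℂ] H₁) (x j)⟫_ℂ =
        ⟪∑ i, star (X i) (x i), σ.toOp (∑ j, star (X j) (x j))⟫_ℂ := by
      rw [map_sum, sum_inner]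
      refine Finset.sum_congr rfl fun i _ => ?_
      rw [inner_sum]
      refine Finset.sum_congr rfl fun j _ => ?_
      rw [ContinuousLinearMap.star_eq_adjoint (X i), ContinuousLinearMap.adjoint_inner_left]
      rfl
    rw [e]
    exact σ.isPositive.inner_nonneg_right _
  have hS := 𝓕.completely_positive 2 T hT
  have m : ∀ i j, (𝓕.toLin (T i j) : H₂ →L[ℂ] H₂) ∈ traceClass H₂ := fun i j =>
    (𝓕.toLin (T i j)).2
  have h0 : 0 ≤ trace ((𝓕.toLin (T 0 0) : H₂ →L[ℂ] H₂)
      + ((-1 : ℂ) • ((𝓕.toLin (T 0 1) : H₂ →L[ℂ] H₂) * star B)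
      + ((-1 : ℂ) • (B * (𝓕.toLin (T 1 0) : H₂ →L[ℂ] H₂))
      + B * (𝓕.toLin (T 1 1) : H₂ →L[ℂ] H₂) * star B))) := by
    refine trace_nonneg (isPositive_of_inner fun x => ?_)
    have h := hS ![x, -(star B x)]
    simp only [Fin.sum_univ_two, Matrix.cons_val_zero, Matrix.cons_val_one, map_neg,
      inner_neg_left, inner_neg_right, ContinuousLinearMap.star_eq_adjoint,
      ContinuousLinearMap.adjoint_inner_left] at h
    convert h using 1
    simp only [add_apply, smul_apply, mul_apply_eq_comp,
      inner_add_right, inner_smul_right, ContinuousLinearMap.star_eq_adjoint]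
    ring
  rw [trace_add (m 0 0) (Submodule.add_mem _ (Submodule.smul_mem _ _ (mem_traceClass_mul _ (m 0 1)))
      (Submodule.add_mem _ (Submodule.smul_mem _ _ (mul_mem_traceClass _ (m 1 0)))
      (mem_traceClass_mul _ (mul_mem_traceClass _ (m 1 1))))),
    trace_add (Submodule.smul_mem _ _ (mem_traceClass_mul _ (m 0 1)))
      (Submodule.add_mem _ (Submodule.smul_mem _ _ (mul_mem_traceClass _ (m 1 0)))
      (mem_traceClass_mul _ (mul_mem_traceClass _ (m 1 1)))),
    trace_add (Submodule.smul_mem _ _ (mul_mem_traceClass _ (m 1 0)))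
      (mem_traceClass_mul _ (mul_mem_traceClass _ (m 1 1))), trace_smul, trace_smul] at h0
  have t00 : trace (𝓕.toLin (T 0 0) : H₂ →L[ℂ] H₂) = trace (star C * C * σ.toOp) := by
    rw [𝓕.trace_preserving]
    change trace (C * σ.toOp * star C) = _
    rw [← trace_mul_comm _ (mul_mem_traceClass C σ.mem_traceClass), mul_assoc]
  have t01 : trace ((𝓕.toLin (T 0 1) : H₂ →L[ℂ] H₂) * star B) = trace (star C * C * σ.toOp) := by
    rw [← trace_mul_comm _ (m 0 1)]
    have h := 𝓕.hsInner_adj B (T 0 1)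
    unfold hsInner at h
    rw [← h]
    change trace (star C * (C * σ.toOp * star 1)) = _
    rw [star_one, mul_one, mul_assoc]
  have t10 : trace (B * (𝓕.toLin (T 1 0) : H₂ →L[ℂ] H₂)) =
      starRingEnd ℂ (trace (star C * C * σ.toOp)) := by
    have e : (𝓕.toLin (T 1 0) : H₂ →L[ℂ] H₂) = star (𝓕.toLin (T 0 1) : H₂ →L[ℂ] H₂) := by
      rw [← 𝓕.toLin_star]
      congr 2
      apply Subtype.ext
      simp [T, X, hσ]
    rw [e, ← t01, ← trace_star, star_mul, star_star]
  have t11 : trace (B * (𝓕.toLin (T 1 1) : H₂ →L[ℂ] H₂) * star B) =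
      trace (star B * B * (𝓕.apply σ).toOp) := by
    have e : (𝓕.toLin (T 1 1) : H₂ →L[ℂ] H₂) = (𝓕.apply σ).toOp := by
      change _ = (𝓕.toLin ⟨σ.toOp, σ.mem_traceClass⟩ : H₂ →L[ℂ] H₂)
      congr 2
      apply Subtype.ext
      simp [T, X]
    rw [e, ← trace_mul_comm _ (mul_mem_traceClass B (𝓕.apply σ).mem_traceClass), mul_assoc]
  rw [t00, t01, t10, t11] at h0
  have h1 := (Complex.le_def.1 h0).1
  simp at h1
  linarith

/-- `𝓕*` is a contraction from `(𝓞(H₂), ‖·‖_{𝓕σ})` to `(𝓞(H₁), ‖·‖_σ)`. -/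
theorem norm_adj_le (σ : DensityOperator H₁) (B : H₂ →L[ℂ] H₂) :
    (wInner σ (𝓕.adj B) (𝓕.adj B)).re ≤ (wInner (𝓕.apply σ) B B).re := by
  have h1 := 𝓕.trace_adj_mul_self_le σ B
  have h2 := 𝓕.trace_adj_mul_self_le σ (star B)
  rw [𝓕.adj_star] at h2
  rw [wInner_self_eq, wInner_self_eq]
  simp
  simp at h1 h2
  linarith

/-- The extension of `𝓕*` to `L₂(𝓕σ) → L₂(σ)` by continuity. -/
noncomputable def adjL2 (σ : DensityOperator H₁) : L2 (𝓕.apply σ) →L[ℂ] L2 σ :=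
  ContinuousLinearMap.completion (LinearMap.mkContinuous
    ({ toFun := fun B : WOp (𝓕.apply σ) => (𝓕.adj B : WOp σ)
       map_add' := 𝓕.adj_add
       map_smul' := 𝓕.adj_smul } : WOp (𝓕.apply σ) →ₗ[ℂ] WOp σ) 1 (fun B => by
      rw [one_mul]
      refine (pow_le_pow_iff_left₀ (norm_nonneg _) (norm_nonneg _) two_ne_zero).1 ?_
      rw [wOp_norm_sq, wOp_norm_sq]
      exact 𝓕.norm_adj_le σ B))

theorem adjL2_toL2 (σ : DensityOperator H₁) (B : H₂ →L[ℂ] H₂) :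
    𝓕.adjL2 σ (toL2 (𝓕.apply σ) B) = toL2 σ (𝓕.adj B) := by
  unfold adjL2 toL2
  exact UniformSpace.Completion.map_coe (ContinuousLinearMap.uniformContinuous _) _

end QuantumChannel

/-- The divergence
`D_{σ,𝓕}(A, B) = ‖A‖²_σ - 2 Re ⟨𝓕* B, A⟩_σ + ‖B‖²_{𝓕σ}` for `A ∈ L₂(σ)`, `B ∈ L₂(𝓕σ)`. -/
noncomputable def divergence (σ : DensityOperator H₁) (𝓕 : QuantumChannel H₁ H₂)
    (A : L2 σ) (B : L2 (𝓕.apply σ)) : ℝ :=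
  ‖A‖ ^ 2 - 2 * (⟪𝓕.adjL2 σ B, A⟫_ℂ).re + ‖B‖ ^ 2

/-- `B` is the generalized conditional expectation `𝓕_* A`: the unique minimizer of
`D_{σ,𝓕}(A, ·)` over `L₂(𝓕σ)`. -/
def IsGCE (σ : DensityOperator H₁) (𝓕 : QuantumChannel H₁ H₂) (A : L2 σ)
    (B : L2 (𝓕.apply σ)) : Prop :=
  {B' | IsMinOn (divergence σ 𝓕 A) Set.univ B'} = {B}

end Channels

/-! ## Bosonic modes: canonical observables, Weyl operators, Gaussian states and channels -/

section Bosons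

/-- The Hilbert space `L²(ℝˢ)` of `s` bosonic modes. -/
abbrev BosonSpace (s : ℕ) : Type := Lp ℂ 2 (volume : Measure (Fin s → ℝ))

/-- The index set of the phase space `ℝ²ˢ`: `(j, 0)` is the index of `qⱼ` (and of `xⱼ`), `(j, 1)`
is the index of `pⱼ` (and of `yⱼ`), so that the lexicographic order is `q₁, p₁, …, q_s, p_s`. -/
abbrev PhaseIndex (s : ℕ) : Type := Fin s × Fin 2

/-- The position operator `(qⱼ ψ)(ξ) = ξⱼ ψ(ξ)`, on its maximal domain. -/
noncomputable def position (s : ℕ) (j : Fin s) : BosonSpace s →ₗ.[ℂ] BosonSpace s where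
  domain :=
    { carrier := {ψ | MemLp (fun ξ => (ξ j : ℂ) * ψ ξ) 2 volume}
      add_mem' := by
        intro ψ χ hψ hχ
        refine MemLp.ae_eq ?_ (MemLp.add hψ hχ)
        filter_upwards [Lp.coeFn_add ψ χ] with ξ h
        rw [h]
        simp [mul_add]
      zero_mem' := by
        refine MemLp.ae_eq ?_ (MemLp.zero (ε := ℂ))
        filter_upwards [Lp.coeFn_zero ℂ 2 (volume : Measure (Fin s → ℝ))] with ξ h
        rw [h]
        simp
      smul_mem' := by
        intro c ψ hψ
        refine MemLp.ae_eq ?_ (MemLp.const_smul hψ c)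
        filter_upwards [Lp.coeFn_smul c ψ] with ξ h
        rw [h]
        simp [mul_left_comm] }
  toFun :=
    { toFun := fun ψ => MemLp.toLp (fun ξ => (ξ j : ℂ) * (ψ : BosonSpace s) ξ) ψ.2
      map_add' := by
        intro ψ χ
        rw [← MemLp.toLp_add]
        refine (MemLp.toLp_eq_toLp_iff _ _).2 ?_
        filter_upwards [Lp.coeFn_add (ψ : BosonSpace s) χ] with ξ h
        rw [Submodule.coe_add, h]
        simp [mul_add]
      map_smul' := by
        intro c ψ
        rw [RingHom.id_apply, ← MemLp.toLp_const_smul]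
        refine (MemLp.toLp_eq_toLp_iff _ _).2 ?_
        filter_upwards [Lp.coeFn_smul c (ψ : BosonSpace s)] with ξ h
        rw [Submodule.coe_smul, h]
        simp [mul_left_comm] }

theorem integrable_test_mul {s : ℕ} {g : (Fin s → ℝ) → ℝ} (hg : Continuous g)
    (hc : HasCompactSupport g) (ψ : BosonSpace s) :
    Integrable (fun ξ => (g ξ : ℂ) * ψ ξ) volume := by
  have h1 : MemLp (fun ξ => (g ξ : ℂ)) 2 (volume : Measure (Fin s → ℝ)) :=
    (hg.memLp_of_hasCompactSupport hc).ofReal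
  exact h1.integrable_mul (Lp.memLp ψ)

/-- The pairs `(ψ, χ)` with `χ = pⱼ ψ = -i ∂ⱼ ψ` in the weak sense:
`∫ (∂ⱼ φ) ψ = - ∫ φ (i χ)` for all test functions `φ ∈ C_c^∞(ℝˢ)`. -/
noncomputable def momentumGraph (s : ℕ) (j : Fin s) :
    Submodule ℂ (BosonSpace s × BosonSpace s) where
  carrier := {p | ∀ φ : (Fin s → ℝ) → ℝ, ContDiff ℝ ∞ φ → HasCompactSupport φ →
    ∫ ξ, ((fderiv ℝ φ ξ (Pi.single j 1) : ℝ) : ℂ) * p.1 ξ =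
      - ∫ ξ, (φ ξ : ℂ) * (Complex.I * p.2 ξ)}
  add_mem' := by
    intro p p' hp hp' φ hφ hc
    have i1 : ∀ ψ : BosonSpace s, Integrable (fun ξ =>
        ((fderiv ℝ φ ξ (Pi.single j 1) : ℝ) : ℂ) * ψ ξ) volume := fun ψ =>
      integrable_test_mul (by fun_prop (disch := simp)) (hc.fderiv_apply ℝ _) ψ
    have i2 : ∀ ψ : BosonSpace s, Integrable (fun ξ =>
        (φ ξ : ℂ) * (Complex.I * ψ ξ)) volume := fun ψ => by
      simpa [mul_left_comm] using (integrable_test_mul hφ.continuous hc ψ).const_mul Complex.I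
    have e1 : ∫ ξ, ((fderiv ℝ φ ξ (Pi.single j 1) : ℝ) : ℂ) * (p + p').1 ξ =
        ∫ ξ, (((fderiv ℝ φ ξ (Pi.single j 1) : ℝ) : ℂ) * p.1 ξ +
          ((fderiv ℝ φ ξ (Pi.single j 1) : ℝ) : ℂ) * p'.1 ξ) := by
      refine integral_congr_ae ?_
      filter_upwards [Lp.coeFn_add p.1 p'.1] with ξ h
      rw [Prod.fst_add, h, Pi.add_apply, mul_add]
    have e2 : ∫ ξ, (φ ξ : ℂ) * (Complex.I * (p + p').2 ξ) =
        ∫ ξ, ((φ ξ : ℂ) * (Complex.I * p.2 ξ) + (φ ξ : ℂ) * (Complex.I * p'.2 ξ)) := by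
      refine integral_congr_ae ?_
      filter_upwards [Lp.coeFn_add p.2 p'.2] with ξ h
      rw [Prod.snd_add, h, Pi.add_apply, mul_add, mul_add]
    rw [e1, e2, integral_add (i1 _) (i1 _), integral_add (i2 _) (i2 _), hp φ hφ hc, hp' φ hφ hc,
      neg_add]
  zero_mem' := by
    intro φ _ _
    have h : ((0 : BosonSpace s × BosonSpace s).1 : (Fin s → ℝ) → ℂ) =ᵐ[volume] 0 :=
      Lp.coeFn_zero ℂ 2 volume
    have e1 : ∫ ξ, ((fderiv ℝ φ ξ (Pi.single j 1) : ℝ) : ℂ) *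
        (0 : BosonSpace s × BosonSpace s).1 ξ = 0 := by
      refine integral_eq_zero_of_ae ?_
      filter_upwards [h] with ξ h
      rw [h]; simp
    have e2 : ∫ ξ, (φ ξ : ℂ) * (Complex.I * (0 : BosonSpace s × BosonSpace s).2 ξ) = 0 := by
      refine integral_eq_zero_of_ae ?_
      filter_upwards [h] with ξ h
      change (φ ξ : ℂ) * (Complex.I * (0 : BosonSpace s × BosonSpace s).1 ξ) = 0
      rw [h]; simp
    rw [e1, e2, neg_zero]
  smul_mem' := by
    intro c p hp φ hφ hc
    have e1 : ∫ ξ, ((fderiv ℝ φ ξ (Pi.single j 1) : ℝ) : ℂ) * (c • p).1 ξ =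
        ∫ ξ, c * (((fderiv ℝ φ ξ (Pi.single j 1) : ℝ) : ℂ) * p.1 ξ) := by
      refine integral_congr_ae ?_
      filter_upwards [Lp.coeFn_smul c p.1] with ξ h
      rw [Prod.smul_fst, h, Pi.smul_apply, smul_eq_mul, mul_left_comm]
    have e2 : ∫ ξ, (φ ξ : ℂ) * (Complex.I * (c • p).2 ξ) =
        ∫ ξ, c * ((φ ξ : ℂ) * (Complex.I * p.2 ξ)) := by
      refine integral_congr_ae ?_
      filter_upwards [Lp.coeFn_smul c p.2] with ξ h
      rw [Prod.smul_snd, h, Pi.smul_apply, smul_eq_mul]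
      ring
    rw [e1, e2, integral_const_mul, integral_const_mul, hp φ hφ hc, mul_neg]

theorem momentumGraph_single_valued (s : ℕ) (j : Fin s) (p : BosonSpace s × BosonSpace s)
    (hp : p ∈ momentumGraph s j) (h0 : p.1 = 0) : p.2 = 0 := by
  obtain ⟨ψ, χ⟩ := p
  subst h0
  have h : ((0 : BosonSpace s) : (Fin s → ℝ) → ℂ) =ᵐ[volume] 0 := Lp.coeFn_zero ℂ 2 volume
  have key : ∀ᵐ ξ ∂(volume : Measure (Fin s → ℝ)), χ ξ = 0 := by
    refine ae_eq_zero_of_integral_contDiff_smul_eq_zero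
      ((Lp.memLp χ).locallyIntegrable (by norm_num)) fun φ hφ hc => ?_
    have h1 := hp φ hφ hc
    have e1 : ∫ ξ, ((fderiv ℝ φ ξ (Pi.single j 1) : ℝ) : ℂ) * (0 : BosonSpace s) ξ = 0 := by
      refine integral_eq_zero_of_ae ?_
      filter_upwards [h] with ξ h
      rw [h]; simp
    have e2 : ∫ ξ, (φ ξ : ℂ) * (Complex.I * χ ξ) = Complex.I * ∫ ξ, φ ξ • χ ξ := by
      rw [← integral_const_mul]
      refine integral_congr_ae (Filter.Eventually.of_forall fun ξ => ?_)
      simp [mul_left_comm]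
    change ∫ ξ, ((fderiv ℝ φ ξ (Pi.single j 1) : ℝ) : ℂ) * (0 : BosonSpace s) ξ =
      - ∫ ξ, (φ ξ : ℂ) * (Complex.I * χ ξ) at h1
    rw [e1, e2] at h1
    simpa using h1.symm
  exact (Lp.eq_zero_iff_ae_eq_zero).2 key

/-- The momentum operator `pⱼ = -i ∂ⱼ`, with the weak derivative, on its maximal domain. -/
noncomputable def momentum (s : ℕ) (j : Fin s) : BosonSpace s →ₗ.[ℂ] BosonSpace s :=
  (momentumGraph s j).toLinearPMap

/-- The canonical observables `Q = (q₁, p₁, …, q_s, p_s)`. -/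
noncomputable def canonicalObs (s : ℕ) (k : PhaseIndex s) : BosonSpace s →ₗ.[ℂ] BosonSpace s :=
  if k.2 = 0 then position s k.1 else momentum s k.1

/-- The real multiple `c I` of the identity operator. -/
noncomputable def scalarOp (s : ℕ) (c : ℝ) : BosonSpace s →ₗ.[ℂ] BosonSpace s :=
  ((c : ℂ) • (LinearMap.id : BosonSpace s →ₗ[ℂ] BosonSpace s)).toPMap ⊤

/-- Multiplication by a measurable function of modulus one. -/
noncomputable def modulation {s : ℕ} (c : (Fin s → ℝ) → ℂ) (hc : Measurable c)
    (h1 : ∀ ξ, ‖c ξ‖ = 1) : BosonSpace s →L[ℂ] BosonSpace s :=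
  have hm : ∀ ψ : BosonSpace s, MemLp (fun ξ => c ξ * ψ ξ) 2 volume := fun ψ =>
    (Lp.memLp ψ).of_le (hc.aestronglyMeasurable.mul (Lp.aestronglyMeasurable ψ))
      (Filter.Eventually.of_forall fun ξ => by simp [h1])
  LinearMap.mkContinuous
    { toFun := fun ψ => (hm ψ).toLp (fun ξ => c ξ * ψ ξ)
      map_add' := by
        intro ψ χ
        rw [← MemLp.toLp_add]
        refine (MemLp.toLp_eq_toLp_iff _ _).2 ?_
        filter_upwards [Lp.coeFn_add ψ χ] with ξ h
        rw [h]
        simp [mul_add]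
      map_smul' := by
        intro a ψ
        rw [RingHom.id_apply, ← MemLp.toLp_const_smul]
        refine (MemLp.toLp_eq_toLp_iff _ _).2 ?_
        filter_upwards [Lp.coeFn_smul a ψ] with ξ h
        rw [h]
        simp [mul_left_comm] } 1 (fun ψ => by
      rw [one_mul]
      refine Lp.norm_le_norm_of_ae_le ?_
      filter_upwards [(hm ψ).coeFn_toLp] with ξ h
      change ‖((hm ψ).toLp (fun ξ => c ξ * ψ ξ)) ξ‖ ≤ _
      rw [h, norm_mul, h1, one_mul])

/-- The translation `ψ ↦ ψ(· + y)`, that is `exp(i ∑ⱼ yⱼ pⱼ)`. -/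
noncomputable def translation {s : ℕ} (y : Fin s → ℝ) : BosonSpace s →L[ℂ] BosonSpace s :=
  (Lp.compMeasurePreservingₗᵢ ℂ (fun ξ : Fin s → ℝ => ξ + y)
    (measurePreserving_add_right volume y)).toContinuousLinearMap

/-- The phase `ξ ↦ exp(i ∑ⱼ xⱼ ξⱼ + (i/2) ∑ⱼ xⱼ yⱼ)`. -/
noncomputable def weylPhase {s : ℕ} (z : PhaseIndex s → ℝ) (ξ : Fin s → ℝ) : ℂ :=
  Complex.exp ((((∑ j, z (j, 0) * ξ j) + (1 / 2) * (∑ j, z (j, 0) * z (j, 1)) : ℝ) : ℂ) *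
    Complex.I)

/-- The Weyl operator `W(z) = exp(i Qᵀ z)`, `z = (x₁, y₁, …, x_s, y_s)`; explicitly
`(W(z) ψ)(ξ) = exp(i ∑ⱼ xⱼ ξⱼ + (i/2) ∑ⱼ xⱼ yⱼ) ψ(ξ + y)`. -/
noncomputable def weyl {s : ℕ} (z : PhaseIndex s → ℝ) : BosonSpace s →L[ℂ] BosonSpace s :=
  modulation (weylPhase z) (by unfold weylPhase; fun_prop)
    (fun ξ => Complex.norm_exp_ofReal_mul_I _) * translation (fun j => z (j, 1))

/-- `exp(i mᵀ z - zᵀ Σ z / 2)`. -/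
noncomputable def gaussianChar {ι : Type*} [Fintype ι] (m : ι → ℝ) (S : Matrix ι ι ℝ)
    (z : ι → ℝ) : ℂ :=
  Complex.exp (Complex.I * ((m ⬝ᵥ z : ℝ) : ℂ) - (1 / 2) * ((z ⬝ᵥ (S *ᵥ z) : ℝ) : ℂ))

/-- `σ` is the Gaussian state with mean vector `m` and covariance matrix `S`:
`S` is symmetric and `Tr σ W(z) = exp(i mᵀ z - zᵀ S z / 2)`. -/
def IsGaussianState {s : ℕ} (σ : DensityOperator (BosonSpace s)) (m : PhaseIndex s → ℝ)
    (S : Matrix (PhaseIndex s) (PhaseIndex s) ℝ) : Prop :=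
  S.IsSymm ∧ ∀ z, trace (σ.toOp * weyl z) = gaussianChar m S z

/-- `𝓕` is the Gaussian channel with transition matrix `F`, displacement `l` and covariance
matrix `R`: `R` is symmetric and `𝓕* W(ζ) = exp(i lᵀ ζ - ζᵀ R ζ / 2) W(Fᵀ ζ)`. -/
def IsGaussianChannel {s t : ℕ} (𝓕 : QuantumChannel (BosonSpace s) (BosonSpace t))
    (F : Matrix (PhaseIndex t) (PhaseIndex s) ℝ) (l : PhaseIndex t → ℝ)
    (R : Matrix (PhaseIndex t) (PhaseIndex t) ℝ) : Prop :=
  R.IsSymm ∧ ∀ ζ, 𝓕.adj (weyl ζ) = gaussianChar l R ζ • weyl (Fᵀ *ᵥ ζ)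

/-- The quadrature operator `uᵀ Q`. -/
noncomputable def quadrature {s : ℕ} (u : PhaseIndex s → ℝ) : BosonSpace s →ₗ.[ℂ] BosonSpace s :=
  ∑ k, (u k : ℂ) • canonicalObs s k

/-- The gain `K = Σ Fᵀ (F Σ Fᵀ + R)⁻¹`. -/
noncomputable def kalmanGain {ι κ : Type*} [Fintype ι] [Fintype κ] [DecidableEq κ]
    (S : Matrix ι ι ℝ) (F : Matrix κ ι ℝ) (R : Matrix κ κ ℝ) : Matrix ι κ ℝ :=
  S * Fᵀ * (F * S * Fᵀ + R)⁻¹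

/-- The operator `uᵀ [m + K (Q̃ - F m - l)]`. -/
noncomputable def kalmanOperator {s t : ℕ} (u m : PhaseIndex s → ℝ)
    (K : Matrix (PhaseIndex s) (PhaseIndex t) ℝ) (F : Matrix (PhaseIndex t) (PhaseIndex s) ℝ)
    (l : PhaseIndex t → ℝ) : BosonSpace t →ₗ.[ℂ] BosonSpace t :=
  ∑ k, (u k : ℂ) • (scalarOp t (m k) +
    ∑ j, (K k j : ℂ) • (canonicalObs t j - scalarOp t ((F *ᵥ m) j) - scalarOp t (l j)))

end Bosons

end GaussianGCE

/-!
The divergence `D(A, B)` is the sum of `‖B - (𝓕*)† A‖²` and a term that does not depend on `B`,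
where `(𝓕*)†` is the Hilbert space adjoint of the contraction `𝓕* : L₂(𝓕σ) → L₂(σ)`. Hence the
generalized conditional expectation of `A` is `(𝓕*)† A`, with minimum divergence
`‖A‖² - ‖(𝓕*)† A‖²` (`divergence_eq`, `isGCE_adjoint`). To identify `(𝓕*)† A` for a quadrature `A`,
its inner products with the Weyl operators are compared with those of the Kalman operator. A
Gaussian channel maps `W(z)` to a multiple of `W(Fᵀ z)`, and the output state is Gaussian with
covariance `F S Fᵀ + R`, so that everything reduces to the moments of Gaussian states and to the
identity `K (F S Fᵀ + R) = S Fᵀ` (`adjoint_adjL2_affineObs`). Four ingredients carry the argument.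

*Quadratures as elements of `L₂(ρ)`.* The class of a canonical observable is the limit of the
difference quotients `(W(τ e) - 1) / (i τ)`. Along a ray the characteristic function satisfies
`h (t - s) = h t * h (-s) * exp (β s t)`, so that the inner products of two difference quotients
converge and the quotients form a Cauchy family
(`IsGaussianState.tendsto_inner_wVec_weylQuotient`). The same convergence holds at each vector of
the range of `√ρ`, and the limits there are the values of position (multiplication) and momentum
(weak derivative), by `canonicalObs_graph_mem_of_tendsto`. The prescribed distances to bounded
operators follow by passing to the limit (`Approximates.represents`).

*Moments.* Inner products of quadratures with Weyl operators and with each other are derivatives of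
the characteristic function (`IsGaussianState.inner_weyl_affineObs`,
`IsGaussianState.norm_affineObs_sq`).

*Totality of the Weyl operators in `L₂(ρ)`* (`eq_zero_of_inner_weyl_eq_zero`). Injectivity of the
Fourier transform shows that an operator commuting with all Weyl operators is a scalar
(`eq_smul_one_of_commute_weyl`). The pairing with an element of `L₂(ρ)` is a sum of two
Hilbert–Schmidt pairings, that is, a matrix element of `B ⊗ 1` on square-summable families, and the
double commutant argument `inner_ampliation_eq_zero` shows that it vanishes for every bounded `B`
if it vanishes for the Weyl operators.

*Nondegenerate covariance* (`IsGaussianState.isUnit`). If the variance in a direction `w` were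
zero, the operators `W(t w)` would act on the state as scalars, which contradicts the commutation
relations because a Gaussian characteristic function has no zeros.

In the classical model, the gain makes the estimation error uncorrelated with the observation,
hence independent of it by joint Gaussianity (`indepFun_error_observation`), and the conditional
expectation can be read off (`condExp_linear_gaussian`).
-/

namespace GaussianGCE

open Filter Topology

/-! ### Hilbert–Schmidt representation of the weighted inner product -/

section HilbertSchmidt

variable {H : Type*} [NormedAddCommGroup H] [InnerProductSpace ℂ H] [CompleteSpace H]

theorem norm_apply_sq_le_tsum {X : H →L[ℂ] H} (hX : IsHS X) (v : H) :
    ‖X v‖ ^ 2 ≤ (∑' i, ‖X (basis H i)‖ ^ 2) * ‖v‖ ^ 2 := by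
  have hX' : Summable fun i => ‖X (basis H i)‖ ^ 2 := hX
  set s := ∑' i, ‖X (basis H i)‖ ^ 2 with hs
  have hs0 : 0 ≤ s := tsum_nonneg fun _ => sq_nonneg _
  -- the bound is easier for the adjoint, whose coordinates are the `⟪X eᵢ, w⟫`
  have key : ∀ w, ‖star X w‖ ^ 2 ≤ s * ‖w‖ ^ 2 := by
    intro w
    rw [← (hasSum_norm_sq_basis (star X w)).tsum_eq, hs, ← tsum_mul_right]
    refine (hasSum_norm_sq_basis (star X w)).summable.tsum_le_tsum (fun i => ?_)
      (hX'.mul_right _)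
    rw [ContinuousLinearMap.star_eq_adjoint, ContinuousLinearMap.adjoint_inner_right, ← mul_pow]
    exact pow_le_pow_left₀ (norm_nonneg _) (norm_inner_le_norm _ _) 2
  have hn : ‖X‖ ≤ √s := by
    rw [← norm_star]
    refine ContinuousLinearMap.opNorm_le_bound _ (Real.sqrt_nonneg _) fun w => ?_
    rw [← Real.sqrt_sq (norm_nonneg w), ← Real.sqrt_mul hs0]
    exact Real.le_sqrt_of_sq_le (key w)
  calc ‖X v‖ ^ 2 ≤ (‖X‖ * ‖v‖) ^ 2 := by gcongr; exact X.le_opNorm v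
    _ ≤ (√s * ‖v‖) ^ 2 := by gcongr
    _ = s * ‖v‖ ^ 2 := by rw [mul_pow, Real.sq_sqrt hs0]

theorem hasSum_norm_sq_lp {ι E : Type*} [NormedAddCommGroup E] (x : lp (fun _ : ι => E) 2) :
    HasSum (fun i => ‖x i‖ ^ 2) (‖x‖ ^ 2) := by
  have h := lp.hasSum_norm (p := 2) (by norm_num) x
  simpa using h

/-- The positive square root `√ρ`. -/
noncomputable def sqrtOp (ρ : DensityOperator H) : H →L[ℂ] H := CFC.sqrt ρ.toOp

theorem sqrtOp_mul_self (ρ : DensityOperator H) : sqrtOp ρ * sqrtOp ρ = ρ.toOp :=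
  CFC.sqrt_mul_sqrt_self ρ.toOp ((ContinuousLinearMap.nonneg_iff_isPositive _).2 ρ.isPositive)

theorem star_sqrtOp (ρ : DensityOperator H) : star (sqrtOp ρ) = sqrtOp ρ :=
  (CFC.sqrt_nonneg ρ.toOp).isSelfAdjoint

theorem isHS_sqrtOp (ρ : DensityOperator H) : IsHS (sqrtOp ρ) := by
  refine ((summable_of_mem_traceClass ρ.mem_traceClass).mapL Complex.reCLM).congr fun i => ?_
  have e : ⟪basis H i, ρ.toOp (basis H i)⟫_ℂ =
      ⟪sqrtOp ρ (basis H i), sqrtOp ρ (basis H i)⟫_ℂ := by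
    rw [← sqrtOp_mul_self, mul_apply_eq_comp, ← ContinuousLinearMap.adjoint_inner_left,
      ← ContinuousLinearMap.star_eq_adjoint, star_sqrtOp]
  rw [e]
  exact inner_self_eq_norm_sq (𝕜 := ℂ) _

theorem isHS_mul_sqrtOp (ρ : DensityOperator H) (X : H →L[ℂ] H) : IsHS (X * sqrtOp ρ) :=
  isHS_mul_left (isHS_sqrtOp ρ) X

/-- The Hilbert–Schmidt operator `X √ρ`, as the square-summable family of its values on the fixed
Hilbert basis. -/
noncomputable def wVec (ρ : DensityOperator H) :
    (H →L[ℂ] H) →ₗ[ℂ] lp (fun _ : BasisIndex H => H) 2 where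
  toFun X := ⟨fun i => X (sqrtOp ρ (basis H i)), by
    refine memℓp_gen ?_
    simpa using! isHS_mul_sqrtOp ρ X⟩
  map_add' X Y := by ext; simp; rfl
  map_smul' c X := by ext; simp

theorem wVec_apply (ρ : DensityOperator H) (X : H →L[ℂ] H) (i : BasisIndex H) :
    wVec ρ X i = X (sqrtOp ρ (basis H i)) := rfl

/-- Convergence of `X √ρ` in the Hilbert–Schmidt norm entails convergence of `X` at each vector of
the range of `√ρ`. -/
theorem norm_apply_sqrtOp_le (ρ : DensityOperator H) (X : H →L[ℂ] H) (v : H) :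
    ‖X (sqrtOp ρ v)‖ ≤ ‖wVec ρ X‖ * ‖v‖ := by
  refine (pow_le_pow_iff_left₀ (norm_nonneg _) (by positivity) two_ne_zero).1 ?_
  have h := norm_apply_sq_le_tsum (isHS_mul_sqrtOp ρ X) v
  rw [mul_pow, ← (hasSum_norm_sq_lp (wVec ρ X)).tsum_eq]
  exact h

/-- The Hilbert–Schmidt inner product of `Y √ρ` and `X √ρ` is `tr (ρ Y† X)`. -/
theorem inner_wVec (ρ : DensityOperator H) (Y X : H →L[ℂ] H) :
    ⟪wVec ρ Y, wVec ρ X⟫_ℂ = trace (ρ.toOp * (star Y * X)) := by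
  have h := trace_star_mul_comm_of_HS (isHS_sqrtOp ρ) (isHS_mul_sqrtOp ρ (star Y * X))
  rw [star_sqrtOp, mul_assoc _ (sqrtOp ρ), sqrtOp_mul_self,
    trace_mul_comm _ ρ.mem_traceClass] at h
  rw [← h, lp.inner_eq_tsum]
  refine tsum_congr fun i => ?_
  rw [wVec_apply, wVec_apply, mul_apply_eq_comp (sqrtOp ρ),
    ← ContinuousLinearMap.adjoint_inner_left (sqrtOp ρ),
    ← ContinuousLinearMap.star_eq_adjoint, star_sqrtOp, mul_apply_eq_comp, mul_apply_eq_comp,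
    ContinuousLinearMap.star_eq_adjoint, ContinuousLinearMap.adjoint_inner_right]

theorem inner_toL2 (ρ : DensityOperator H) (B A : H →L[ℂ] H) :
    ⟪toL2 ρ B, toL2 ρ A⟫_ℂ = wInner ρ B A :=
  UniformSpace.Completion.inner_coe _ _

/-- The symmetrized inner product is the average of the Hilbert–Schmidt inner products of `A √ρ`,
`B √ρ` and of `A† √ρ`, `B† √ρ`, the latter in the reverse order. -/
theorem wInner_eq_inner_wVec (ρ : DensityOperator H) (B A : H →L[ℂ] H) :
    wInner ρ B A = (1 / 2) * (⟪wVec ρ B, wVec ρ A⟫_ℂ + ⟪wVec ρ (star A), wVec ρ (star B)⟫_ℂ) := by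
  rw [wInner_eq, inner_wVec, inner_wVec, star_star,
    ← trace_mul_comm _ (mul_mem_traceClass A ρ.mem_traceClass), ← mul_assoc,
    trace_mul_comm _ ρ.mem_traceClass, mul_assoc (star B),
    trace_mul_comm _ (mem_traceClass_mul A ρ.mem_traceClass), mul_assoc, add_comm]

theorem toL2_add (ρ : DensityOperator H) (A B : H →L[ℂ] H) :
    toL2 ρ (A + B) = toL2 ρ A + toL2 ρ B :=
  UniformSpace.Completion.coe_add (α := WOp ρ) _ _

theorem toL2_sub (ρ : DensityOperator H) (A B : H →L[ℂ] H) :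
    toL2 ρ (A - B) = toL2 ρ A - toL2 ρ B :=
  UniformSpace.Completion.coe_sub (α := WOp ρ) _ _

theorem toL2_smul (ρ : DensityOperator H) (c : ℂ) (A : H →L[ℂ] H) :
    toL2 ρ (c • A) = c • toL2 ρ A :=
  (UniformSpace.Completion.toComplL (𝕜 := ℂ) (E := WOp ρ)).map_smul c A

theorem toL2_zero (ρ : DensityOperator H) : toL2 ρ 0 = 0 := by
  simpa using toL2_smul ρ 0 0

theorem norm_toL2_sq (ρ : DensityOperator H) (X : H →L[ℂ] H) :
    ‖toL2 ρ X‖ ^ 2 = (1 / 2) * (‖wVec ρ X‖ ^ 2 + ‖wVec ρ (star X)‖ ^ 2) := by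
  rw [← inner_self_eq_norm_sq (𝕜 := ℂ), ← inner_self_eq_norm_sq (𝕜 := ℂ) (wVec ρ X),
    ← inner_self_eq_norm_sq (𝕜 := ℂ) (wVec ρ (star X)), inner_toL2, wInner_eq_inner_wVec]
  simp

end HilbertSchmidt

/-! ### Unbounded observables as limits of bounded operators -/

section PartialMaps

variable {H : Type*} [NormedAddCommGroup H] [InnerProductSpace ℂ H]

theorem graph_add_mem {f g : H →ₗ.[ℂ] H} {x y z : H} (hf : (x, y) ∈ f.graph)
    (hg : (x, z) ∈ g.graph) : (x, y + z) ∈ (f + g).graph := by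
  rw [LinearPMap.mem_graph_iff] at *
  obtain ⟨⟨a, ha⟩, rfl, rfl⟩ := hf
  obtain ⟨⟨b, hb⟩, hab, rfl⟩ := hg
  obtain rfl : b = a := hab
  exact ⟨⟨b, ha, hb⟩, rfl, rfl⟩

theorem graph_smul_mem {f : H →ₗ.[ℂ] H} {x y : H} (c : ℂ) (hf : (x, y) ∈ f.graph) :
    (x, c • y) ∈ (c • f).graph := by
  rw [LinearPMap.mem_graph_iff] at *
  obtain ⟨⟨a, ha⟩, rfl, rfl⟩ := hf
  exact ⟨⟨a, ha⟩, rfl, rfl⟩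

theorem graph_sub_mem {f g : H →ₗ.[ℂ] H} {x y z : H} (hf : (x, y) ∈ f.graph)
    (hg : (x, z) ∈ g.graph) : (x, y - z) ∈ (f - g).graph := by
  rw [LinearPMap.mem_graph_iff] at *
  obtain ⟨⟨a, ha⟩, rfl, rfl⟩ := hf
  obtain ⟨⟨b, hb⟩, hab, rfl⟩ := hg
  obtain rfl : b = a := hab
  exact ⟨⟨b, ha, hb⟩, rfl, rfl⟩

variable [CompleteSpace H]

/-- `(A, a)` is approximated by bounded operators `B τ` as `τ → 0`, `τ ≠ 0`: the operators `B τ`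
converge to `A` pointwise on the range of `√ρ`, the Hilbert–Schmidt operators `B τ √ρ` and
`(B τ)† √ρ` converge to a common limit, and `B τ` converges to `a` in `L₂(ρ)`.  The common limit
reflects the symmetry of `A`. -/
def Approximates (ρ : DensityOperator H) (B : ℝ → H →L[ℂ] H) (A : H →ₗ.[ℂ] H) (a : L2 ρ) : Prop :=
  (∀ v, ∃ y, (sqrtOp ρ v, y) ∈ A.graph ∧ Tendsto (fun τ => B τ (sqrtOp ρ v)) (𝓝[≠] 0) (𝓝 y)) ∧
  (∃ T, Tendsto (fun τ => wVec ρ (B τ)) (𝓝[≠] 0) (𝓝 T) ∧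
    Tendsto (fun τ => wVec ρ (star (B τ))) (𝓝[≠] 0) (𝓝 T)) ∧
  Tendsto (fun τ => toL2 ρ (B τ)) (𝓝[≠] 0) (𝓝 a)

namespace Approximates

variable {ρ : DensityOperator H} {B C : ℝ → H →L[ℂ] H} {A A' : H →ₗ.[ℂ] H} {a a' : L2 ρ}

theorem add (h : Approximates ρ B A a) (h' : Approximates ρ C A' a') :
    Approximates ρ (fun τ => B τ + C τ) (A + A') (a + a') := by
  obtain ⟨h1, ⟨T, h2, h3⟩, h4⟩ := h
  obtain ⟨h1', ⟨T', h2', h3'⟩, h4'⟩ := h'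
  refine ⟨fun v => ?_, ⟨T + T', ?_, ?_⟩, ?_⟩
  · obtain ⟨y, hy, ht⟩ := h1 v
    obtain ⟨z, hz, ht'⟩ := h1' v
    exact ⟨y + z, graph_add_mem hy hz, ht.add ht'⟩
  · simpa only [map_add] using h2.add h2'
  · simpa only [star_add, map_add] using h3.add h3'
  · simpa only [toL2_add] using h4.add h4'

theorem real_smul (h : Approximates ρ B A a) (c : ℝ) :
    Approximates ρ (fun τ => (c : ℂ) • B τ) ((c : ℂ) • A) ((c : ℂ) • a) := by
  obtain ⟨h1, ⟨T, h2, h3⟩, h4⟩ := h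
  refine ⟨fun v => ?_, ⟨(c : ℂ) • T, ?_, ?_⟩, ?_⟩
  · obtain ⟨y, hy, ht⟩ := h1 v
    exact ⟨(c : ℂ) • y, graph_smul_mem _ hy, ht.const_smul _⟩
  · simpa only [map_smul] using h2.const_smul (c : ℂ)
  · simpa only [star_smul, map_smul, Complex.star_def, Complex.conj_ofReal]
      using h3.const_smul (c : ℂ)
  · simpa only [toL2_smul] using h4.const_smul (c : ℂ)

theorem sub (h : Approximates ρ B A a) (h' : Approximates ρ C A' a') :
    Approximates ρ (fun τ => B τ - C τ) (A - A') (a - a') := by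
  obtain ⟨h1, ⟨T, h2, h3⟩, h4⟩ := h
  obtain ⟨h1', ⟨T', h2', h3'⟩, h4'⟩ := h'
  refine ⟨fun v => ?_, ⟨T - T', ?_, ?_⟩, ?_⟩
  · obtain ⟨y, hy, ht⟩ := h1 v
    obtain ⟨z, hz, ht'⟩ := h1' v
    exact ⟨y - z, graph_sub_mem hy hz, ht.sub ht'⟩
  · simpa only [map_sub] using h2.sub h2'
  · simpa only [star_sub, map_sub] using h3.sub h3'
  · simpa only [toL2_sub] using h4.sub h4'

theorem zero (ρ : DensityOperator H) : Approximates ρ (fun _ => 0) 0 0 := by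
  refine ⟨fun v => ⟨0, ?_, by simp⟩, ⟨0, by simp, by simp⟩, by simp [toL2_zero]⟩
  rw [LinearPMap.mem_graph_iff]
  exact ⟨⟨sqrtOp ρ v, trivial⟩, rfl, rfl⟩

theorem sum {ι : Type*} (s : Finset ι) {B : ι → ℝ → H →L[ℂ] H} {A : ι → H →ₗ.[ℂ] H}
    {a : ι → L2 ρ} (h : ∀ k, Approximates ρ (B k) (A k) (a k)) :
    Approximates ρ (fun τ => ∑ k ∈ s, B k τ) (∑ k ∈ s, A k) (∑ k ∈ s, a k) := by
  classical
  induction s using Finset.induction_on with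
  | empty => simpa using zero ρ
  | insert k s hk ih => simpa only [Finset.sum_insert hk] using (h k).add ih

/-- An approximated element is the class of the operator: the distances to a bounded operator `X`
are the limits of the distances from `X` to the approximants. -/
theorem represents (h : Approximates ρ B A a) : Represents ρ A a := by
  obtain ⟨h1, ⟨T, h2, h3⟩, h4⟩ := h
  have hA : ∀ v, sqrtOp ρ v ∈ A.domain := fun v => by
    obtain ⟨y, hy, -⟩ := h1 v
    exact LinearPMap.mem_domain_of_mem_graph hy
  have hT : ∀ i, A ⟨sqrtOp ρ (basis H i), hA _⟩ = T i := by
    intro i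
    obtain ⟨y, hy, ht⟩ := h1 (basis H i)
    have e : A ⟨sqrtOp ρ (basis H i), hA _⟩ = y :=
      (LinearPMap.mem_graph_snd_inj A (LinearPMap.mem_graph A ⟨sqrtOp ρ (basis H i), hA _⟩)
        hy rfl)
    rw [e]
    exact tendsto_nhds_unique ht (((lp.evalCLM ℂ (fun _ : BasisIndex H => H) 2 i).continuous.tendsto
      T).comp h2)
  refine ⟨hA, fun X => ?_⟩
  have hl : Tendsto (fun τ => ‖toL2 ρ (X - B τ)‖ ^ 2) (𝓝[≠] 0) (𝓝 (‖toL2 ρ X - a‖ ^ 2)) := by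
    simp only [toL2_sub]
    exact ((tendsto_const_nhds.sub h4).norm).pow 2
  have hr : Tendsto (fun τ => ‖toL2 ρ (X - B τ)‖ ^ 2) (𝓝[≠] 0)
      (𝓝 ((1 / 2) * (‖wVec ρ X - T‖ ^ 2 + ‖wVec ρ (star X) - T‖ ^ 2))) := by
    simp only [norm_toL2_sq, star_sub, map_sub]
    exact ((((tendsto_const_nhds.sub h2).norm).pow 2).add
      (((tendsto_const_nhds.sub h3).norm).pow 2)).const_mul _
  rw [tendsto_nhds_unique hl hr]
  convert! ((hasSum_norm_sq_lp (wVec ρ X - T)).add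
    (hasSum_norm_sq_lp (wVec ρ (star X) - T))).mul_left (1 / 2) using 4 with i
  · congr 3; exact hT i
  · congr 3; exact hT i

end Approximates

end PartialMaps

/-! ### The Weyl relations -/

section WeylRelations

variable {s : ℕ}

/-- The symplectic form `∑ⱼ (x'ⱼ yⱼ - xⱼ y'ⱼ)` on the phase space. -/
def symplectic (z w : PhaseIndex s → ℝ) : ℝ :=
  ∑ j, (w (j, 0) * z (j, 1) - z (j, 0) * w (j, 1))

theorem modulation_ae {c : (Fin s → ℝ) → ℂ} (hc : Measurable c) (h1 : ∀ ξ, ‖c ξ‖ = 1)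
    (ψ : BosonSpace s) : modulation c hc h1 ψ =ᵐ[volume] fun ξ => c ξ * ψ ξ :=
  MemLp.coeFn_toLp ((Lp.memLp ψ).of_le (hc.aestronglyMeasurable.mul (Lp.aestronglyMeasurable ψ))
    (Filter.Eventually.of_forall fun ξ => by simp [h1]))

theorem translation_ae (y : Fin s → ℝ) (ψ : BosonSpace s) :
    translation y ψ =ᵐ[volume] fun ξ => ψ (ξ + y) :=
  Lp.coeFn_compMeasurePreserving ψ (measurePreserving_add_right volume y)

theorem measurable_weylPhase (z : PhaseIndex s → ℝ) : Measurable (weylPhase z) := by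
  unfold weylPhase
  fun_prop

theorem norm_weylPhase (z : PhaseIndex s → ℝ) (ξ : Fin s → ℝ) : ‖weylPhase z ξ‖ = 1 :=
  Complex.norm_exp_ofReal_mul_I _

theorem weyl_ae (z : PhaseIndex s → ℝ) (ψ : BosonSpace s) :
    weyl z ψ =ᵐ[volume] fun ξ => weylPhase z ξ * ψ (ξ + fun j => z (j, 1)) := by
  unfold weyl
  rw [mul_apply_eq_comp]
  filter_upwards [modulation_ae (measurable_weylPhase z) (norm_weylPhase z)
    (translation (fun j => z (j, 1)) ψ), translation_ae (fun j => z (j, 1)) ψ] with ξ h1 h2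
  rw [h1, h2]

theorem norm_weyl_apply (z : PhaseIndex s → ℝ) (ψ : BosonSpace s) : ‖weyl z ψ‖ = ‖ψ‖ := by
  have h2 : ‖translation (fun j => z (j, 1)) ψ‖ = ‖ψ‖ :=
    (Lp.compMeasurePreservingₗᵢ ℂ (fun ξ : Fin s → ℝ => ξ + fun j => z (j, 1))
      (measurePreserving_add_right volume _)).norm_map ψ
  rw [← h2]
  unfold weyl
  rw [mul_apply_eq_comp]
  rw [Lp.norm_def, Lp.norm_def]
  congr 1
  refine eLpNorm_congr_norm_ae ?_
  filter_upwards [modulation_ae (measurable_weylPhase z) (norm_weylPhase z)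
    (translation (fun j => z (j, 1)) ψ)] with ξ h1
  rw [h1, norm_mul, norm_weylPhase, one_mul]

theorem weyl_zero : weyl (0 : PhaseIndex s → ℝ) = 1 := by
  refine ContinuousLinearMap.ext fun ψ => Lp.ext ?_
  filter_upwards [weyl_ae 0 ψ] with ξ h
  have e : (fun j => (0 : PhaseIndex s → ℝ) (j, 1)) = (0 : Fin s → ℝ) := rfl
  rw [h, e, add_zero]
  simp [weylPhase]

/-- The Weyl form of the canonical commutation relations. -/
theorem weyl_mul_weyl (z w : PhaseIndex s → ℝ) : weyl z * weyl w =
    Complex.exp (((symplectic z w / 2 : ℝ) : ℂ) * Complex.I) • weyl (z + w) := by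
  refine ContinuousLinearMap.ext fun ψ => Lp.ext ?_
  rw [smul_apply, mul_apply_eq_comp]
  have hw := (measurePreserving_add_right (volume : Measure (Fin s → ℝ))
    (fun j => z (j, 1))).quasiMeasurePreserving.ae (weyl_ae w ψ)
  filter_upwards [weyl_ae z (weyl w ψ), hw, weyl_ae (z + w) ψ,
    Lp.coeFn_smul (Complex.exp (((symplectic z w / 2 : ℝ) : ℂ) * Complex.I)) (weyl (z + w) ψ)]
    with ξ h1 h2 h3 h4
  have e : (fun j => (z + w) (j, 1)) = (fun j => z (j, 1)) + fun j => w (j, 1) := rfl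
  rw [h1, h2, h4, Pi.smul_apply, h3, smul_eq_mul, ← mul_assoc, ← mul_assoc, e, add_assoc]
  congr 1
  unfold weylPhase
  rw [← Complex.exp_add, ← Complex.exp_add, ← add_mul, ← add_mul]
  congr 2
  norm_cast
  simp only [symplectic, Finset.mul_sum, Finset.sum_div, ← Finset.sum_add_distrib, Pi.add_apply]
  refine Finset.sum_congr rfl fun j _ => ?_
  ring

theorem star_weyl (z : PhaseIndex s → ℝ) : star (weyl z) = weyl (-z) := by
  have h1 : star (weyl z) * weyl z = 1 := by
    rw [ContinuousLinearMap.star_eq_adjoint]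
    exact (ContinuousLinearMap.norm_map_iff_adjoint_comp_self _).1 (norm_weyl_apply z)
  have h2 : weyl z * weyl (-z) = 1 := by
    have e : symplectic z (-z) = 0 := by
      unfold symplectic
      refine Finset.sum_eq_zero fun j _ => ?_
      simp only [Pi.neg_apply]
      ring
    rw [weyl_mul_weyl, e, add_neg_cancel, weyl_zero]
    simp
  exact left_inv_eq_right_inv h1 h2

theorem symplectic_smul_smul (z : PhaseIndex s → ℝ) (a b : ℝ) :
    symplectic (a • z) (b • z) = 0 := by
  unfold symplectic
  refine Finset.sum_eq_zero fun j _ => ?_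
  simp only [Pi.smul_apply, smul_eq_mul]
  ring

theorem weyl_smul_mul_weyl_smul (z : PhaseIndex s → ℝ) (a b : ℝ) :
    weyl (a • z) * weyl (b • z) = weyl ((a + b) • z) := by
  rw [weyl_mul_weyl, symplectic_smul_smul, add_smul]
  simp

end WeylRelations

/-! ### Uniqueness of Fourier transforms -/

section Fourier

variable {s : ℕ}

theorem norm_character (x ξ : Fin s → ℝ) :
    ‖Complex.exp (((∑ j, x j * ξ j : ℝ) : ℂ) * Complex.I)‖ = 1 :=
  Complex.norm_exp_ofReal_mul_I _

theorem integrable_character_mul {f : (Fin s → ℝ) → ℂ} (hf : Integrable f) (x : Fin s → ℝ) :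
    Integrable fun ξ => Complex.exp (((∑ j, x j * ξ j : ℝ) : ℂ) * Complex.I) * f ξ :=
  hf.bdd_mul (c := 1) (Continuous.aestronglyMeasurable (by fun_prop))
    (Filter.Eventually.of_forall fun ξ => (norm_character x ξ).le)

/-- The real case of the injectivity of the Fourier transform is the statement that a finite
measure is determined by its characteristic function, applied to the positive and the negative
part. -/
theorem ae_eq_zero_of_fourier_eq_zero_real {f : (Fin s → ℝ) → ℝ} (hf : Integrable f)
    (h : ∀ x : Fin s → ℝ,
      ∫ ξ, Complex.exp (((∑ j, x j * ξ j : ℝ) : ℂ) * Complex.I) * (f ξ : ℂ) = 0) :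
    f =ᵐ[volume] 0 := by
  -- the measures with densities `f⁺` and `f⁻` have the same characteristic function
  have hchar : ∀ {g : (Fin s → ℝ) → ℝ}, Integrable g → ∀ L : StrongDual ℝ (Fin s → ℝ),
      charFunDual (volume.withDensity fun ξ => ENNReal.ofReal (g ξ)) L =
        ∫ ξ, Complex.exp (((∑ j, L (Pi.single j 1) * ξ j : ℝ) : ℂ) * Complex.I) *
          ((max (g ξ) 0 : ℝ) : ℂ) := by
    intro g hg L
    rw [charFunDual_apply, integral_withDensity_eq_integral_toReal_smul₀
      hg.aemeasurable.ennreal_ofReal (Filter.Eventually.of_forall fun _ => ENNReal.ofReal_lt_top)]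
    refine integral_congr_ae (Filter.Eventually.of_forall fun ξ => ?_)
    have e : L ξ = ∑ j, L (Pi.single j 1) * ξ j := by
      conv_lhs => rw [pi_eq_sum_univ' ξ]
      simp [mul_comm]
    simp only [e, Complex.real_smul, ENNReal.toReal_ofReal']
    rw [mul_comm]
  have h1 := isFiniteMeasure_withDensity_ofReal hf.2
  have h2 := isFiniteMeasure_withDensity_ofReal hf.neg.2
  have key : (volume.withDensity fun ξ => ENNReal.ofReal (f ξ)) =
      volume.withDensity fun ξ => ENNReal.ofReal ((-f) ξ) := by
    refine Measure.ext_of_charFunDual (funext fun L => ?_)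
    rw [hchar hf, hchar hf.neg, ← sub_eq_zero, ← integral_sub, ← h fun j => L (Pi.single j 1)]
    · refine integral_congr_ae (Filter.Eventually.of_forall fun ξ => ?_)
      simp only [← mul_sub, ← Complex.ofReal_sub, Pi.neg_apply]
      congr 3
      rcases le_total 0 (f ξ) with h0 | h0
      · simp [h0]
      · simp [h0]
    · exact integrable_character_mul hf.pos_part.ofReal _
    · exact integrable_character_mul hf.neg.pos_part.ofReal _
  rw [withDensity_eq_iff hf.aemeasurable.ennreal_ofReal hf.neg.aemeasurable.ennreal_ofReal
    (by simpa using hf.lintegral_lt_top.ne)] at key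
  filter_upwards [key] with ξ hξ
  rcases le_total 0 (f ξ) with h0 | h0
  · have : ENNReal.ofReal ((-f) ξ) = 0 := ENNReal.ofReal_eq_zero.2 (by simpa using h0)
    rw [this, ENNReal.ofReal_eq_zero] at hξ
    exact le_antisymm hξ h0
  · have : ENNReal.ofReal (f ξ) = 0 := ENNReal.ofReal_eq_zero.2 h0
    rw [this, eq_comm, ENNReal.ofReal_eq_zero] at hξ
    exact le_antisymm h0 (by simpa using hξ)

/-- Injectivity of the Fourier transform on `L¹(ℝˢ)`. -/
theorem ae_eq_zero_of_fourier_eq_zero {f : (Fin s → ℝ) → ℂ} (hf : Integrable f)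
    (h : ∀ x : Fin s → ℝ,
      ∫ ξ, Complex.exp (((∑ j, x j * ξ j : ℝ) : ℂ) * Complex.I) * f ξ = 0) :
    f =ᵐ[volume] 0 := by
  have hc : ∀ x : Fin s → ℝ, ∫ ξ, Complex.exp (((∑ j, x j * ξ j : ℝ) : ℂ) * Complex.I) *
      starRingEnd ℂ (f ξ) = 0 := by
    intro x
    have e := congrArg (starRingEnd ℂ) (h (-x))
    rw [← integral_conj, map_zero] at e
    rw [← e]
    refine integral_congr_ae (Filter.Eventually.of_forall fun ξ => ?_)
    simp only [map_mul, ← Complex.exp_conj, Complex.conj_ofReal, Complex.conj_I]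
    congr 2
    simp
  have hconj : Integrable fun ξ => starRingEnd ℂ (f ξ) :=
    (LinearIsometryEquiv.integrable_comp_iff Complex.conjLIE).2 hf
  have hre := ae_eq_zero_of_fourier_eq_zero_real hf.re fun x => by
    have e : ∀ ξ, Complex.exp (((∑ j, x j * ξ j : ℝ) : ℂ) * Complex.I) * ((f ξ).re : ℂ) =
        (1 / 2) * (Complex.exp (((∑ j, x j * ξ j : ℝ) : ℂ) * Complex.I) * f ξ +
          Complex.exp (((∑ j, x j * ξ j : ℝ) : ℂ) * Complex.I) * starRingEnd ℂ (f ξ)) := by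
      intro ξ
      rw [Complex.re_eq_add_conj]
      ring
    simp only [RCLike.re_to_complex, e]
    rw [integral_const_mul, integral_add (integrable_character_mul hf x)
      (integrable_character_mul hconj x), h, hc]
    simp
  have him := ae_eq_zero_of_fourier_eq_zero_real hf.im fun x => by
    have e : ∀ ξ, Complex.exp (((∑ j, x j * ξ j : ℝ) : ℂ) * Complex.I) * ((f ξ).im : ℂ) =
        (1 / (2 * Complex.I)) * (Complex.exp (((∑ j, x j * ξ j : ℝ) : ℂ) * Complex.I) * f ξ -
          Complex.exp (((∑ j, x j * ξ j : ℝ) : ℂ) * Complex.I) * starRingEnd ℂ (f ξ)) := by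
      intro ξ
      rw [Complex.im_eq_sub_conj]
      ring
    simp only [RCLike.im_to_complex, e]
    rw [integral_const_mul, integral_sub (integrable_character_mul hf x)
      (integrable_character_mul hconj x), h, hc]
    simp
  filter_upwards [hre, him] with ξ h1 h2
  exact Complex.ext h1 h2

end Fourier

/-! ### Irreducibility of the Weyl operators -/

section Irreducibility

variable {s : ℕ}

/-- The point of the phase space with position part `x` and momentum part `y`. -/
def phasePoint (x y : Fin s → ℝ) : PhaseIndex s → ℝ := fun p => if p.2 = 0 then x p.1 else y p.1

theorem phasePoint_zero (x y : Fin s → ℝ) (j : Fin s) : phasePoint x y (j, 0) = x j := by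
  simp [phasePoint]

theorem phasePoint_one (x y : Fin s → ℝ) (j : Fin s) : phasePoint x y (j, 1) = y j := by
  simp [phasePoint]

theorem weylPhase_phasePoint (x y ξ : Fin s → ℝ) : weylPhase (phasePoint x y) ξ =
    Complex.exp ((((1 / 2) * ∑ j, x j * y j : ℝ) : ℂ) * Complex.I) *
      Complex.exp (((∑ j, x j * ξ j : ℝ) : ℂ) * Complex.I) := by
  unfold weylPhase
  rw [← Complex.exp_add, ← add_mul]
  simp only [phasePoint_zero, phasePoint_one]
  congr 2
  push_cast
  ring

theorem inner_weyl_phasePoint (x y : Fin s → ℝ) (ψ χ : BosonSpace s) :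
    ⟪weyl (phasePoint x y) ψ, χ⟫_ℂ =
      Complex.exp (-((((1 / 2) * ∑ j, x j * y j : ℝ) : ℂ) * Complex.I)) *
      ∫ ξ, Complex.exp (((∑ j, (-x) j * ξ j : ℝ) : ℂ) * Complex.I) *
        (starRingEnd ℂ (ψ (ξ + y)) * χ ξ) := by
  rw [L2.inner_def, ← integral_const_mul]
  refine integral_congr_ae ?_
  filter_upwards [weyl_ae (phasePoint x y) ψ] with ξ h
  have e : (fun j => phasePoint x y (j, 1)) = y := funext fun j => phasePoint_one x y j
  rw [h, e, weylPhase_phasePoint, RCLike.inner_apply, map_mul, map_mul, ← Complex.exp_conj,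
    ← Complex.exp_conj, map_mul, map_mul, Complex.conj_ofReal, Complex.conj_ofReal,
    Complex.conj_I, mul_neg]
  simp only [Pi.neg_apply, neg_mul, Finset.sum_neg_distrib, Complex.ofReal_neg, mul_neg]
  ring

theorem integrable_conj_mul (ψ χ : BosonSpace s) (y : Fin s → ℝ) :
    Integrable fun ξ => starRingEnd ℂ (ψ (ξ + y)) * χ ξ := by
  have h1 : MemLp (fun ξ => ψ (ξ + y)) 2 volume :=
    (Lp.memLp ψ).comp_measurePreserving (measurePreserving_add_right volume y)
  exact h1.star.integrable_mul (Lp.memLp χ)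

/-- At a fixed translation part `y`, the matrix elements of the Weyl operators are, up to a phase,
the Fourier transform of `conj (ψ (· + y)) * χ`, and therefore determine this function. -/
theorem ae_eq_of_inner_weyl_eq {ψ χ ψ' χ' : BosonSpace s} (y : Fin s → ℝ)
    (h : ∀ x, ⟪weyl (phasePoint x y) ψ, χ⟫_ℂ = ⟪weyl (phasePoint x y) ψ', χ'⟫_ℂ) :
    ∀ᵐ ξ, starRingEnd ℂ (ψ (ξ + y)) * χ ξ = starRingEnd ℂ (ψ' (ξ + y)) * χ' ξ := by
  have key := ae_eq_zero_of_fourier_eq_zero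
    ((integrable_conj_mul ψ χ y).sub (integrable_conj_mul ψ' χ' y)) fun x => by
      have e := h (-x)
      rw [inner_weyl_phasePoint, inner_weyl_phasePoint, neg_neg] at e
      have e' := mul_left_cancel₀ (Complex.exp_ne_zero _) e
      simp only [Pi.sub_apply, mul_sub]
      rw [integral_sub (integrable_character_mul (integrable_conj_mul ψ χ y) x)
        (integrable_character_mul (integrable_conj_mul ψ' χ' y) x), e', sub_self]
  filter_upwards [key] with ξ hξ
  exact sub_eq_zero.1 hξ

/-- There is a square-integrable function that is positive everywhere. -/
theorem exists_pos_bosonSpace (s : ℕ) : ∃ (w : (Fin s → ℝ) → ℝ) (ψ : BosonSpace s),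
    Measurable w ∧ (∀ ξ, 0 < w ξ) ∧ ψ =ᵐ[volume] fun ξ => (w ξ : ℂ) := by
  obtain ⟨g, hg0, hgm, hg⟩ := exists_pos_lintegral_lt_of_sigmaFinite
    (volume : Measure (Fin s → ℝ)) (ε := 1) one_ne_zero
  have hm : Measurable fun ξ => √(g ξ : ℝ) := by fun_prop
  have h2 : MemLp (fun ξ => √(g ξ : ℝ)) 2 (volume : Measure (Fin s → ℝ)) := by
    rw [memLp_two_iff_integrable_sq hm.aestronglyMeasurable]
    refine ⟨by fun_prop, ?_⟩
    rw [hasFiniteIntegral_iff_enorm]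
    refine lt_of_le_of_lt (lintegral_mono fun ξ => ?_) (hg.trans ENNReal.one_lt_top)
    rw [Real.sq_sqrt (by positivity), Real.enorm_eq_ofReal (by positivity)]
    simp
  refine ⟨fun ξ => √(g ξ : ℝ), h2.ofReal.toLp _, hm, fun ξ => Real.sqrt_pos.2 (hg0 ξ), ?_⟩
  exact h2.ofReal.coeFn_toLp

/-- Irreducibility of the Weyl operators: an operator that commutes with all of them is a scalar. -/
theorem eq_smul_one_of_commute_weyl {C : BosonSpace s →L[ℂ] BosonSpace s}
    (hC : ∀ z, C * weyl z = weyl z * C) : ∃ c : ℂ, C = c • 1 := by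
  obtain ⟨w, Φ, hwm, hw0, hΦ⟩ := exists_pos_bosonSpace s
  have hstar : ∀ z, star C * weyl z = weyl z * star C := by
    intro z
    have h := congrArg star (hC (-z))
    rw [star_mul, star_mul, star_weyl, neg_neg] at h
    exact h.symm
  have hΦy : ∀ y, ∀ᵐ ξ, Φ (ξ + y) = (w (ξ + y) : ℂ) := fun y =>
    (measurePreserving_add_right volume y).quasiMeasurePreserving.ae hΦ
  -- `C Φ / Φ` at `ξ` equals the conjugate of `C* Φ / Φ` at `ξ + y`
  have hE : ∀ y, ∀ᵐ ξ, C Φ ξ / w ξ = starRingEnd ℂ (star C Φ (ξ + y)) / w (ξ + y) := by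
    intro y
    have h := ae_eq_of_inner_weyl_eq (ψ := Φ) (χ := C Φ) (ψ' := star C Φ) (χ' := Φ) y fun x => by
      rw [← ContinuousLinearMap.adjoint_inner_left, ← ContinuousLinearMap.star_eq_adjoint,
        ← mul_apply_eq_comp, hstar, mul_apply_eq_comp]
    filter_upwards [h, hΦy y, hΦ] with ξ h1 h2 h3
    have p1 : (w ξ : ℂ) ≠ 0 := by exact_mod_cast (hw0 ξ).ne'
    have p2 : (w (ξ + y) : ℂ) ≠ 0 := by exact_mod_cast (hw0 (ξ + y)).ne'
    rw [h2, h3, Complex.conj_ofReal] at h1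
    rw [div_eq_div_iff p1 p2, mul_comm, h1]
  have hf : Measurable fun ξ => C Φ ξ / (w ξ : ℂ) :=
    (Lp.stronglyMeasurable _).measurable.div (by fun_prop)
  have hg : Measurable fun ξ => starRingEnd ℂ (star C Φ ξ) / (w ξ : ℂ) :=
    (Complex.continuous_conj.measurable.comp (Lp.stronglyMeasurable _).measurable).div
      (by fun_prop)
  have hms : MeasurableSet {p : (Fin s → ℝ) × (Fin s → ℝ) |
      C Φ p.2 / (w p.2 : ℂ) = starRingEnd ℂ (star C Φ (p.2 + p.1)) / (w (p.2 + p.1) : ℂ)} :=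
    measurableSet_eq_fun (hf.comp measurable_snd)
      (hg.comp (measurable_snd.add measurable_fst))
  -- for a suitable `ξ₀` this holds at almost every `y`, so that `conj (C* Φ) / Φ` is constant
  have hE' := (Measure.ae_ae_comm (μ := volume) (ν := volume) hms).1
    (Filter.Eventually.of_forall hE)
  obtain ⟨ξ₀, hξ₀⟩ := hE'.exists
  set c := C Φ ξ₀ / (w ξ₀ : ℂ) with hc
  have hgc : ∀ᵐ ξ, starRingEnd ℂ (star C Φ ξ) / (w ξ : ℂ) = c := by
    have := (measurePreserving_add_right volume (-ξ₀)).quasiMeasurePreserving.ae hξ₀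
    filter_upwards [this] with ξ h
    rw [add_comm ξ, add_neg_cancel_left] at h
    exact h.symm
  have hCΦ : C Φ = c • Φ := by
    refine Lp.ext ?_
    have h0 := hE 0
    filter_upwards [h0, hgc, hΦ, Lp.coeFn_smul c Φ] with ξ h1 h2 h3 h4
    have p1 : (w ξ : ℂ) ≠ 0 := by exact_mod_cast (hw0 ξ).ne'
    rw [add_zero, h2, div_eq_iff p1] at h1
    rw [h4, Pi.smul_apply, h3, h1, smul_eq_mul]
  -- the vectors `W(x, 0) Φ` are total
  have htot : ∀ χ : BosonSpace s, (∀ z, ⟪weyl z Φ, χ⟫_ℂ = 0) → χ = 0 := by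
    intro χ h
    have h1 := ae_eq_of_inner_weyl_eq (ψ := Φ) (χ := χ) (ψ' := 0) (χ' := 0) 0 fun x => by
      rw [h]; simp
    refine (Lp.eq_zero_iff_ae_eq_zero).2 ?_
    filter_upwards [h1, hΦ, Lp.coeFn_zero ℂ 2 (volume : Measure (Fin s → ℝ))] with ξ h2 h3 h4
    have p1 : (w ξ : ℂ) ≠ 0 := by exact_mod_cast (hw0 ξ).ne'
    rw [add_zero, h3, h4, Complex.conj_ofReal] at h2
    simpa [p1] using h2
  refine ⟨c, ?_⟩
  -- `C* χ` and `conj c • χ` have the same inner products with the vectors `W(z) Φ`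
  have h0 : star C = star c • 1 := by
    refine ContinuousLinearMap.ext fun χ => sub_eq_zero.1 (htot _ fun z => ?_)
    rw [inner_sub_right, ContinuousLinearMap.star_eq_adjoint,
      ContinuousLinearMap.adjoint_inner_right, ← mul_apply_eq_comp, hC, mul_apply_eq_comp, hCΦ,
      map_smul, smul_apply, inner_smul_left, inner_smul_right]
    simp
  rw [← star_star C, h0, star_smul, star_star, star_one]

end Irreducibility

/-! ### Totality of the Weyl operators in the weighted space -/

section Ampliation

variable {H : Type*} [NormedAddCommGroup H] [InnerProductSpace ℂ H]
  {ι : Type*}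

/-- The ampliation `B ⊗ 1` of a bounded operator, acting on square-summable families. -/
noncomputable def ampliation (ι : Type*) (B : H →L[ℂ] H) :
    lp (fun _ : ι => H) 2 →L[ℂ] lp (fun _ : ι => H) 2 :=
  have hs : ∀ x : lp (fun _ : ι => H) 2, Summable fun i => ‖B (x i)‖ ^ 2 := fun x =>
    Summable.of_nonneg_of_le (fun _ => by positivity)
      (fun i => by
        rw [← mul_pow]
        exact pow_le_pow_left₀ (norm_nonneg _) (B.le_opNorm _) 2)
      ((hasSum_norm_sq_lp x).summable.mul_left (‖B‖ ^ 2))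
  LinearMap.mkContinuous
    { toFun := fun x => ⟨fun i => B (x i), memℓp_gen (by simpa using hs x)⟩
      map_add' := fun x y => by ext; simp; rfl
      map_smul' := fun c x => by ext; simp } ‖B‖ fun x => by
    refine (pow_le_pow_iff_left₀ (norm_nonneg _) (by positivity) two_ne_zero).1 ?_
    rw [← (hasSum_norm_sq_lp _).tsum_eq, mul_pow, ← (hasSum_norm_sq_lp x).tsum_eq,
      ← tsum_mul_left]
    refine (hs x).tsum_le_tsum (fun i => ?_)
      ((hasSum_norm_sq_lp x).summable.mul_left (‖B‖ ^ 2))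
    rw [← mul_pow]
    exact pow_le_pow_left₀ (norm_nonneg _) (B.le_opNorm _) 2

theorem ampliation_apply (B : H →L[ℂ] H) (x : lp (fun _ : ι => H) 2) (i : ι) :
    ampliation ι B x i = B (x i) := rfl

theorem ampliation_mul (A B : H →L[ℂ] H) :
    ampliation ι (A * B) = ampliation ι A * ampliation ι B := by
  ext x i
  rfl

theorem ampliation_smul (c : ℂ) (B : H →L[ℂ] H) :
    ampliation ι (c • B) = c • ampliation ι B := by
  ext x i
  rfl

theorem ampliation_single [DecidableEq ι] (B : H →L[ℂ] H) (l : ι) (v : H) :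
    ampliation ι B (lp.single 2 l v) = lp.single 2 l (B v) := by
  ext i
  rw [ampliation_apply]
  rcases eq_or_ne i l with rfl | h
  · simp
  · simp [h]

/-- The element `(x, y)` of the direct sum of two spaces of square-summable families. -/
noncomputable def lpSum {ι κ : Type*} (x : lp (fun _ : ι => H) 2) (y : lp (fun _ : κ => H) 2) :
    lp (fun _ : ι ⊕ κ => H) 2 :=
  ⟨fun k => Sum.elim (fun i => x i) (fun j => y j) k, by
    refine memℓp_gen ?_
    have h := (hasSum_norm_sq_lp x).summable.sum
      (f := fun k : ι ⊕ κ => ‖Sum.elim (fun i => x i) (fun j => y j) k‖ ^ 2)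
      (hasSum_norm_sq_lp y).summable
    simpa using h⟩

theorem inner_lpSum {ι κ : Type*} (x x' : lp (fun _ : ι => H) 2) (y y' : lp (fun _ : κ => H) 2) :
    ⟪lpSum x y, lpSum x' y'⟫_ℂ = ⟪x, x'⟫_ℂ + ⟪y, y'⟫_ℂ := by
  have h := (lp.hasSum_inner x x').sum
    (f := fun k : ι ⊕ κ => ⟪lpSum x y k, lpSum x' y' k⟫_ℂ) (lp.hasSum_inner y y')
  exact (lp.hasSum_inner _ _).unique h

theorem ampliation_lpSum {ι κ : Type*} (B : H →L[ℂ] H) (x : lp (fun _ : ι => H) 2)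
    (y : lp (fun _ : κ => H) 2) :
    ampliation (ι ⊕ κ) B (lpSum x y) = lpSum (ampliation ι B x) (ampliation κ B y) := by
  ext k
  rcases k with i | j <;> rfl

variable [CompleteSpace H]

theorem inner_ampliation_left (B : H →L[ℂ] H) (x y : lp (fun _ : ι => H) 2) :
    ⟪ampliation ι B x, y⟫_ℂ = ⟪x, ampliation ι (star B) y⟫_ℂ := by
  rw [lp.inner_eq_tsum, lp.inner_eq_tsum]
  refine tsum_congr fun i => ?_
  rw [ampliation_apply, ampliation_apply, ContinuousLinearMap.star_eq_adjoint,
    ContinuousLinearMap.adjoint_inner_right]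

/-- The double commutant argument.  The orthogonal projection onto the cyclic subspace of a family
`x` commutes with the ampliations of the operators in `S`, so that its matrix entries commute with
`S` and are scalars; hence it commutes with every ampliation `B ⊗ 1`, and the cyclic subspace
contains `(B ⊗ 1) x`. -/
theorem inner_ampliation_eq_zero {S : Set (H →L[ℂ] H)} (h1 : 1 ∈ S)
    (hstar : ∀ W ∈ S, star W ∈ S)
    (hmul : ∀ W ∈ S, ∀ V ∈ S, ∃ c : ℂ, ∃ U ∈ S, W * V = c • U)
    (hirr : ∀ C : H →L[ℂ] H, (∀ W ∈ S, C * W = W * C) → ∃ c : ℂ, C = c • 1)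
    (x y : lp (fun _ : ι => H) 2) (h : ∀ W ∈ S, ⟪ampliation ι W x, y⟫_ℂ = 0) (B : H →L[ℂ] H) :
    ⟪ampliation ι B x, y⟫_ℂ = 0 := by
  classical
  let M₀ : Submodule ℂ (lp (fun _ : ι => H) 2) :=
    Submodule.span ℂ ((fun W => ampliation ι W x) '' S)
  let M := M₀.topologicalClosure
  have hMc : IsClosed (M : Set (lp (fun _ : ι => H) 2)) := M₀.isClosed_topologicalClosure
  have : CompleteSpace M := hMc.completeSpace_coe
  have hinv : ∀ W ∈ S, ∀ v ∈ M, ampliation ι W v ∈ M := by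
    intro W hW
    have hle : M₀ ≤ M.comap (ampliation ι W : _ →ₗ[ℂ] _) := by
      refine Submodule.span_le.2 ?_
      rintro _ ⟨V, hV, rfl⟩
      obtain ⟨c, U, hU, e⟩ := hmul W hW V hV
      change ampliation ι W (ampliation ι V x) ∈ M
      rw [← mul_apply_eq_comp, ← ampliation_mul, e, ampliation_smul]
      exact M.smul_mem _ (M₀.le_topologicalClosure (Submodule.subset_span ⟨U, hU, rfl⟩))
    exact M₀.topologicalClosure_minimal hle (hMc.preimage (ampliation ι W).continuous)
  have hinv' : ∀ W ∈ S, ∀ v ∈ Mᗮ, ampliation ι W v ∈ Mᗮ := by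
    intro W hW v hv
    rw [Submodule.mem_orthogonal] at hv ⊢
    intro w hw
    have := hv _ (hinv _ (hstar W hW) w hw)
    rwa [inner_ampliation_left, star_star] at this
  let P := M.starProjection
  have hP : ∀ W ∈ S, ∀ v, P (ampliation ι W v) = ampliation ι W (P v) := by
    intro W hW v
    have e : v = P v + (v - P v) := by abel
    have m1 : P v ∈ M := M.starProjection_apply_mem v
    have m2 : v - P v ∈ Mᗮ := M.sub_starProjection_mem_orthogonal v
    conv_lhs => rw [e, map_add, map_add]
    rw [(M.starProjection_eq_self_iff).2 (hinv W hW _ m1),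
      (M.starProjection_apply_eq_zero_iff).2 (hinv' W hW _ m2), add_zero]
  -- the matrix entries of the projection
  let E : ι → ι → H →L[ℂ] H := fun k l =>
    (lp.evalCLM ℂ (fun _ : ι => H) 2 k).comp
      (P.comp (lp.singleContinuousLinearMap ℂ (fun _ : ι => H) 2 l))
  have hE : ∀ k l v, E k l v = P (lp.single 2 l v) k := fun _ _ _ => rfl
  have hEB : ∀ k l v, E k l (B v) = B (E k l v) := by
    intro k l v
    obtain ⟨c, hc⟩ := hirr (E k l) fun W hW => by
      ext1 v
      rw [mul_apply_eq_comp, mul_apply_eq_comp, hE, hE, ← ampliation_single, hP W hW]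
      rfl
    rw [hc]
    simp
  have hPB : P.comp (ampliation ι B) = (ampliation ι B).comp P := by
    refine lp.ext_continuousLinearMap (by norm_num) fun l => ?_
    refine ContinuousLinearMap.ext fun v => lp.ext (funext fun k => ?_)
    change P (ampliation ι B (lp.single 2 l v)) k = B (P (lp.single 2 l v) k)
    rw [ampliation_single]
    exact hEB k l v
  have hxM : x ∈ M := M₀.le_topologicalClosure (Submodule.subset_span ⟨1, h1, rfl⟩)
  have hBx : ampliation ι B x ∈ M := by
    have e := congrArg (fun T => T x) hPB
    simp only [ContinuousLinearMap.comp_apply] at e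
    rw [(M.starProjection_eq_self_iff).2 hxM] at e
    rw [← e]
    exact M.starProjection_apply_mem _
  have hle : M₀ ≤ (ℂ ∙ y)ᗮ := by
    refine Submodule.span_le.2 ?_
    rintro _ ⟨W, hW, rfl⟩
    exact Submodule.mem_orthogonal_singleton_iff_inner_left.2 (h W hW)
  exact Submodule.mem_orthogonal_singleton_iff_inner_left.1
    (M₀.topologicalClosure_minimal hle (Submodule.isClosed_orthogonal _) hBx)

/-- The pairing `⟨·, d⟩_ρ` with an element `d` of `L₂(ρ)` is given by two square-summable families:
the limits of `Xₙ √ρ` and of `Xₙ† √ρ` for bounded operators `Xₙ` converging to `d`. -/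
theorem exists_inner_toL2_eq (ρ : DensityOperator H) (d : L2 ρ) :
    ∃ D D' : lp (fun _ : BasisIndex H => H) 2, ∀ B : H →L[ℂ] H,
      ⟪toL2 ρ B, d⟫_ℂ = (1 / 2) * (⟪wVec ρ B, D⟫_ℂ + ⟪D', wVec ρ (star B)⟫_ℂ) := by
  obtain ⟨X, hX⟩ : ∃ X : ℕ → H →L[ℂ] H, Tendsto (fun n => toL2 ρ (X n)) atTop (𝓝 d) := by
    have hd : d ∈ closure (Set.range fun A : WOp ρ => (A : L2 ρ)) :=
      UniformSpace.Completion.denseRange_coe d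
    obtain ⟨x, hx, hlim⟩ := mem_closure_iff_seq_limit.1 hd
    choose X hX' using hx
    exact ⟨X, hlim.congr fun n => (hX' n).symm⟩
  have hle : ∀ A : H →L[ℂ] H, ‖wVec ρ A‖ ≤ 2 * ‖toL2 ρ A‖ ∧
      ‖wVec ρ (star A)‖ ≤ 2 * ‖toL2 ρ A‖ := by
    intro A
    have h := norm_toL2_sq ρ A
    constructor <;> refine (pow_le_pow_iff_left₀ (norm_nonneg _) (by positivity) two_ne_zero).1 ?_
    · nlinarith [sq_nonneg ‖wVec ρ A‖, sq_nonneg ‖wVec ρ (star A)‖]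
    · nlinarith [sq_nonneg ‖wVec ρ A‖, sq_nonneg ‖wVec ρ (star A)‖]
  have hc := hX.cauchySeq
  have hcauchy : ∀ f : (H →L[ℂ] H) → lp (fun _ : BasisIndex H => H) 2,
      (∀ A B, ‖f A - f B‖ ≤ 2 * ‖toL2 ρ A - toL2 ρ B‖) → CauchySeq fun n => f (X n) := by
    intro f hf
    rw [Metric.cauchySeq_iff] at hc ⊢
    intro ε hε
    obtain ⟨N, hN⟩ := hc (ε / 2) (by positivity)
    refine ⟨N, fun m hm n hn => ?_⟩
    have h1 := hN m hm n hn
    rw [dist_eq_norm] at h1 ⊢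
    linarith [hf (X m) (X n)]
  obtain ⟨D, hD⟩ := cauchySeq_tendsto_of_complete (hcauchy (fun A => wVec ρ A) fun A B => by
    rw [← map_sub, ← toL2_sub]; exact (hle _).1)
  obtain ⟨D', hD'⟩ := cauchySeq_tendsto_of_complete (hcauchy (fun A => wVec ρ (star A))
    fun A B => by rw [← map_sub, ← toL2_sub, ← star_sub]; exact (hle _).2)
  refine ⟨D, D', fun B => ?_⟩
  refine tendsto_nhds_unique (tendsto_const_nhds.inner hX) ?_
  simp only [inner_toL2, wInner_eq_inner_wVec]
  exact ((tendsto_const_nhds.inner hD).add (hD'.inner tendsto_const_nhds)).const_mul _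

/-- By `exists_inner_toL2_eq` the pairing with `d` is, up to the factor `2`, the matrix element of
the ampliations between the vectors `(√ρ, D')` and `(D, √ρ)` of a doubled space of square-summable
families, to which the double commutant argument applies. -/
theorem eq_zero_of_inner_toL2_eq_zero {ρ : DensityOperator H} {S : Set (H →L[ℂ] H)} (h1 : 1 ∈ S)
    (hstar : ∀ W ∈ S, star W ∈ S)
    (hmul : ∀ W ∈ S, ∀ V ∈ S, ∃ c : ℂ, ∃ U ∈ S, W * V = c • U)
    (hirr : ∀ C : H →L[ℂ] H, (∀ W ∈ S, C * W = W * C) → ∃ c : ℂ, C = c • 1)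
    {d : L2 ρ} (h : ∀ W ∈ S, ⟪toL2 ρ W, d⟫_ℂ = 0) : d = 0 := by
  obtain ⟨D, D', hD⟩ := exists_inner_toL2_eq ρ d
  have key : ∀ B : H →L[ℂ] H, ⟪ampliation _ B (lpSum (wVec ρ 1) D'), lpSum D (wVec ρ 1)⟫_ℂ =
      2 * ⟪toL2 ρ B, d⟫_ℂ := by
    intro B
    have e : ∀ A : H →L[ℂ] H, ampliation _ A (wVec ρ 1) = wVec ρ A := fun A => rfl
    rw [ampliation_lpSum, inner_lpSum, hD, inner_ampliation_left B D', e, e]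
    ring
  have hall : ∀ B : H →L[ℂ] H, ⟪toL2 ρ B, d⟫_ℂ = 0 := by
    intro B
    have h0 := inner_ampliation_eq_zero h1 hstar hmul hirr (lpSum (wVec ρ 1) D')
      (lpSum D (wVec ρ 1)) (fun W hW => by rw [key, h W hW, mul_zero]) B
    rw [key] at h0
    simpa using h0
  have hx : ∀ x : L2 ρ, ⟪x, d⟫_ℂ = 0 := by
    intro x
    induction x using UniformSpace.Completion.induction_on with
    | hp => exact isClosed_eq (by fun_prop) (by fun_prop)
    | ih B => exact hall B
  exact inner_self_eq_zero.1 (hx d)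

/-- The Weyl operators are total in `L₂(ρ)`. -/
theorem eq_zero_of_inner_weyl_eq_zero {s : ℕ} {ρ : DensityOperator (BosonSpace s)} {d : L2 ρ}
    (h : ∀ z, ⟪toL2 ρ (weyl z), d⟫_ℂ = 0) : d = 0 := by
  refine eq_zero_of_inner_toL2_eq_zero (S := Set.range weyl) ⟨0, weyl_zero⟩ ?_ ?_ ?_ ?_
  · rintro _ ⟨z, rfl⟩
    exact ⟨-z, (star_weyl z).symm⟩
  · rintro _ ⟨z, rfl⟩ _ ⟨w, rfl⟩
    exact ⟨_, _, ⟨z + w, rfl⟩, weyl_mul_weyl z w⟩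
  · intro C hC
    exact eq_smul_one_of_commute_weyl fun z => hC _ ⟨z, rfl⟩
  · rintro _ ⟨z, rfl⟩
    exact h z

end Ampliation

/-! ### Position and momentum as generators -/

section Generators

variable {s : ℕ}

/-- The difference quotient `(W(τ z) - 1) / (i τ)` of the one-parameter group generated by the
quadrature `zᵀ Q`. -/
noncomputable def weylQuotient (z : PhaseIndex s → ℝ) (τ : ℝ) :
    BosonSpace s →L[ℂ] BosonSpace s :=
  (Complex.I * τ)⁻¹ • (weyl (τ • z) - 1)

theorem star_weylQuotient (z : PhaseIndex s → ℝ) (τ : ℝ) :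
    star (weylQuotient z τ) = weylQuotient z (-τ) := by
  unfold weylQuotient
  rw [star_smul, star_sub, star_weyl, star_one, neg_smul]
  congr 1
  simp

theorem weylQuotient_ae (z : PhaseIndex s → ℝ) (τ : ℝ) (ψ : BosonSpace s) :
    weylQuotient z τ ψ =ᵐ[volume] fun ξ =>
      (Complex.I * τ)⁻¹ * (weylPhase (τ • z) ξ * ψ (ξ + τ • fun j => z (j, 1)) - ψ ξ) := by
  filter_upwards [Lp.coeFn_smul (Complex.I * τ : ℂ)⁻¹ (weyl (τ • z) ψ - ψ),
    Lp.coeFn_sub (weyl (τ • z) ψ) ψ, weyl_ae (τ • z) ψ] with ξ h1 h2 h3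
  change ((Complex.I * τ : ℂ)⁻¹ • (weyl (τ • z) ψ - ψ)) ξ = _
  rw [h1, Pi.smul_apply, h2, Pi.sub_apply, h3]
  rfl

theorem position_graph_mem {j : Fin s} {ψ χ : BosonSpace s}
    (h : χ =ᵐ[volume] fun ξ => (ξ j : ℂ) * ψ ξ) : (ψ, χ) ∈ (position s j).graph := by
  rw [LinearPMap.mem_graph_iff]
  have hm : MemLp (fun ξ => (ξ j : ℂ) * ψ ξ) 2 volume := (Lp.memLp χ).ae_eq h
  exact ⟨⟨ψ, hm⟩, rfl, Lp.ext (hm.coeFn_toLp.trans h.symm)⟩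

theorem momentum_graph_mem {j : Fin s} {ψ χ : BosonSpace s} (h : (ψ, χ) ∈ momentumGraph s j) :
    (ψ, χ) ∈ (momentum s j).graph := by
  unfold momentum
  rwa [Submodule.toLinearPMap_graph_eq _ (momentumGraph_single_valued s j)]

/-- A limit of difference quotients of `exp(i τ qⱼ)` at `ψ` is the value `qⱼ ψ`. -/
theorem position_graph_mem_of_tendsto {j : Fin s} {ψ χ : BosonSpace s}
    (h : Tendsto (fun τ => weylQuotient (Pi.single (j, 0) 1) τ ψ) (𝓝[≠] 0) (𝓝 χ)) :
    (ψ, χ) ∈ (position s j).graph := by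
  refine position_graph_mem ?_
  -- along a sequence `τₙ → 0` the quotients converge almost everywhere
  obtain ⟨τ, hτ⟩ := exists_seq_tendsto (𝓝[≠] (0 : ℝ))
  obtain ⟨n, hn, hlim⟩ := (tendstoInMeasure_of_tendsto_Lp (h.comp hτ)).exists_seq_tendsto_ae
  have hq : ∀ᵐ ξ, ∀ k, weylQuotient (Pi.single (j, 0) 1) (τ k) ψ ξ =
      (Complex.I * τ k)⁻¹ * (Complex.exp ((τ k : ℂ) * ((ξ j : ℂ) * Complex.I)) - 1) * ψ ξ := by
    rw [ae_all_iff]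
    intro k
    filter_upwards [weylQuotient_ae (Pi.single (j, 0) 1) (τ k) ψ] with ξ h1
    have e1 : (fun i => (Pi.single (j, 0) 1 : PhaseIndex s → ℝ) (i, 1)) = 0 := by
      ext i
      simp
    have e2 : weylPhase (τ k • (Pi.single (j, 0) 1 : PhaseIndex s → ℝ)) ξ =
        Complex.exp ((τ k : ℂ) * ((ξ j : ℂ) * Complex.I)) := by
      unfold weylPhase
      congr 1
      simp [Pi.single_apply, mul_assoc]
    rw [h1, e1, e2, smul_zero, add_zero]
    ring
  filter_upwards [hlim, hq] with ξ h1 h2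
  have hd : HasDerivAt (fun t : ℝ => Complex.exp ((t : ℂ) * ((ξ j : ℂ) * Complex.I)))
      ((ξ j : ℂ) * Complex.I) 0 := by
    have h3 : HasDerivAt (fun t : ℂ => Complex.exp (t * ((ξ j : ℂ) * Complex.I)))
        (Complex.exp (((0 : ℝ) : ℂ) * ((ξ j : ℂ) * Complex.I)) * (1 * ((ξ j : ℂ) * Complex.I)))
        ((0 : ℝ) : ℂ) :=
      ((hasDerivAt_id _).mul_const _).cexp
    simpa using h3.comp_ofReal
  have hs := (hasDerivAt_iff_tendsto_slope.1 hd).comp (hτ.comp hn.tendsto_atTop)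
  have hs' := ((hs.const_mul Complex.I⁻¹).mul_const (ψ ξ))
  have e : Complex.I⁻¹ * ((ξ j : ℂ) * Complex.I) * ψ ξ = (ξ j : ℂ) * ψ ξ := by
    field_simp
  rw [e] at hs'
  refine tendsto_nhds_unique h1 (hs'.congr fun k => ?_)
  simp only [Function.comp_apply, h2, slope_def_module, sub_zero, Complex.real_smul]
  simp only [Complex.ofReal_zero, zero_mul, Complex.exp_zero, Complex.ofReal_inv, mul_inv]
  ring

/-- Pairing with a test function is continuous in `L²`. -/
theorem tendsto_integral_mul {ι : Type*} {l : Filter ι} {φ : (Fin s → ℝ) → ℝ} (hφ : Continuous φ)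
    (hc : HasCompactSupport φ) {f : ι → BosonSpace s} {χ : BosonSpace s}
    (h : Tendsto f l (𝓝 χ)) :
    Tendsto (fun i => ∫ ξ, (φ ξ : ℂ) * f i ξ) l (𝓝 (∫ ξ, (φ ξ : ℂ) * χ ξ)) := by
  have h1 : MemLp (fun ξ => (φ ξ : ℂ)) 2 (volume : Measure (Fin s → ℝ)) :=
    (hφ.memLp_of_hasCompactSupport hc).ofReal
  have e : ∀ g : BosonSpace s, ∫ ξ, (φ ξ : ℂ) * g ξ = ⟪h1.toLp _, g⟫_ℂ := by
    intro g
    rw [L2.inner_def]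
    refine integral_congr_ae ?_
    filter_upwards [h1.coeFn_toLp] with ξ h2
    rw [h2, RCLike.inner_apply, Complex.conj_ofReal, mul_comm]
  simp only [e]
  exact tendsto_const_nhds.inner h

/-- The difference quotients of a test function converge weakly against an `L²` function. -/
theorem tendsto_integral_quotient_mul {φ : (Fin s → ℝ) → ℝ} (hφ : ContDiff ℝ ∞ φ)
    (hc : HasCompactSupport φ) (v : Fin s → ℝ) (ψ : BosonSpace s) :
    Tendsto (fun τ : ℝ => ∫ ξ, ((τ⁻¹ * (φ (ξ - τ • v) - φ ξ) : ℝ) : ℂ) * ψ ξ) (𝓝[≠] 0)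
      (𝓝 (- ∫ ξ, ((fderiv ℝ φ ξ v : ℝ) : ℂ) * ψ ξ)) := by
  obtain ⟨C, hC⟩ := (hφ.of_le (by simp : (1 : WithTop ℕ∞) ≤ ∞)).lipschitzWith_of_hasCompactSupport
    hc (by simp)
  -- for `|τ| ≤ 1` the difference quotients are supported in `K` and bounded by `C * ‖v‖`
  set K := Metric.cthickening ‖v‖ (tsupport φ) with hK
  have hKc : IsCompact K := hc.isCompact.cthickening
  have hψ : Integrable (K.indicator fun ξ => (C * ‖v‖) * ‖ψ ξ‖) volume := by
    refine IntegrableOn.integrable_indicator ?_ hKc.measurableSet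
    exact (((Lp.memLp ψ).locallyIntegrable (by norm_num)).integrableOn_isCompact
      hKc).norm.const_mul _
  rw [← integral_neg]
  refine tendsto_integral_filter_of_dominated_convergence _ ?_ ?_ hψ ?_
  · refine Filter.Eventually.of_forall fun τ => ?_
    have hcont : Continuous φ := hφ.continuous
    exact AEStronglyMeasurable.mul (Continuous.aestronglyMeasurable (by fun_prop))
      (Lp.aestronglyMeasurable ψ)
  · have h1 : ∀ᶠ τ : ℝ in 𝓝[≠] 0, |τ| ≤ 1 ∧ τ ≠ 0 := by
      refine Filter.Eventually.and (nhdsWithin_le_nhds ?_) self_mem_nhdsWithin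
      exact (continuous_abs.tendsto' (0 : ℝ) 0 abs_zero).eventually_le_const one_pos
    filter_upwards [h1] with τ hτ
    refine Filter.Eventually.of_forall fun ξ => ?_
    by_cases hξ : ξ ∈ K
    · rw [Set.indicator_of_mem hξ, norm_mul, Complex.norm_real, norm_mul, norm_inv]
      have h2 : ‖φ (ξ - τ • v) - φ ξ‖ ≤ C * (‖τ‖ * ‖v‖) := by
        have := hC.dist_le_mul (ξ - τ • v) ξ
        rwa [dist_eq_norm, dist_eq_norm, sub_sub_cancel_left, norm_neg, norm_smul] at this
      have h3 : 0 < ‖τ‖ := norm_pos_iff.2 hτ.2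
      refine mul_le_mul_of_nonneg_right ?_ (norm_nonneg _)
      rw [inv_mul_le_iff₀ h3]
      linarith
    · have h2 : φ ξ = 0 := by
        by_contra h0
        exact hξ (Metric.self_subset_cthickening _ (subset_tsupport φ h0))
      have h3 : φ (ξ - τ • v) = 0 := by
        by_contra h0
        refine hξ (Metric.mem_cthickening_of_dist_le ξ (ξ - τ • v) _ _
          (subset_tsupport φ h0) ?_)
        rw [dist_eq_norm, sub_sub_cancel, norm_smul]
        exact mul_le_of_le_one_left (norm_nonneg _) hτ.1
      rw [Set.indicator_of_notMem hξ, h2, h3]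
      simp
  · refine Filter.Eventually.of_forall fun ξ => ?_
    have hd : HasDerivAt (fun τ : ℝ => φ (ξ - τ • v)) (-(fderiv ℝ φ ξ v)) 0 := by
      have h1 : HasDerivAt (fun τ : ℝ => ξ - τ • v) (-((1 : ℝ) • v)) 0 :=
        ((hasDerivAt_id (0 : ℝ)).smul_const v).const_sub ξ
      have h2 : HasFDerivAt φ (fderiv ℝ φ ξ) (ξ - (0 : ℝ) • v) := by
        rw [zero_smul, sub_zero]
        exact (hφ.differentiable (by simp) ξ).hasFDerivAt
      have h3 := h2.comp_hasDerivAt (0 : ℝ) h1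
      simpa only [one_smul, map_neg] using! h3
    have h2 := (Complex.continuous_ofReal.tendsto _).comp (hasDerivAt_iff_tendsto_slope.1 hd)
    have h3 := h2.mul_const (ψ ξ)
    rw [Complex.ofReal_neg, neg_mul] at h3
    refine h3.congr fun τ => ?_
    simp [slope_def_module]

/-- A limit of difference quotients of `exp(i τ pⱼ)` at `ψ` is the value `pⱼ ψ`. -/
theorem momentum_graph_mem_of_tendsto {j : Fin s} {ψ χ : BosonSpace s}
    (h : Tendsto (fun τ => weylQuotient (Pi.single (j, 1) 1) τ ψ) (𝓝[≠] 0) (𝓝 χ)) :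
    (ψ, χ) ∈ (momentum s j).graph := by
  refine momentum_graph_mem fun φ hφ hc => ?_
  have hint := fun χ : BosonSpace s => integrable_test_mul hφ.continuous hc χ
  have h1 := (tendsto_integral_mul hφ.continuous hc h).const_mul Complex.I
  have h2 := tendsto_integral_quotient_mul hφ hc (Pi.single j 1) ψ
  have e : ∀ τ : ℝ, Complex.I * ∫ ξ, (φ ξ : ℂ) * weylQuotient (Pi.single (j, 1) 1) τ ψ ξ =
      ∫ ξ, ((τ⁻¹ * (φ (ξ - τ • (Pi.single j 1 : Fin s → ℝ)) - φ ξ) : ℝ) : ℂ) * ψ ξ := by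
    intro τ
    have hmp := measurePreserving_add_right (volume : Measure (Fin s → ℝ))
      (τ • (Pi.single j 1 : Fin s → ℝ))
    have e1 : ∀ᵐ ξ, (φ ξ : ℂ) * weylQuotient (Pi.single (j, 1) 1) τ ψ ξ =
        (Complex.I * τ)⁻¹ * ((φ ξ : ℂ) * ψ (ξ + τ • (Pi.single j 1 : Fin s → ℝ)) -
          (φ ξ : ℂ) * ψ ξ) := by
      filter_upwards [weylQuotient_ae (Pi.single (j, 1) 1) τ ψ] with ξ h1
      have e1 : (fun i => (Pi.single (j, 1) 1 : PhaseIndex s → ℝ) (i, 1)) = Pi.single j 1 := by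
        ext i
        simp [Pi.single_apply]
      have e2 : weylPhase (τ • (Pi.single (j, 1) 1 : PhaseIndex s → ℝ)) ξ = 1 := by
        unfold weylPhase
        simp
      rw [h1, e1, e2]
      ring
    -- the translation is moved to the test function by a change of variables
    have e2 : ∫ ξ, (φ ξ : ℂ) * ψ (ξ + τ • (Pi.single j 1 : Fin s → ℝ)) =
        ∫ ξ, (φ (ξ - τ • (Pi.single j 1 : Fin s → ℝ)) : ℂ) * ψ ξ := by
      rw [← integral_add_right_eq_self (μ := (volume : Measure (Fin s → ℝ)))
        (fun ξ => (φ (ξ - τ • (Pi.single j 1 : Fin s → ℝ)) : ℂ) * ψ ξ)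
        (τ • (Pi.single j 1 : Fin s → ℝ))]
      simp
    have i1 : Integrable (fun ξ => (φ (ξ - τ • (Pi.single j 1 : Fin s → ℝ)) : ℂ) * ψ ξ) :=
      integrable_test_mul (g := fun ξ => φ (ξ - τ • (Pi.single j 1 : Fin s → ℝ)))
        (by have := hφ.continuous; fun_prop)
        (hc.comp_homeomorph (Homeomorph.subRight (τ • (Pi.single j 1 : Fin s → ℝ)))) ψ
    have i2 : Integrable (fun ξ => (φ ξ : ℂ) * ψ (ξ + τ • (Pi.single j 1 : Fin s → ℝ))) := by
      have := i1.comp_add_right (τ • (Pi.single j 1 : Fin s → ℝ))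
      simpa using this
    rw [integral_congr_ae e1, integral_const_mul, integral_sub i2 (hint ψ), e2,
      ← integral_sub i1 (hint ψ), ← mul_assoc, ← integral_const_mul]
    refine integral_congr_ae (Filter.Eventually.of_forall fun ξ => ?_)
    simp only [mul_inv, ← mul_assoc, mul_inv_cancel₀ Complex.I_ne_zero]
    push_cast
    ring
  have h3 := tendsto_nhds_unique (h1.congr e) h2
  rw [← neg_eq_iff_eq_neg] at h3
  change ∫ ξ, ((fderiv ℝ φ ξ (Pi.single j 1) : ℝ) : ℂ) * ψ ξ = - ∫ ξ, (φ ξ : ℂ) * (Complex.I * χ ξ)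
  rw [← h3, ← integral_const_mul]
  congr 1
  refine integral_congr_ae (Filter.Eventually.of_forall fun ξ => ?_)
  simp only
  ring

/-- Strong limits of the difference quotients of the Weyl group lie on the graph of the canonical
observable, in its domain as defined by multiplication or by weak derivatives. -/
theorem canonicalObs_graph_mem_of_tendsto {k : PhaseIndex s} {ψ χ : BosonSpace s}
    (h : Tendsto (fun τ => weylQuotient (Pi.single k 1) τ ψ) (𝓝[≠] 0) (𝓝 χ)) :
    (ψ, χ) ∈ (canonicalObs s k).graph := by
  obtain ⟨j, i⟩ := k
  unfold canonicalObs
  fin_cases i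
  · exact position_graph_mem_of_tendsto h
  · exact momentum_graph_mem_of_tendsto h

end Generators

/-! ### Gaussian characteristic functions -/

section GaussianCharacter

variable {ι : Type*} [Fintype ι] {m : ι → ℝ} {S : Matrix ι ι ℝ}

theorem dotProduct_mulVec_comm_of_isSymm (hS : S.IsSymm) (v w : ι → ℝ) :
    v ⬝ᵥ (S *ᵥ w) = w ⬝ᵥ (S *ᵥ v) := by
  rw [Matrix.dotProduct_mulVec, ← Matrix.mulVec_transpose, hS.eq, dotProduct_comm]

/-- The failure of a Gaussian characteristic function to be a character is the exponential of its
covariance form. -/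
theorem gaussianChar_add (hS : S.IsSymm) (v w : ι → ℝ) : gaussianChar m S (v + w) =
    gaussianChar m S v * gaussianChar m S w * Complex.exp (-((v ⬝ᵥ (S *ᵥ w) : ℝ) : ℂ)) := by
  unfold gaussianChar
  rw [← Complex.exp_add, ← Complex.exp_add]
  congr 1
  rw [Matrix.mulVec_add, dotProduct_add, add_dotProduct, dotProduct_add, dotProduct_add,
    dotProduct_mulVec_comm_of_isSymm hS w v]
  push_cast
  ring

theorem gaussianChar_smul (v : ι → ℝ) (t : ℝ) : gaussianChar m S (t • v) =
    Complex.exp (Complex.I * ((m ⬝ᵥ v : ℝ) : ℂ) * t -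
      (1 / 2) * ((v ⬝ᵥ (S *ᵥ v) : ℝ) : ℂ) * t ^ 2) := by
  unfold gaussianChar
  rw [Matrix.mulVec_smul, dotProduct_smul, dotProduct_smul, smul_dotProduct]
  congr 1
  simp only [smul_eq_mul]
  push_cast
  ring

theorem gaussianChar_zero : gaussianChar m S 0 = 1 := by
  simp [gaussianChar]

theorem gaussianChar_ne_zero (z : ι → ℝ) : gaussianChar m S z ≠ 0 := Complex.exp_ne_zero _

theorem star_gaussianChar (z : ι → ℝ) :
    starRingEnd ℂ (gaussianChar m S z) = gaussianChar m S (-z) := by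
  unfold gaussianChar
  rw [← Complex.exp_conj, Matrix.mulVec_neg, dotProduct_neg, neg_dotProduct, dotProduct_neg,
    neg_neg]
  congr 1
  simp only [map_sub, map_mul, Complex.conj_I, Complex.conj_ofReal, map_div₀, map_one,
    Complex.conj_ofNat]
  push_cast
  ring

theorem norm_gaussianChar (z : ι → ℝ) :
    ‖gaussianChar m S z‖ = Real.exp (-(1 / 2) * (z ⬝ᵥ (S *ᵥ z))) := by
  unfold gaussianChar
  rw [Complex.norm_exp]
  congr 1
  simp

theorem hasDerivAt_gaussianChar_smul (v : ι → ℝ) :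
    HasDerivAt (fun t : ℝ => gaussianChar m S (t • v)) (Complex.I * ((m ⬝ᵥ v : ℝ) : ℂ)) 0 := by
  simp only [gaussianChar_smul]
  set a : ℂ := Complex.I * ((m ⬝ᵥ v : ℝ) : ℂ)
  set b : ℂ := (1 / 2) * ((v ⬝ᵥ (S *ᵥ v) : ℝ) : ℂ)
  have h : HasDerivAt (fun t : ℂ => Complex.exp (a * t - b * t ^ 2))
      (Complex.exp (a * ((0 : ℝ) : ℂ) - b * ((0 : ℝ) : ℂ) ^ 2) *
        (a * 1 - b * (((2 : ℕ) : ℂ) * ((0 : ℝ) : ℂ) ^ (2 - 1) * 1))) ((0 : ℝ) : ℂ) :=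
    (((hasDerivAt_id _).const_mul a).sub (((hasDerivAt_id _).pow 2).const_mul b)).cexp
  simpa using h.comp_ofReal

end GaussianCharacter

/-! ### Convergence criteria in Hilbert spaces -/

section HilbertLimits

variable {E : Type*} [NormedAddCommGroup E] [InnerProductSpace ℂ E]

/-- A family of vectors is Cauchy as soon as its matrix of inner products converges. -/
theorem cauchy_map_of_tendsto_inner {ι : Type*} {l : Filter ι} [l.NeBot] {x : ι → E} {c : ℂ}
    (h : Tendsto (fun p : ι × ι => ⟪x p.1, x p.2⟫_ℂ) (l ×ˢ l) (𝓝 c)) : Cauchy (map x l) := by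
  have hd : Tendsto (fun i => ‖x i‖ ^ 2) l (𝓝 c.re) := by
    have := (Complex.continuous_re.tendsto _).comp (h.comp tendsto_diag)
    refine this.congr fun i => ?_
    exact inner_self_eq_norm_sq (𝕜 := ℂ) _
  have h2 : Tendsto (fun p : ι × ι => ‖x p.1 - x p.2‖ ^ 2) (l ×ˢ l) (𝓝 0) := by
    have h3 := ((hd.comp tendsto_fst).sub
      (((Complex.continuous_re.tendsto _).comp h).const_mul 2)).add (hd.comp tendsto_snd)
    have e : c.re - 2 * c.re + c.re = 0 := by ring
    rw [e] at h3
    refine h3.congr fun p => ?_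
    rw [@norm_sub_sq ℂ]
    rfl
  rw [cauchy_map_iff, tendsto_uniformity_iff_dist_tendsto_zero]
  refine ⟨inferInstance, ?_⟩
  have h3 := (Real.continuous_sqrt.tendsto _).comp h2
  rw [Real.sqrt_zero] at h3
  refine h3.congr fun p => ?_
  simp [Real.sqrt_sq (norm_nonneg _), dist_eq_norm]

/-- Convergence of `B √ρ` and of `B† √ρ` in the Hilbert–Schmidt norm entails convergence in
`L₂(ρ)`. -/
theorem exists_tendsto_toL2 {H : Type*} [NormedAddCommGroup H] [InnerProductSpace ℂ H]
    [CompleteSpace H] {ρ : DensityOperator H} {ι : Type*} {l : Filter ι} [l.NeBot]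
    {B : ι → H →L[ℂ] H} {T T' : lp (fun _ : BasisIndex H => H) 2}
    (h : Tendsto (fun i => wVec ρ (B i)) l (𝓝 T))
    (h' : Tendsto (fun i => wVec ρ (star (B i))) l (𝓝 T')) :
    ∃ a, Tendsto (fun i => toL2 ρ (B i)) l (𝓝 a) := by
  have h2 : Tendsto (fun p : ι × ι => ‖toL2 ρ (B p.1) - toL2 ρ (B p.2)‖ ^ 2) (l ×ˢ l) (𝓝 0) := by
    simp only [← toL2_sub, norm_toL2_sq, star_sub, map_sub]
    have e : (1 / 2 : ℝ) * (‖T - T‖ ^ 2 + ‖T' - T'‖ ^ 2) = 0 := by simp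
    rw [← e]
    exact (((((h.comp tendsto_fst).sub (h.comp tendsto_snd)).norm).pow 2).add
      ((((h'.comp tendsto_fst).sub (h'.comp tendsto_snd)).norm).pow 2)).const_mul _
  have hc : Cauchy (map (fun i => toL2 ρ (B i)) l) := by
    rw [cauchy_map_iff, tendsto_uniformity_iff_dist_tendsto_zero]
    refine ⟨inferInstance, ?_⟩
    have h3 := (Real.continuous_sqrt.tendsto _).comp h2
    rw [Real.sqrt_zero] at h3
    refine h3.congr fun p => ?_
    simp [Real.sqrt_sq (norm_nonneg _), dist_eq_norm]
  exact cauchy_iff_exists_le_nhds.1 hc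

end HilbertLimits

/-! ### Canonical observables in the weighted space of a Gaussian state -/

section GaussianStates

variable {s : ℕ} {ρ : DensityOperator (BosonSpace s)} {m : PhaseIndex s → ℝ}
  {S : Matrix (PhaseIndex s) (PhaseIndex s) ℝ}

theorem symplectic_neg_left (z w : PhaseIndex s → ℝ) : symplectic (-z) w = -symplectic z w := by
  unfold symplectic
  rw [← Finset.sum_neg_distrib]
  refine Finset.sum_congr rfl fun j _ => ?_
  simp only [Pi.neg_apply]
  ring

theorem symplectic_neg_swap (z w : PhaseIndex s → ℝ) : symplectic w (-z) = symplectic z w := by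
  unfold symplectic
  refine Finset.sum_congr rfl fun j _ => ?_
  simp only [Pi.neg_apply]
  ring

theorem symplectic_smul_right (z w : PhaseIndex s → ℝ) (t : ℝ) :
    symplectic z (t • w) = t * symplectic z w := by
  unfold symplectic
  rw [Finset.mul_sum]
  refine Finset.sum_congr rfl fun j _ => ?_
  simp only [Pi.smul_apply, smul_eq_mul]
  ring

theorem IsGaussianState.inner_wVec_weyl (h : IsGaussianState ρ m S) (z w : PhaseIndex s → ℝ) :
    ⟪wVec ρ (weyl z), wVec ρ (weyl w)⟫_ℂ =
      Complex.exp (-(((symplectic z w / 2 : ℝ) : ℂ) * Complex.I)) * gaussianChar m S (w - z) := by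
  rw [inner_wVec, star_weyl, weyl_mul_weyl, mul_smul_comm, trace_smul, h.2, symplectic_neg_left,
    neg_add_eq_sub]
  congr 2
  push_cast
  ring

/-- Symmetrizing the product of two Weyl operators replaces the phase of the Weyl relations by a
cosine, which does not contribute to first derivatives at the origin. -/
theorem IsGaussianState.inner_toL2_weyl (h : IsGaussianState ρ m S) (z w : PhaseIndex s → ℝ) :
    ⟪toL2 ρ (weyl z), toL2 ρ (weyl w)⟫_ℂ =
      Complex.cos ((symplectic z w / 2 : ℝ) : ℂ) * gaussianChar m S (w - z) := by
  rw [inner_toL2, wInner_eq_inner_wVec, star_weyl, star_weyl, h.inner_wVec_weyl,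
    h.inner_wVec_weyl]
  have e : symplectic (-w) (-z) = -symplectic z w := by
    rw [symplectic_neg_left, symplectic_neg_swap]
  rw [e, neg_sub_neg, Complex.cos]
  push_cast
  ring_nf

theorem tendsto_neg_nhdsNE_zero : Tendsto (fun t : ℝ => -t) (𝓝[≠] 0) (𝓝[≠] 0) := by
  refine tendsto_nhdsWithin_iff.2 ⟨?_, ?_⟩
  · exact (continuous_neg.tendsto' (0 : ℝ) 0 neg_zero).mono_left nhdsWithin_le_nhds
  · filter_upwards [self_mem_nhdsWithin] with t ht using neg_ne_zero.2 ht

/-- On a single ray of the phase space, the matrix of inner products of the difference quotients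
converges: writing `h t` for the characteristic function at `t e`, one has
`h (t - s) = h t * h (-s) * exp (β s t)`, and the mixed second difference splits into a product of
two difference quotients and a difference quotient of `exp (β ·)`. -/
theorem IsGaussianState.tendsto_inner_wVec_weylQuotient (h : IsGaussianState ρ m S)
    (e : PhaseIndex s → ℝ) :
    Tendsto (fun p : ℝ × ℝ => ⟪wVec ρ (weylQuotient e p.1), wVec ρ (weylQuotient e p.2)⟫_ℂ)
      (𝓝[≠] 0 ×ˢ 𝓝[≠] 0) (𝓝 (((m ⬝ᵥ e) ^ 2 + e ⬝ᵥ (S *ᵥ e) : ℝ) : ℂ)) := by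
  set g : ℝ → ℂ := fun t => gaussianChar m S (t • e) with hg
  set β : ℝ := e ⬝ᵥ (S *ᵥ e) with hβ
  have hg0 : g 0 = 1 := by simp only [hg, zero_smul, gaussianChar_zero]
  have hg' : HasDerivAt g (Complex.I * ((m ⬝ᵥ e : ℝ) : ℂ)) 0 := hasDerivAt_gaussianChar_smul e
  have hW : ∀ a b : ℝ, ⟪wVec ρ (weyl (a • e)), wVec ρ (weyl (b • e))⟫_ℂ = g (b - a) := by
    intro a b
    rw [h.inner_wVec_weyl, symplectic_smul_smul]
    simp [hg, sub_smul]
  have hone : (1 : BosonSpace s →L[ℂ] BosonSpace s) = weyl ((0 : ℝ) • e) := by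
    rw [zero_smul, weyl_zero]
  have hmul : ∀ a b : ℝ, g (b - a) = g b * g (-a) * Complex.exp ((a * b : ℝ) * (β : ℂ)) := by
    intro a b
    simp only [hg]
    rw [sub_eq_add_neg, add_smul, gaussianChar_add h.1, Matrix.mulVec_smul, dotProduct_smul,
      smul_dotProduct]
    congr 2
    simp only [smul_eq_mul, ← hβ]
    push_cast
    ring
  -- `g (b - a) - g b - g (-a) + 1` is the sum of `g b * g (-a) * (exp (a * b * β) - 1)` and
  -- `(g b - 1) * (g (-a) - 1)`
  have hexp : ∀ a b : ℝ, a ≠ 0 → b ≠ 0 →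
      ⟪wVec ρ (weylQuotient e a), wVec ρ (weylQuotient e b)⟫_ℂ =
      g b * g (-a) * slope (fun u : ℝ => Complex.exp ((u : ℂ) * β)) 0 (a * b) -
        slope g 0 b * slope g 0 (-a) := by
    intro a b ha hb
    have ha' : (a : ℂ) ≠ 0 := by exact_mod_cast ha
    have hb' : (b : ℂ) ≠ 0 := by exact_mod_cast hb
    unfold weylQuotient
    rw [hone, map_smul, map_smul, map_sub, map_sub, inner_smul_left, inner_smul_right,
      inner_sub_left, inner_sub_right, inner_sub_right, hW, hW, hW, hW, hmul a b]
    simp only [slope_def_module, hg0, sub_zero, zero_sub, sub_self, Complex.real_smul, map_inv₀,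
      map_mul, Complex.conj_I, Complex.conj_ofReal, Complex.ofReal_inv, Complex.ofReal_mul,
      Complex.ofReal_neg, Complex.ofReal_zero, zero_mul, Complex.exp_zero]
    have hI := Complex.I_mul_I
    field_simp
    rw [pow_two, hI]
    ring
  have t1 : Tendsto (fun p : ℝ × ℝ => p.1 * p.2) (𝓝[≠] 0 ×ˢ 𝓝[≠] 0) (𝓝[≠] (0 : ℝ)) := by
    refine tendsto_nhdsWithin_iff.2 ⟨?_, ?_⟩
    · have : Tendsto (fun p : ℝ × ℝ => p.1 * p.2) (𝓝 0 ×ˢ 𝓝 0) (𝓝 (0 * 0 : ℝ)) :=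
        tendsto_fst.mul tendsto_snd
      rw [mul_zero] at this
      exact this.mono_left (Filter.prod_mono nhdsWithin_le_nhds nhdsWithin_le_nhds)
    · filter_upwards [prod_mem_prod self_mem_nhdsWithin self_mem_nhdsWithin] with p hp
      exact mul_ne_zero hp.1 hp.2
  have hd : HasDerivAt (fun u : ℝ => Complex.exp ((u : ℂ) * β)) (β : ℂ) 0 := by
    have h3 : HasDerivAt (fun u : ℂ => Complex.exp (u * β))
        (Complex.exp (((0 : ℝ) : ℂ) * β) * (1 * (β : ℂ))) ((0 : ℝ) : ℂ) :=
      ((hasDerivAt_id _).mul_const _).cexp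
    simpa using h3.comp_ofReal
  have s1 := (hasDerivAt_iff_tendsto_slope.1 hd).comp t1
  have s2 := hasDerivAt_iff_tendsto_slope.1 hg'
  have s3 : Tendsto g (𝓝[≠] 0) (𝓝 1) := by
    have := hg'.continuousAt.tendsto
    rw [hg0] at this
    exact this.mono_left nhdsWithin_le_nhds
  have key := (((s3.comp tendsto_snd).mul
    ((s3.comp tendsto_neg_nhdsNE_zero).comp tendsto_fst)).mul s1).sub
    ((s2.comp tendsto_snd).mul ((s2.comp tendsto_neg_nhdsNE_zero).comp tendsto_fst))
  have ec : (1 : ℂ) * 1 * (β : ℂ) - Complex.I * ((m ⬝ᵥ e : ℝ) : ℂ) *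
      (Complex.I * ((m ⬝ᵥ e : ℝ) : ℂ)) = (((m ⬝ᵥ e) ^ 2 + β : ℝ) : ℂ) := by
    push_cast
    linear_combination (-(((m ⬝ᵥ e : ℝ) : ℂ)) ^ 2) * Complex.I_mul_I
  rw [ec] at key
  refine key.congr' ?_
  filter_upwards [prod_mem_prod self_mem_nhdsWithin self_mem_nhdsWithin] with p hp
  exact (hexp p.1 p.2 hp.1 hp.2).symm

/-- The canonical observables of a Gaussian state have classes in `L₂(ρ)`, the limits of the
difference quotients of the Weyl operators. -/
theorem IsGaussianState.exists_approximates (h : IsGaussianState ρ m S) (k : PhaseIndex s) :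
    ∃ a : L2 ρ, Approximates ρ (weylQuotient (Pi.single k 1)) (canonicalObs s k) a := by
  obtain ⟨T, hT⟩ : ∃ T, Tendsto (fun τ => wVec ρ (weylQuotient (Pi.single k 1) τ)) (𝓝[≠] 0)
      (𝓝 T) :=
    cauchy_iff_exists_le_nhds.1
      (cauchy_map_of_tendsto_inner (h.tendsto_inner_wVec_weylQuotient (Pi.single k 1)))
  have hT' : Tendsto (fun τ => wVec ρ (star (weylQuotient (Pi.single k 1) τ))) (𝓝[≠] 0)
      (𝓝 T) := by
    simp only [star_weylQuotient]
    exact hT.comp tendsto_neg_nhdsNE_zero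
  obtain ⟨a, ha⟩ := exists_tendsto_toL2 hT hT'
  refine ⟨a, fun v => ?_, ⟨T, hT, hT'⟩, ha⟩
  have hc : Cauchy (map (fun τ => weylQuotient (Pi.single k 1) τ (sqrtOp ρ v)) (𝓝[≠] 0)) := by
    rw [cauchy_map_iff, tendsto_uniformity_iff_dist_tendsto_zero]
    refine ⟨inferInstance, ?_⟩
    have h1 : Tendsto (fun p : ℝ × ℝ => ‖wVec ρ (weylQuotient (Pi.single k 1) p.1) -
        wVec ρ (weylQuotient (Pi.single k 1) p.2)‖ * ‖v‖) (𝓝[≠] 0 ×ˢ 𝓝[≠] 0)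
        (𝓝 (‖T - T‖ * ‖v‖)) :=
      (((hT.comp tendsto_fst).sub (hT.comp tendsto_snd)).norm).mul_const _
    rw [sub_self, norm_zero, zero_mul] at h1
    refine squeeze_zero (fun _ => dist_nonneg) (fun p => ?_) h1
    rw [dist_eq_norm, ← sub_apply, ← map_sub (wVec ρ)]
    exact norm_apply_sqrtOp_le ρ _ v
  obtain ⟨y, hy⟩ := cauchy_iff_exists_le_nhds.1 hc
  exact ⟨y, canonicalObs_graph_mem_of_tendsto hy, hy⟩

theorem approximates_scalarOp (ρ : DensityOperator (BosonSpace s)) (c : ℝ) :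
    Approximates ρ (fun _ => (c : ℂ) • 1) (scalarOp s c) ((c : ℂ) • toL2 ρ 1) := by
  refine ⟨fun v => ⟨(c : ℂ) • sqrtOp ρ v, ?_, tendsto_const_nhds⟩,
    ⟨wVec ρ ((c : ℂ) • 1), tendsto_const_nhds, ?_⟩, ?_⟩
  · rw [LinearPMap.mem_graph_iff]
    exact ⟨⟨sqrtOp ρ v, trivial⟩, rfl, rfl⟩
  · simp only [star_smul, star_one, Complex.star_def, Complex.conj_ofReal]
    exact tendsto_const_nhds
  · rw [← toL2_smul]
    exact tendsto_const_nhds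

end GaussianStates

/-! ### First and second moments -/

section Moments

variable {s : ℕ} {ρ : DensityOperator (BosonSpace s)} {m : PhaseIndex s → ℝ}
  {S : Matrix (PhaseIndex s) (PhaseIndex s) ℝ}

/-- The inner products of a canonical observable with the Weyl operators are the derivatives of
those of the Weyl operators, hence of the characteristic function. -/
theorem IsGaussianState.inner_weyl_of_approximates (h : IsGaussianState ρ m S) {k : PhaseIndex s}
    {a : L2 ρ} (ha : Approximates ρ (weylQuotient (Pi.single k 1)) (canonicalObs s k) a)
    (z : PhaseIndex s → ℝ) :
    ⟪toL2 ρ (weyl z), a⟫_ℂ =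
      gaussianChar m S (-z) * ((m k : ℂ) - Complex.I * ((S *ᵥ z) k : ℝ)) := by
  set e : PhaseIndex s → ℝ := Pi.single k 1 with he
  set f : ℝ → ℂ := fun τ => ⟪toL2 ρ (weyl z), toL2 ρ (weyl (τ • e))⟫_ℂ with hf
  have hfe : ∀ τ : ℝ, f τ = Complex.cos ((τ : ℂ) * ((symplectic z e / 2 : ℝ) : ℂ)) *
      (gaussianChar m S (τ • e) * (gaussianChar m S (-z) *
        Complex.exp ((τ : ℂ) * (((S *ᵥ z) k : ℝ) : ℂ)))) := by
    intro τ
    simp only [hf]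
    rw [h.inner_toL2_weyl, symplectic_smul_right, sub_eq_add_neg, gaussianChar_add h.1,
      Matrix.mulVec_neg, dotProduct_neg, smul_dotProduct, he, single_one_dotProduct, smul_eq_mul,
      mul_assoc (gaussianChar m S _)]
    congr 2
    · push_cast
      ring
    · push_cast
      ring_nf
  have hd : HasDerivAt f (gaussianChar m S (-z) *
      (Complex.I * (m k : ℂ) + (((S *ᵥ z) k : ℝ) : ℂ))) 0 := by
    have h1 : HasDerivAt (fun τ : ℝ => Complex.cos ((τ : ℂ) * ((symplectic z e / 2 : ℝ) : ℂ)))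
        0 0 := by
      have h3 : HasDerivAt (fun u : ℂ => Complex.cos (u * ((symplectic z e / 2 : ℝ) : ℂ)))
          (-Complex.sin (((0 : ℝ) : ℂ) * ((symplectic z e / 2 : ℝ) : ℂ)) *
            (1 * ((symplectic z e / 2 : ℝ) : ℂ))) ((0 : ℝ) : ℂ) :=
        ((hasDerivAt_id _).mul_const _).ccos
      simpa using h3.comp_ofReal
    have h2 : HasDerivAt (fun τ : ℝ => Complex.exp ((τ : ℂ) * (((S *ᵥ z) k : ℝ) : ℂ)))
        (((S *ᵥ z) k : ℝ) : ℂ) 0 := by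
      have h3 : HasDerivAt (fun u : ℂ => Complex.exp (u * (((S *ᵥ z) k : ℝ) : ℂ)))
          (Complex.exp (((0 : ℝ) : ℂ) * (((S *ᵥ z) k : ℝ) : ℂ)) *
            (1 * (((S *ᵥ z) k : ℝ) : ℂ))) ((0 : ℝ) : ℂ) :=
        ((hasDerivAt_id _).mul_const _).cexp
      simpa using h3.comp_ofReal
    have h3 := h1.mul ((hasDerivAt_gaussianChar_smul (m := m) (S := S) e).mul
      (h2.const_mul (gaussianChar m S (-z))))
    have e0 : m ⬝ᵥ e = m k := by rw [he, dotProduct_single_one]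
    refine (h3.congr_deriv ?_).congr_of_eventuallyEq
      (Filter.Eventually.of_forall fun τ => hfe τ)
    simp only [zero_smul, gaussianChar_zero, Complex.ofReal_zero, zero_mul, Complex.exp_zero,
      Complex.cos_zero, e0]
    ring
  have hs := (hasDerivAt_iff_tendsto_slope.1 hd).const_mul Complex.I⁻¹
  have hl : Tendsto (fun τ => ⟪toL2 ρ (weyl z), toL2 ρ (weylQuotient e τ)⟫_ℂ) (𝓝[≠] 0)
      (𝓝 ⟪toL2 ρ (weyl z), a⟫_ℂ) := tendsto_const_nhds.inner ha.2.2
  have hone : (1 : BosonSpace s →L[ℂ] BosonSpace s) = weyl ((0 : ℝ) • e) := by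
    rw [zero_smul, weyl_zero]
  refine (tendsto_nhds_unique hl (hs.congr fun τ => ?_)).trans ?_
  · unfold weylQuotient
    rw [toL2_smul, inner_smul_right, toL2_sub, inner_sub_right, hone]
    simp only [slope_def_module, sub_zero, Complex.real_smul, mul_inv, Complex.ofReal_inv, hf]
    ring
  · rw [Complex.inv_I]
    linear_combination (-(gaussianChar m S (-z) * (m k : ℂ))) * Complex.I_mul_I

/-- Second moments, as derivatives of `IsGaussianState.inner_weyl_of_approximates`. -/
theorem IsGaussianState.inner_of_approximates (h : IsGaussianState ρ m S) {j k : PhaseIndex s}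
    {a b : L2 ρ} (ha : Approximates ρ (weylQuotient (Pi.single j 1)) (canonicalObs s j) a)
    (hb : Approximates ρ (weylQuotient (Pi.single k 1)) (canonicalObs s k) b) :
    ⟪a, b⟫_ℂ = ((m j * m k + S k j : ℝ) : ℂ) := by
  set e : PhaseIndex s → ℝ := Pi.single j 1 with he
  -- the sign accounts for the conjugate-linearity of the inner product in the first variable
  set f : ℝ → ℂ := fun τ => ⟪toL2 ρ (weyl ((-τ) • e)), b⟫_ℂ with hf
  have hSe : (S *ᵥ e) k = S k j := by rw [he, Matrix.mulVec_single_one]; rfl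
  have hfe : ∀ τ : ℝ, f τ = gaussianChar m S (τ • e) *
      ((m k : ℂ) + (τ : ℂ) * (Complex.I * (S k j : ℝ))) := by
    intro τ
    simp only [hf]
    rw [h.inner_weyl_of_approximates hb, Matrix.mulVec_smul, neg_smul, neg_neg, Pi.smul_apply,
      hSe, smul_eq_mul]
    push_cast
    ring
  have hd : HasDerivAt f (Complex.I * ((m j * m k + S k j : ℝ) : ℂ)) 0 := by
    have h2 : HasDerivAt (fun τ : ℝ => (m k : ℂ) + (τ : ℂ) * (Complex.I * (S k j : ℝ)))
        (Complex.I * (S k j : ℝ)) 0 := by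
      have h3 : HasDerivAt (fun u : ℂ => (m k : ℂ) + u * (Complex.I * (S k j : ℝ)))
          (1 * (Complex.I * (S k j : ℝ))) ((0 : ℝ) : ℂ) :=
        ((hasDerivAt_id _).mul_const _).const_add _
      simpa using h3.comp_ofReal
    have h3 := (hasDerivAt_gaussianChar_smul (m := m) (S := S) e).mul h2
    have e0 : m ⬝ᵥ e = m j := by rw [he, dotProduct_single_one]
    refine (h3.congr_deriv ?_).congr_of_eventuallyEq
      (Filter.Eventually.of_forall fun τ => hfe τ)
    simp only [zero_smul, gaussianChar_zero, Complex.ofReal_zero, zero_mul, e0]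
    push_cast
    ring
  have hs := ((hasDerivAt_iff_tendsto_slope.1 hd).comp tendsto_neg_nhdsNE_zero).const_mul
    (-Complex.I)
  have hl : Tendsto (fun τ => ⟪toL2 ρ (weylQuotient e τ), b⟫_ℂ) (𝓝[≠] 0) (𝓝 ⟪a, b⟫_ℂ) :=
    ha.2.2.inner tendsto_const_nhds
  have hone : (1 : BosonSpace s →L[ℂ] BosonSpace s) = weyl ((-0 : ℝ) • e) := by
    rw [neg_zero, zero_smul, weyl_zero]
  refine (tendsto_nhds_unique hl (hs.congr fun τ => ?_)).trans ?_
  · unfold weylQuotient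
    rw [toL2_smul, inner_smul_left, toL2_sub, inner_sub_left, hone]
    simp only [slope_def_module, sub_zero, Complex.real_smul, mul_inv, hf,
      Function.comp_apply, neg_neg, map_mul, map_inv₀, Complex.conj_I, Complex.conj_ofReal,
      Complex.ofReal_inv, Complex.ofReal_neg, inv_neg, Complex.inv_I, map_neg]
    ring
  · linear_combination (-((m j * m k + S k j : ℝ) : ℂ)) * Complex.I_mul_I

/-- The element `c + ∑ₖ uₖ qₖ` of `L₂(ρ)`. -/
noncomputable def affineObs (q : PhaseIndex s → L2 ρ) (c : ℝ) (u : PhaseIndex s → ℝ) : L2 ρ :=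
  (c : ℂ) • toL2 ρ 1 + ∑ k, (u k : ℂ) • q k

variable {q : PhaseIndex s → L2 ρ}

theorem IsGaussianState.inner_weyl_affineObs (h : IsGaussianState ρ m S)
    (hq : ∀ k, Approximates ρ (weylQuotient (Pi.single k 1)) (canonicalObs s k) (q k))
    (c : ℝ) (u z : PhaseIndex s → ℝ) :
    ⟪toL2 ρ (weyl z), affineObs q c u⟫_ℂ = gaussianChar m S (-z) *
      (((c + m ⬝ᵥ u : ℝ) : ℂ) - Complex.I * ((u ⬝ᵥ (S *ᵥ z) : ℝ) : ℂ)) := by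
  unfold affineObs
  rw [inner_add_right, inner_sum, inner_smul_right, ← weyl_zero, h.inner_toL2_weyl]
  simp only [inner_smul_right, h.inner_weyl_of_approximates (hq _)]
  have e : symplectic z 0 = 0 := by simp [symplectic]
  rw [e, zero_sub]
  simp only [dotProduct, Complex.ofReal_add, Complex.ofReal_sum, Complex.ofReal_mul,
    Finset.mul_sum, mul_sub, mul_add, Finset.sum_sub_distrib]
  have e1 : ∀ k, (u k : ℂ) * (gaussianChar m S (-z) * (m k : ℂ)) =
    gaussianChar m S (-z) * ((m k : ℂ) * (u k : ℂ)) := fun k => by ring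
  have e2 : ∀ k, (u k : ℂ) * (gaussianChar m S (-z) * (Complex.I * (((S *ᵥ z) k : ℝ) : ℂ))) =
    gaussianChar m S (-z) * (Complex.I * ((u k : ℂ) * (((S *ᵥ z) k : ℝ) : ℂ))) :=
    fun k => by ring
  simp only [e1, e2]
  simp
  ring

theorem IsGaussianState.norm_affineObs_sq (h : IsGaussianState ρ m S)
    (hq : ∀ k, Approximates ρ (weylQuotient (Pi.single k 1)) (canonicalObs s k) (q k))
    (c : ℝ) (u : PhaseIndex s → ℝ) :
    ‖affineObs q c u‖ ^ 2 = (c + m ⬝ᵥ u) ^ 2 + u ⬝ᵥ (S *ᵥ u) := by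
  have h1 : ⟪toL2 ρ 1, affineObs q c u⟫_ℂ = ((c + m ⬝ᵥ u : ℝ) : ℂ) := by
    rw [← weyl_zero, h.inner_weyl_affineObs hq]
    simp [gaussianChar_zero]
  have h2 : ∀ j, ⟪q j, affineObs q c u⟫_ℂ =
      ((m j * (c + m ⬝ᵥ u) + (S *ᵥ u) j : ℝ) : ℂ) := by
    intro j
    have h3 : ⟪q j, toL2 ρ 1⟫_ℂ = (m j : ℂ) := by
      rw [← inner_conj_symm, ← weyl_zero, h.inner_weyl_of_approximates (hq j)]
      simp [gaussianChar_zero]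
    unfold affineObs
    rw [inner_add_right, inner_sum, inner_smul_right, h3]
    simp only [inner_smul_right, h.inner_of_approximates (hq _) (hq _)]
    simp only [← Complex.ofReal_mul, ← Complex.ofReal_sum, ← Complex.ofReal_add]
    congr 1
    rw [mul_add, add_assoc, mul_comm c]
    congr 1
    simp only [dotProduct, Matrix.mulVec, Finset.mul_sum, ← Finset.sum_add_distrib]
    refine Finset.sum_congr rfl fun k _ => ?_
    rw [h.1.apply]
    ring
  rw [← inner_self_eq_norm_sq (𝕜 := ℂ)]
  have h3 : ⟪affineObs q c u, affineObs q c u⟫_ℂ =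
      (((c + m ⬝ᵥ u) ^ 2 + u ⬝ᵥ (S *ᵥ u) : ℝ) : ℂ) := by
    conv_lhs => rw [affineObs.eq_1 q c u, inner_add_left, inner_smul_left, sum_inner]
    simp only [← affineObs.eq_1, inner_smul_left, h1, h2, Complex.conj_ofReal]
    simp only [← Complex.ofReal_mul, ← Complex.ofReal_sum, ← Complex.ofReal_add]
    congr 1
    simp only [mul_add, Finset.sum_add_distrib]
    have e : ∑ k, u k * (m k * c) + ∑ k, u k * (m k * m ⬝ᵥ u) = (m ⬝ᵥ u) * (c + m ⬝ᵥ u) := by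
      simp only [← Finset.sum_add_distrib]
      conv_rhs => rw [dotProduct, Finset.sum_mul]
      refine Finset.sum_congr rfl fun k _ => ?_
      rw [dotProduct]
      ring
    rw [e]
    simp only [dotProduct]
    ring
  rw [h3]
  exact Complex.ofReal_re _

theorem represents_quadrature
    (hq : ∀ k, Approximates ρ (weylQuotient (Pi.single k 1)) (canonicalObs s k) (q k))
    (u : PhaseIndex s → ℝ) : Represents ρ (quadrature u) (affineObs q 0 u) := by
  unfold affineObs quadrature
  rw [Complex.ofReal_zero, zero_smul, zero_add]
  exact (Approximates.sum Finset.univ fun k => (hq k).real_smul (u k)).represents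

/-- The Kalman operator is the affine observable with coefficients `uᵀ K` and constant term
`uᵀ n - uᵀ K (F n + l)`. -/
theorem represents_kalmanOperator {r : ℕ}
    (hq : ∀ k, Approximates ρ (weylQuotient (Pi.single k 1)) (canonicalObs s k) (q k))
    (u n : PhaseIndex r → ℝ) (K : Matrix (PhaseIndex r) (PhaseIndex s) ℝ)
    (F : Matrix (PhaseIndex s) (PhaseIndex r) ℝ) (l : PhaseIndex s → ℝ) :
    Represents ρ (kalmanOperator u n K F l)
      (affineObs q (u ⬝ᵥ n - (u ᵥ* K) ⬝ᵥ (F *ᵥ n + l)) (u ᵥ* K)) := by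
  have h := (Approximates.sum Finset.univ fun k =>
    ((approximates_scalarOp ρ (n k)).add (Approximates.sum Finset.univ fun j =>
      (((hq j).sub (approximates_scalarOp ρ ((F *ᵥ n) j))).sub
        (approximates_scalarOp ρ (l j))).real_smul (K k j))).real_smul (u k)).represents
  convert! h using 1
  unfold affineObs
  simp only [smul_add, smul_sub, Finset.smul_sum, Finset.sum_add_distrib, Finset.sum_sub_distrib,
    smul_smul]
  have e1 : ∑ k, (((u ᵥ* K) k : ℝ) : ℂ) • q k = ∑ k, ∑ j, ((u k : ℂ) * (K k j : ℂ)) • q j := by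
    rw [Finset.sum_comm]
    refine Finset.sum_congr rfl fun j _ => ?_
    rw [← Finset.sum_smul, Matrix.vecMul, dotProduct]
    push_cast
    rfl
  rw [e1]
  simp only [← Finset.sum_smul]
  have e2 : (((u ⬝ᵥ n - (u ᵥ* K) ⬝ᵥ (F *ᵥ n + l) : ℝ) : ℂ)) = ∑ k, (u k : ℂ) * (n k : ℂ) -
      ∑ k, ∑ j, (u k : ℂ) * (K k j : ℂ) * (((F *ᵥ n) j : ℝ) : ℂ) -
      ∑ k, ∑ j, (u k : ℂ) * (K k j : ℂ) * (l j : ℂ) := by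
    have e3 : ∀ w : PhaseIndex s → ℝ, (u ᵥ* K) ⬝ᵥ w = ∑ k, ∑ j, u k * K k j * w j := by
      intro w
      rw [Finset.sum_comm]
      simp only [dotProduct, Matrix.vecMul, Finset.sum_mul]
    rw [dotProduct_add, e3, e3, ← sub_sub]
    simp only [dotProduct]
    push_cast
    rfl
  rw [e2, sub_smul, sub_smul]
  simp only [mul_assoc]
  abel

end Moments

/-! ### Nondegeneracy of the covariance matrix -/

section Uncertainty

variable {s : ℕ} {ρ : DensityOperator (BosonSpace s)} {m : PhaseIndex s → ℝ}
  {S : Matrix (PhaseIndex s) (PhaseIndex s) ℝ}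

/-- The modulus of a Gaussian characteristic function is the exponential of `-½ zᵀ S z`. -/
theorem posSemidef_of_norm_gaussianChar_le_one {ι : Type*} [Fintype ι] {m : ι → ℝ}
    {S : Matrix ι ι ℝ} (hS : S.IsSymm) (h : ∀ z, ‖gaussianChar m S z‖ ≤ 1) : S.PosSemidef := by
  refine Matrix.PosSemidef.of_dotProduct_mulVec_nonneg ?_ fun z => ?_
  · rw [Matrix.IsHermitian, Matrix.conjTranspose_eq_transpose_of_trivial, hS.eq]
  · have h1 := h z
    rw [norm_gaussianChar, Real.exp_le_one_iff] at h1
    rw [star_trivial]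
    linarith

theorem IsGaussianState.norm_wVec_weyl (h : IsGaussianState ρ m S) (z : PhaseIndex s → ℝ) :
    ‖wVec ρ (weyl z)‖ = 1 := by
  have h1 := h.inner_wVec_weyl z z
  have e : symplectic z z = 0 := by simpa using symplectic_smul_smul z 1 1
  rw [e, sub_self, gaussianChar_zero, inner_self_eq_norm_sq_to_K] at h1
  have h2 : ‖wVec ρ (weyl z)‖ ^ 2 = 1 := by
    have : ((‖wVec ρ (weyl z)‖ : ℂ)) ^ 2 = 1 := by simpa using h1
    exact_mod_cast this
  exact (pow_eq_one_iff_of_nonneg (norm_nonneg _) two_ne_zero).1 h2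

theorem IsGaussianState.gaussianChar_eq_inner (h : IsGaussianState ρ m S) (z : PhaseIndex s → ℝ) :
    gaussianChar m S z = ⟪wVec ρ (weyl 0), wVec ρ (weyl z)⟫_ℂ := by
  rw [h.inner_wVec_weyl, sub_zero]
  simp [symplectic]

theorem IsGaussianState.posSemidef (h : IsGaussianState ρ m S) : S.PosSemidef := by
  refine posSemidef_of_norm_gaussianChar_le_one (m := m) h.1 fun z => ?_
  rw [h.gaussianChar_eq_inner]
  refine (norm_inner_le_norm _ _).trans ?_
  rw [h.norm_wVec_weyl, h.norm_wVec_weyl, one_mul]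

/-- The covariance matrix of a Gaussian state is nondegenerate.  If the variance of `wᵀ Q`
vanished, all the operators `W(t w)` would act on the state as scalars.  The inner product of
`W(z) √ρ` and `W(t w) √ρ` could then be computed in two ways, by this and by the Weyl relations, and
the results would differ by a positive factor times a phase depending on the symplectic product of
`z` and `t w`; the phase can be made `-1`, whereas the characteristic function has no zeros. -/
theorem IsGaussianState.eq_zero_of_dotProduct_mulVec_eq_zero (h : IsGaussianState ρ m S)
    {w : PhaseIndex s → ℝ} (hw : w ⬝ᵥ (S *ᵥ w) = 0) : w = 0 := by
  by_contra hne
  -- the case of equality in the Cauchy–Schwarz inequality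
  have hscal : ∀ t : ℝ, wVec ρ (weyl (t • w)) = gaussianChar m S (t • w) • wVec ρ (weyl 0) := by
    intro t
    have hn : ‖gaussianChar m S (t • w)‖ = 1 := by
      rw [norm_gaussianChar, Matrix.mulVec_smul, dotProduct_smul, smul_dotProduct, hw]
      simp
    rw [← sub_eq_zero, ← norm_eq_zero, ← pow_eq_zero_iff two_ne_zero, @norm_sub_sq ℂ,
      norm_smul, h.norm_wVec_weyl, h.norm_wVec_weyl, hn, inner_smul_right,
      ← inner_conj_symm, ← h.gaussianChar_eq_inner, Complex.mul_conj', hn]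
    norm_num
  -- the symplectic rotation of `w`, for which the symplectic product with `w` is `wᵀ w`
  set z : PhaseIndex s → ℝ := fun p => if p.2 = 0 then -w (p.1, 1) else w (p.1, 0) with hz
  have hpos : 0 < symplectic z w := by
    have e : symplectic z w = w ⬝ᵥ w := by
      unfold symplectic dotProduct
      rw [Fintype.sum_prod_type]
      refine Finset.sum_congr rfl fun j _ => ?_
      simp [hz, Fin.sum_univ_two]
    rw [e]
    exact lt_of_le_of_ne (Finset.sum_nonneg fun i _ => mul_self_nonneg _)
      fun h0 => hne (dotProduct_self_eq_zero.1 h0.symm)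
  -- at this parameter the phase is `-1`
  set t : ℝ := 2 * Real.pi / symplectic z w with ht
  have h1 := h.inner_wVec_weyl z (t • w)
  have h2 := h.inner_wVec_weyl z 0
  have e0 : symplectic z 0 = 0 := by simp [symplectic]
  have et : symplectic z (t • w) / 2 = Real.pi := by
    rw [symplectic_smul_right, ht]
    field_simp
  have epi : Complex.exp (-((Real.pi : ℂ) * Complex.I)) = -1 := by
    rw [Complex.exp_neg, Complex.exp_pi_mul_I]
    norm_num
  rw [hscal, inner_smul_right, h2, e0, et, zero_sub, sub_eq_add_neg, gaussianChar_add h.1,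
    epi] at h1
  have h3 : gaussianChar m S (t • w) * gaussianChar m S (-z) *
      (1 + ((Real.exp (-(t • w ⬝ᵥ (S *ᵥ (-z)))) : ℝ) : ℂ)) = 0 := by
    push_cast
    simp only [zero_div, Complex.ofReal_zero, zero_mul, neg_zero, Complex.exp_zero, one_mul] at h1
    linear_combination h1
  have h4 := (mul_eq_zero.1 h3).resolve_left
    (mul_ne_zero (gaussianChar_ne_zero _) (gaussianChar_ne_zero _))
  have h5 : 1 + Real.exp (-(t • w ⬝ᵥ (S *ᵥ (-z)))) = 0 := by exact_mod_cast h4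
  linarith [Real.exp_pos (-(t • w ⬝ᵥ (S *ᵥ (-z))))]

theorem IsGaussianState.isUnit (h : IsGaussianState ρ m S) : IsUnit S := by
  refine Matrix.mulVec_injective_iff_isUnit.1 fun v w hvw => ?_
  refine sub_eq_zero.1 (h.eq_zero_of_dotProduct_mulVec_eq_zero ?_)
  rw [Matrix.mulVec_sub, sub_eq_zero.2 hvw, dotProduct_zero]

end Uncertainty

/-! ### Gaussian channels -/

section GaussianChannels

variable {s t : ℕ} {σ : DensityOperator (BosonSpace s)} {m : PhaseIndex s → ℝ}
  {S : Matrix (PhaseIndex s) (PhaseIndex s) ℝ}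
  {𝓕 : QuantumChannel (BosonSpace s) (BosonSpace t)} {F : Matrix (PhaseIndex t) (PhaseIndex s) ℝ}
  {l : PhaseIndex t → ℝ} {R : Matrix (PhaseIndex t) (PhaseIndex t) ℝ}

theorem gaussianChar_mul_gaussianChar_transpose {ι κ : Type*} [Fintype ι] [Fintype κ]
    (m : ι → ℝ) (S : Matrix ι ι ℝ) (F : Matrix κ ι ℝ) (l : κ → ℝ) (R : Matrix κ κ ℝ)
    (z : κ → ℝ) : gaussianChar l R z * gaussianChar m S (Fᵀ *ᵥ z) =
      gaussianChar (F *ᵥ m + l) (F * S * Fᵀ + R) z := by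
  unfold gaussianChar
  rw [← Complex.exp_add]
  congr 1
  have e1 : m ⬝ᵥ (Fᵀ *ᵥ z) = (F *ᵥ m) ⬝ᵥ z := by
    rw [Matrix.dotProduct_mulVec, Matrix.vecMul_transpose]
  have e2 : (Fᵀ *ᵥ z) ⬝ᵥ (S *ᵥ (Fᵀ *ᵥ z)) = z ⬝ᵥ ((F * S * Fᵀ) *ᵥ z) := by
    rw [← Matrix.mulVec_mulVec, ← Matrix.mulVec_mulVec, Matrix.dotProduct_mulVec z,
      ← Matrix.mulVec_transpose]
  rw [e1, e2, Matrix.add_mulVec, dotProduct_add, add_dotProduct]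
  push_cast
  ring

/-- The Schwarz inequality for `𝓕*` at a Weyl operator bounds the factor `exp (i lᵀ z - ½ zᵀ R z)`
by `1`. -/
theorem IsGaussianChannel.posSemidef (h𝓕 : IsGaussianChannel 𝓕 F l R)
    (σ : DensityOperator (BosonSpace s)) : R.PosSemidef := by
  refine posSemidef_of_norm_gaussianChar_le_one (m := l) h𝓕.1 fun z => ?_
  have hW : ∀ {r : ℕ} (w : PhaseIndex r → ℝ), star (weyl w) * weyl w = 1 := fun w => by
    rw [star_weyl]
    simpa [weyl_zero] using weyl_smul_mul_weyl_smul w (-1) 1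
  have h := 𝓕.trace_adj_mul_self_le σ (weyl z)
  rw [h𝓕.2, star_smul, smul_mul_smul_comm, hW, hW, smul_mul_assoc, trace_smul, one_mul, one_mul,
    σ.trace_eq_one, (𝓕.apply σ).trace_eq_one, mul_one, Complex.star_def, Complex.conj_mul'] at h
  have h2 : ‖gaussianChar l R z‖ ^ 2 ≤ 1 := by exact_mod_cast h
  exact (sq_le_one_iff₀ (norm_nonneg _)).1 h2

/-- A Gaussian channel maps a Gaussian state to a Gaussian state, with the mean and covariance of
the classical model `F X + Z`. -/
theorem IsGaussianChannel.isGaussianState (h𝓕 : IsGaussianChannel 𝓕 F l R)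
    (hσ : IsGaussianState σ m S) :
    IsGaussianState (𝓕.apply σ) (F *ᵥ m + l) (F * S * Fᵀ + R) := by
  refine ⟨?_, fun z => ?_⟩
  · rw [Matrix.IsSymm, Matrix.transpose_add, Matrix.transpose_mul, Matrix.transpose_mul,
      Matrix.transpose_transpose, hσ.1.eq, h𝓕.1.eq, Matrix.mul_assoc]
  · have h := 𝓕.hsInner_adj (weyl (-z)) ⟨σ.toOp, σ.mem_traceClass⟩
    unfold hsInner at h
    rw [h𝓕.2, star_smul, star_weyl, star_weyl, Matrix.mulVec_neg, neg_neg, neg_neg,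
      Complex.star_def, star_gaussianChar, neg_neg, smul_mul_assoc, trace_smul,
      trace_mul_comm _ σ.mem_traceClass, hσ.2, gaussianChar_mul_gaussianChar_transpose] at h
    rw [h, ← trace_mul_comm _ (𝓕.apply σ).mem_traceClass]
    rfl

end GaussianChannels

/-! ### The generalized conditional expectation as a Hilbert space adjoint -/

section ConditionalExpectation

variable {H₁ H₂ : Type*} [NormedAddCommGroup H₁] [InnerProductSpace ℂ H₁] [CompleteSpace H₁]
  [NormedAddCommGroup H₂] [InnerProductSpace ℂ H₂] [CompleteSpace H₂]

/-- Completing the square with the Hilbert space adjoint of `𝓕*`. -/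
theorem divergence_eq (σ : DensityOperator H₁) (𝓕 : QuantumChannel H₁ H₂) (a : L2 σ)
    (b : L2 (𝓕.apply σ)) : divergence σ 𝓕 a b =
      ‖b - ContinuousLinearMap.adjoint (𝓕.adjL2 σ) a‖ ^ 2 + ‖a‖ ^ 2 -
        ‖ContinuousLinearMap.adjoint (𝓕.adjL2 σ) a‖ ^ 2 := by
  unfold divergence
  rw [@norm_sub_sq ℂ, ContinuousLinearMap.adjoint_inner_right]
  simp only [RCLike.re_to_complex]
  ring

/-- The generalized conditional expectation is the Hilbert space adjoint of the extension of `𝓕*`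
to the weighted spaces. -/
theorem isGCE_adjoint (σ : DensityOperator H₁) (𝓕 : QuantumChannel H₁ H₂) (a : L2 σ) :
    IsGCE σ 𝓕 a (ContinuousLinearMap.adjoint (𝓕.adjL2 σ) a) := by
  ext b
  simp only [Set.mem_ofPred_eq, Set.mem_singleton_iff, isMinOn_univ_iff, divergence_eq]
  constructor
  · intro h
    have h1 := h (ContinuousLinearMap.adjoint (𝓕.adjL2 σ) a)
    rw [sub_self, norm_zero] at h1
    have h2 : ‖b - ContinuousLinearMap.adjoint (𝓕.adjL2 σ) a‖ = 0 := by
      rw [← pow_eq_zero_iff two_ne_zero]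
      nlinarith [sq_nonneg ‖b - ContinuousLinearMap.adjoint (𝓕.adjL2 σ) a‖]
    exact sub_eq_zero.1 (norm_eq_zero.1 h2)
  · rintro rfl b
    rw [sub_self, norm_zero]
    nlinarith [sq_nonneg ‖b - ContinuousLinearMap.adjoint (𝓕.adjL2 σ) a‖]

end ConditionalExpectation

/-! ### The Kalman gain -/

section LinearGaussian

theorem kalmanGain_mul {ι κ : Type*} [Fintype ι] [Fintype κ] [DecidableEq κ] (S : Matrix ι ι ℝ)
    (F : Matrix κ ι ℝ) (R : Matrix κ κ ℝ) (h : IsUnit (F * S * Fᵀ + R)) :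
    kalmanGain S F R * (F * S * Fᵀ + R) = S * Fᵀ :=
  Matrix.nonsing_inv_mul_cancel_right _ _ ((Matrix.isUnit_iff_isUnit_det _).1 h)

/-- The posterior variance is the prior variance minus the variance of the estimate. -/
theorem dotProduct_kalmanGain_mulVec {ι κ : Type*} [Fintype ι] [Fintype κ] [DecidableEq κ]
    {S : Matrix ι ι ℝ} (hS : S.IsSymm) (F : Matrix κ ι ℝ) (R : Matrix κ κ ℝ)
    (h : IsUnit (F * S * Fᵀ + R)) (u : ι → ℝ) :
    u ⬝ᵥ (S *ᵥ u) - (u ᵥ* kalmanGain S F R) ⬝ᵥ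
        ((F * S * Fᵀ + R) *ᵥ (u ᵥ* kalmanGain S F R)) =
      u ⬝ᵥ ((S - kalmanGain S F R * F * S) *ᵥ u) := by
  rw [Matrix.sub_mulVec, dotProduct_sub]
  congr 1
  have e1 : ∀ w, (u ᵥ* kalmanGain S F R) ⬝ᵥ ((F * S * Fᵀ + R) *ᵥ w) =
      u ⬝ᵥ ((S * Fᵀ) *ᵥ w) := by
    intro w
    rw [← Matrix.dotProduct_mulVec, Matrix.mulVec_mulVec, kalmanGain_mul S F R h]
  rw [e1, Matrix.dotProduct_mulVec, ← Matrix.mulVec_transpose, Matrix.transpose_mul,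
    Matrix.transpose_transpose, hS.eq, dotProduct_comm, ← Matrix.dotProduct_mulVec,
    Matrix.mulVec_mulVec, Matrix.mul_assoc]

variable {s t : ℕ} {σ : DensityOperator (BosonSpace s)} {m : PhaseIndex s → ℝ}
  {S : Matrix (PhaseIndex s) (PhaseIndex s) ℝ}
  {𝓕 : QuantumChannel (BosonSpace s) (BosonSpace t)} {F : Matrix (PhaseIndex t) (PhaseIndex s) ℝ}
  {l : PhaseIndex t → ℝ} {R : Matrix (PhaseIndex t) (PhaseIndex t) ℝ}

/-- Both sides have the same inner products with the Weyl operators `W(z)`. Those of the left side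
are inner products of the quadrature with `𝓕* W(z)`, a multiple of `W(Fᵀ z)`, and the gain solves
the resulting linear equation `K (F S Fᵀ + R) = S Fᵀ`. -/
theorem adjoint_adjL2_affineObs (hσ : IsGaussianState σ m S) (h𝓕 : IsGaussianChannel 𝓕 F l R)
    {q : PhaseIndex s → L2 σ} {p : PhaseIndex t → L2 (𝓕.apply σ)}
    (hq : ∀ k, Approximates σ (weylQuotient (Pi.single k 1)) (canonicalObs s k) (q k))
    (hp : ∀ k, Approximates (𝓕.apply σ) (weylQuotient (Pi.single k 1)) (canonicalObs t k) (p k))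
    (u : PhaseIndex s → ℝ) :
    ContinuousLinearMap.adjoint (𝓕.adjL2 σ) (affineObs q 0 u) =
      affineObs p (u ⬝ᵥ m - (u ᵥ* kalmanGain S F R) ⬝ᵥ (F *ᵥ m + l))
        (u ᵥ* kalmanGain S F R) := by
  have h' := h𝓕.isGaussianState hσ
  refine sub_eq_zero.1 (eq_zero_of_inner_weyl_eq_zero fun z => ?_)
  rw [inner_sub_right, ContinuousLinearMap.adjoint_inner_right, 𝓕.adjL2_toL2, h𝓕.2, toL2_smul,
    inner_smul_left, hσ.inner_weyl_affineObs hq, h'.inner_weyl_affineObs hp, star_gaussianChar,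
    ← Matrix.mulVec_neg, ← mul_assoc, gaussianChar_mul_gaussianChar_transpose,
    ← Matrix.dotProduct_mulVec u (kalmanGain S F R) (_ *ᵥ z),
    Matrix.mulVec_mulVec z (kalmanGain S F R), kalmanGain_mul S F R h'.isUnit,
    dotProduct_comm (F *ᵥ m + l), sub_add_cancel, zero_add, dotProduct_comm m,
    Matrix.mulVec_mulVec, sub_self]

end LinearGaussian

/-! ### The classical linear Gaussian model -/

section Classical

variable {ι : Type*} [Fintype ι]

theorem inner_toLp_eq_dotProduct (v : ι → ℝ) (x : EuclideanSpace ℝ ι) :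
    ⟪WithLp.toLp 2 v, x⟫_ℝ = v ⬝ᵥ x.ofLp := by
  rw [EuclideanSpace.inner_eq_star_dotProduct, star_trivial, dotProduct_comm]

variable [DecidableEq ι] {Ω : Type*} [MeasurableSpace Ω] {P : Measure Ω}
  {X : Ω → EuclideanSpace ℝ ι} {m : ι → ℝ} {S : Matrix ι ι ℝ}

theorem memLp_dotProduct_of_hasLaw
    (hX : HasLaw X (multivariateGaussian (WithLp.toLp 2 m) S) P) (v : ι → ℝ) :
    MemLp (fun w => v ⬝ᵥ (X w).ofLp) 2 P := by
  simp only [← inner_toLp_eq_dotProduct]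
  exact (hX.hasGaussianLaw.map_fun (innerSL ℝ (WithLp.toLp 2 v))).memLp_two

theorem integral_dotProduct_of_hasLaw
    (hX : HasLaw X (multivariateGaussian (WithLp.toLp 2 m) S) P) (v : ι → ℝ) :
    ∫ w, v ⬝ᵥ (X w).ofLp ∂P = v ⬝ᵥ m := by
  simp only [← inner_toLp_eq_dotProduct]
  have h1 : ∫ w, X w ∂P = WithLp.toLp 2 m := by
    rw [hX.integral_eq, integral_id_multivariateGaussian]
  have h2 := (innerSL ℝ (WithLp.toLp 2 v)).integral_comp_comm hX.hasGaussianLaw.integrable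
  simp only [innerSL_apply_apply] at h2
  rw [h2, h1, inner_toLp_eq_dotProduct]

theorem covariance_dotProduct_of_hasLaw (hS : S.PosSemidef)
    (hX : HasLaw X (multivariateGaussian (WithLp.toLp 2 m) S) P) (v v' : ι → ℝ) :
    cov[fun w => v ⬝ᵥ (X w).ofLp, fun w => v' ⬝ᵥ (X w).ofLp; P] = v ⬝ᵥ (S *ᵥ v') := by
  simp only [← inner_toLp_eq_dotProduct]
  have h1 := hX.covariance_fun_comp (f := fun x => ⟪WithLp.toLp 2 v, x⟫_ℝ)
    (g := fun x => ⟪WithLp.toLp 2 v', x⟫_ℝ) (by fun_prop) (by fun_prop)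
  rw [h1, ← covarianceBilin_apply_eq_cov IsGaussian.memLp_two_id,
    covarianceBilin_multivariateGaussian hS]

variable {κ : Type*} [Fintype κ] [DecidableEq κ] {Z : Ω → EuclideanSpace ℝ κ} {l : κ → ℝ}
  {R : Matrix κ κ ℝ} [IsProbabilityMeasure P]

/-- Covariances of linear functions of the independent pair `(X, Z)`. -/
theorem covariance_linear_of_indepFun (hS : S.PosSemidef) (hR : R.PosSemidef)
    (hX : HasLaw X (multivariateGaussian (WithLp.toLp 2 m) S) P)
    (hZ : HasLaw Z (multivariateGaussian (WithLp.toLp 2 l) R) P) (hXZ : IndepFun X Z P)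
    (v v' : ι → ℝ) (w w' : κ → ℝ) :
    cov[fun a => v ⬝ᵥ (X a).ofLp + w ⬝ᵥ (Z a).ofLp,
      fun a => v' ⬝ᵥ (X a).ofLp + w' ⬝ᵥ (Z a).ofLp; P] =
      v ⬝ᵥ (S *ᵥ v') + w ⬝ᵥ (R *ᵥ w') := by
  have mX := memLp_dotProduct_of_hasLaw hX
  have mZ := memLp_dotProduct_of_hasLaw hZ
  have h0 : ∀ (v : ι → ℝ) (w : κ → ℝ),
      cov[fun a => v ⬝ᵥ (X a).ofLp, fun a => w ⬝ᵥ (Z a).ofLp; P] = 0 := by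
    intro v w
    refine IndepFun.covariance_eq_zero ?_ (mX v) (mZ w)
    simp only [← inner_toLp_eq_dotProduct]
    exact hXZ.comp (φ := fun x => ⟪WithLp.toLp 2 v, x⟫_ℝ) (ψ := fun x => ⟪WithLp.toLp 2 w, x⟫_ℝ)
      (by fun_prop) (by fun_prop)
  change cov[(fun a => v ⬝ᵥ (X a).ofLp) + fun a => w ⬝ᵥ (Z a).ofLp,
    (fun a => v' ⬝ᵥ (X a).ofLp) + fun a => w' ⬝ᵥ (Z a).ofLp; P] = _
  rw [covariance_add_left (mX v) (mZ w) ((mX v').add (mZ w')),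
    covariance_add_right (mX v) (mX v') (mZ w'), covariance_add_right (mZ w) (mX v') (mZ w'),
    covariance_dotProduct_of_hasLaw hS hX, covariance_dotProduct_of_hasLaw hR hZ, h0,
    covariance_comm _ (fun a => v' ⬝ᵥ (X a).ofLp), h0]
  ring

/-- The innovation argument: the gain is chosen so that the linear part of the error is
uncorrelated with, hence by Gaussianity independent of, the observation. -/
theorem indepFun_error_observation (hS : S.PosSemidef) (hR : R.PosSemidef) (F : Matrix κ ι ℝ)
    (hX : HasLaw X (multivariateGaussian (WithLp.toLp 2 m) S) P)
    (hZ : HasLaw Z (multivariateGaussian (WithLp.toLp 2 l) R) P) (hXZ : IndepFun X Z P)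
    (u : ι → ℝ) (w : κ → ℝ) (hw : ∀ y, u ⬝ᵥ ((S * Fᵀ) *ᵥ y) = w ⬝ᵥ ((F * S * Fᵀ + R) *ᵥ y)) :
    IndepFun (fun a => (u - Fᵀ *ᵥ w) ⬝ᵥ (X a).ofLp + (-w) ⬝ᵥ (Z a).ofLp)
      (fun a => F *ᵥ (X a).ofLp + (Z a).ofLp) P := by
  have hG : HasGaussianLaw (fun a => (X a, Z a)) P :=
    hXZ.hasGaussianLaw hX.hasGaussianLaw hZ.hasGaussianLaw
  let LX : EuclideanSpace ℝ ι →L[ℝ] (κ → ℝ) :=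
    F.mulVecLin.toContinuousLinearMap.comp (EuclideanSpace.equiv ι ℝ).toContinuousLinearMap
  let L : EuclideanSpace ℝ ι × EuclideanSpace ℝ κ →L[ℝ] ℝ × (κ → ℝ) :=
    ((innerSL ℝ (WithLp.toLp 2 (u - Fᵀ *ᵥ w))).coprod (innerSL ℝ (WithLp.toLp 2 (-w)))).prod
      (LX.coprod (EuclideanSpace.equiv κ ℝ).toContinuousLinearMap)
  have hL : ∀ a, L (X a, Z a) = ((u - Fᵀ *ᵥ w) ⬝ᵥ (X a).ofLp + (-w) ⬝ᵥ (Z a).ofLp,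
      F *ᵥ (X a).ofLp + (Z a).ofLp) := by
    intro a
    rw [← inner_toLp_eq_dotProduct, ← inner_toLp_eq_dotProduct]
    rfl
  have hGL := hG.map_fun L
  simp only [hL] at hGL
  refine hGL.indepFun_of_covariance_strongDual fun L₁ L₂ => ?_
  -- the coefficients of the functional `L₂` of the observation
  set y : κ → ℝ := fun j => L₂ (Pi.single j 1) with hy
  have e1 : (L₁ ∘ fun a => (u - Fᵀ *ᵥ w) ⬝ᵥ (X a).ofLp + (-w) ⬝ᵥ (Z a).ofLp) =
      fun a => L₁ 1 * ((u - Fᵀ *ᵥ w) ⬝ᵥ (X a).ofLp + (-w) ⬝ᵥ (Z a).ofLp) := by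
    funext a
    rw [Function.comp_apply, mul_comm]
    conv_lhs => rw [← mul_one ((u - Fᵀ *ᵥ w) ⬝ᵥ (X a).ofLp + (-w) ⬝ᵥ (Z a).ofLp)]
    rw [← smul_eq_mul, map_smul, smul_eq_mul]
  have e2 : (L₂ ∘ fun a => F *ᵥ (X a).ofLp + (Z a).ofLp) =
      fun a => (Fᵀ *ᵥ y) ⬝ᵥ (X a).ofLp + y ⬝ᵥ (Z a).ofLp := by
    funext a
    have e3 : ∀ x : κ → ℝ, L₂ x = y ⬝ᵥ x := by
      intro x
      conv_lhs => rw [pi_eq_sum_univ' x]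
      simp [hy, dotProduct, mul_comm]
    rw [Function.comp_apply, e3, dotProduct_add, Matrix.mulVec_transpose,
      ← Matrix.dotProduct_mulVec]
  rw [e1, e2, covariance_const_mul_left, covariance_linear_of_indepFun hS hR hX hZ hXZ]
  have e4 : (Fᵀ *ᵥ w) ⬝ᵥ (S *ᵥ (Fᵀ *ᵥ y)) = w ⬝ᵥ ((F * S * Fᵀ) *ᵥ y) := by
    rw [← Matrix.mulVec_mulVec, ← Matrix.mulVec_mulVec, Matrix.dotProduct_mulVec w,
      ← Matrix.mulVec_transpose]
  have e5 := hw y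
  rw [Matrix.add_mulVec, dotProduct_add] at e5
  rw [sub_dotProduct, e4, neg_dotProduct, Matrix.mulVec_mulVec, e5]
  ring

/-- The quantity to be estimated splits into a linear function of the observation `Y` and an error
`E` independent of `Y`; the conditional expectation replaces `E` by its mean, and the mean square
error is the variance of `E`. -/
theorem condExp_linear_gaussian (hS : S.PosSemidef) (hR : R.PosSemidef) (F : Matrix κ ι ℝ)
    (hSR : IsUnit (F * S * Fᵀ + R)) (hXm : Measurable X) (hZm : Measurable Z)
    (hX : HasLaw X (multivariateGaussian (WithLp.toLp 2 m) S) P)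
    (hZ : HasLaw Z (multivariateGaussian (WithLp.toLp 2 l) R) P) (hXZ : IndepFun X Z P)
    {Y : Ω → κ → ℝ} (hY : ∀ a, Y a = F *ᵥ (X a).ofLp + (Z a).ofLp) (u : ι → ℝ) :
    (P[fun a => u ⬝ᵥ (X a).ofLp | MeasurableSpace.comap Y inferInstance] =ᵐ[P]
      fun a => u ⬝ᵥ (m + kalmanGain S F R *ᵥ (Y a - F *ᵥ m - l))) ∧
    ∫ a, ((P[fun a' => u ⬝ᵥ (X a').ofLp | MeasurableSpace.comap Y inferInstance]) a -
        u ⬝ᵥ (X a).ofLp) ^ 2 ∂P =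
      u ⬝ᵥ ((S - kalmanGain S F R * F * S) *ᵥ u) := by
  have hsymm : S.IsSymm := by
    have := hS.1
    rwa [Matrix.IsHermitian, Matrix.conjTranspose_eq_transpose_of_trivial] at this
  set w : κ → ℝ := u ᵥ* kalmanGain S F R with hw
  have hwy : ∀ y, u ⬝ᵥ ((S * Fᵀ) *ᵥ y) = w ⬝ᵥ ((F * S * Fᵀ + R) *ᵥ y) := by
    intro y
    rw [hw, ← Matrix.dotProduct_mulVec, Matrix.mulVec_mulVec, kalmanGain_mul S F R hSR]
  obtain rfl : Y = fun a => F *ᵥ (X a).ofLp + (Z a).ofLp := funext hY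
  clear hY
  set Y : Ω → κ → ℝ := fun a => F *ᵥ (X a).ofLp + (Z a).ofLp with hY
  set E : Ω → ℝ := fun a => (u - Fᵀ *ᵥ w) ⬝ᵥ (X a).ofLp + (-w) ⬝ᵥ (Z a).ofLp with hE
  have hind : IndepFun E Y P := indepFun_error_observation hS hR F hX hZ hXZ u w hwy
  have hEm : Measurable E := by
    simp only [hE, ← inner_toLp_eq_dotProduct]
    fun_prop
  have hYm : Measurable Y := by
    refine measurable_pi_lambda _ fun j => ?_
    simp only [hY, Pi.add_apply, Matrix.mulVec, ← inner_toLp_eq_dotProduct]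
    fun_prop
  have hE2 : MemLp E 2 P :=
    (memLp_dotProduct_of_hasLaw hX _).add (memLp_dotProduct_of_hasLaw hZ _)
  have hdecomp : ∀ a, u ⬝ᵥ (X a).ofLp = E a + w ⬝ᵥ Y a := by
    intro a
    simp only [hE, hY]
    rw [sub_dotProduct, dotProduct_add, neg_dotProduct, Matrix.mulVec_transpose,
      ← Matrix.dotProduct_mulVec]
    ring
  have hwY : Integrable (fun a => w ⬝ᵥ Y a) P := by
    have : (fun a => w ⬝ᵥ Y a) = fun a => u ⬝ᵥ (X a).ofLp - E a := by
      funext a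
      rw [hdecomp]
      ring
    rw [this]
    exact ((memLp_dotProduct_of_hasLaw hX u).sub hE2).integrable one_le_two
  have hEint : ∫ a, E a ∂P = u ⬝ᵥ m - w ⬝ᵥ (F *ᵥ m + l) := by
    simp only [hE]
    rw [integral_add ((memLp_dotProduct_of_hasLaw hX _).integrable one_le_two)
      ((memLp_dotProduct_of_hasLaw hZ _).integrable one_le_two),
      integral_dotProduct_of_hasLaw hX, integral_dotProduct_of_hasLaw hZ, sub_dotProduct,
      dotProduct_add, neg_dotProduct, Matrix.mulVec_transpose, ← Matrix.dotProduct_mulVec]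
    ring
  have hcond : P[fun a => u ⬝ᵥ (X a).ofLp | MeasurableSpace.comap Y inferInstance] =ᵐ[P]
      fun a => ∫ a, E a ∂P + w ⬝ᵥ Y a := by
    have h1 : (fun a => u ⬝ᵥ (X a).ofLp) = E + fun a => w ⬝ᵥ Y a := funext hdecomp
    rw [h1]
    have h2 := condExp_indep_eq hEm.comap_le hYm.comap_le
      (comap_measurable E).stronglyMeasurable hind
    have h3 : StronglyMeasurable[MeasurableSpace.comap Y inferInstance] fun a => w ⬝ᵥ Y a := by
      have hc : Measurable fun y : κ → ℝ => w ⬝ᵥ y := by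
        unfold dotProduct
        fun_prop
      exact (hc.comp (comap_measurable Y)).stronglyMeasurable
    have h4 := condExp_of_stronglyMeasurable hYm.comap_le h3 hwY
    filter_upwards [condExp_add (hE2.integrable one_le_two) hwY
      (MeasurableSpace.comap Y inferInstance), h2] with a h5 h6
    rw [h5, Pi.add_apply, h6, h4]
  constructor
  · filter_upwards [hcond] with a h
    rw [h, hEint, dotProduct_add u, Matrix.dotProduct_mulVec u, ← hw, dotProduct_sub,
      dotProduct_sub, dotProduct_add]
    ring
  · have h1 : ∫ a, ((P[fun a' => u ⬝ᵥ (X a').ofLp | MeasurableSpace.comap Y inferInstance]) a -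
        u ⬝ᵥ (X a).ofLp) ^ 2 ∂P = cov[E, E; P] := by
      rw [covariance_self hEm.aemeasurable, variance_eq_integral hEm.aemeasurable]
      refine integral_congr_ae ?_
      filter_upwards [hcond] with a h
      rw [h, hdecomp]
      ring
    have e4 : (Fᵀ *ᵥ w) ⬝ᵥ (S *ᵥ (Fᵀ *ᵥ w)) = w ⬝ᵥ ((F * S * Fᵀ) *ᵥ w) := by
      rw [← Matrix.mulVec_mulVec, ← Matrix.mulVec_mulVec, Matrix.dotProduct_mulVec w,
        ← Matrix.mulVec_transpose]
    have e5 := hwy w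
    rw [h1, hE, covariance_linear_of_indepFun hS hR hX hZ hXZ,
      ← dotProduct_kalmanGain_mulVec hsymm F R hSR u, ← hw, Matrix.mulVec_sub, dotProduct_sub,
      sub_dotProduct, sub_dotProduct, e4, Matrix.mulVec_neg, dotProduct_neg, neg_dotProduct,
      neg_neg, dotProduct_mulVec_comm_of_isSymm hsymm (Fᵀ *ᵥ w) u, Matrix.mulVec_mulVec, e5,
      Matrix.add_mulVec, dotProduct_add]
    ring

end Classical

end GaussianGCE

theorem mainTheorem10 {s t : ℕ}
    (σ : GaussianGCE.DensityOperator (GaussianGCE.BosonSpace s))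
    (m : GaussianGCE.PhaseIndex s → ℝ)
    (S : Matrix (GaussianGCE.PhaseIndex s) (GaussianGCE.PhaseIndex s) ℝ)
    (hσ : GaussianGCE.IsGaussianState σ m S)
    (𝓕 : GaussianGCE.QuantumChannel (GaussianGCE.BosonSpace s) (GaussianGCE.BosonSpace t))
    (F : Matrix (GaussianGCE.PhaseIndex t) (GaussianGCE.PhaseIndex s) ℝ)
    (l : GaussianGCE.PhaseIndex t → ℝ)
    (R : Matrix (GaussianGCE.PhaseIndex t) (GaussianGCE.PhaseIndex t) ℝ)
    (h𝓕 : GaussianGCE.IsGaussianChannel 𝓕 F l R)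
    (u : GaussianGCE.PhaseIndex s → ℝ) :
    -- the matrix inverted in the gain is invertible
    IsUnit (F * S * Fᵀ + R) ∧
    -- the GCE of the quadrature operator, and the minimum divergence
    (∃ (a : GaussianGCE.L2 σ) (b : GaussianGCE.L2 (𝓕.apply σ)),
      GaussianGCE.Represents σ (GaussianGCE.quadrature u) a ∧
      GaussianGCE.Represents (𝓕.apply σ)
        (GaussianGCE.kalmanOperator u m (GaussianGCE.kalmanGain S F R) F l) b ∧
      GaussianGCE.IsGCE σ 𝓕 a b ∧
      GaussianGCE.divergence σ 𝓕 a b =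
        u ⬝ᵥ ((S - GaussianGCE.kalmanGain S F R * F * S) *ᵥ u)) ∧
    -- the same formulas for the classical linear Gaussian model `Y = F X + Z`
    (∀ (Ω : Type*) [MeasurableSpace Ω] (P : Measure Ω) [IsProbabilityMeasure P]
      (X : Ω → EuclideanSpace ℝ (GaussianGCE.PhaseIndex s))
      (Z : Ω → EuclideanSpace ℝ (GaussianGCE.PhaseIndex t))
      (Y : Ω → GaussianGCE.PhaseIndex t → ℝ),
      Measurable X → Measurable Z →
      HasLaw X (multivariateGaussian (WithLp.toLp 2 m) S) P →
      HasLaw Z (multivariateGaussian (WithLp.toLp 2 l) R) P →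
      IndepFun X Z P →
      (∀ w, Y w = F *ᵥ (X w).ofLp + (Z w).ofLp) →
      (P[fun w => u ⬝ᵥ (X w).ofLp | MeasurableSpace.comap Y inferInstance] =ᵐ[P]
        fun w => u ⬝ᵥ (m + GaussianGCE.kalmanGain S F R *ᵥ (Y w - F *ᵥ m - l))) ∧
      ∫ w, ((P[fun w' => u ⬝ᵥ (X w').ofLp | MeasurableSpace.comap Y inferInstance]) w -
          u ⬝ᵥ (X w).ofLp) ^ 2 ∂P =
        u ⬝ᵥ ((S - GaussianGCE.kalmanGain S F R * F * S) *ᵥ u)) := by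
  have h' := h𝓕.isGaussianState hσ
  refine ⟨h'.isUnit, ?_, ?_⟩
  · choose q hq using hσ.exists_approximates
    choose p hp using h'.exists_approximates
    have hb := GaussianGCE.adjoint_adjL2_affineObs hσ h𝓕 hq hp u
    refine ⟨GaussianGCE.affineObs q 0 u, _, GaussianGCE.represents_quadrature hq u,
      GaussianGCE.represents_kalmanOperator hp u m _ F l, hb ▸ GaussianGCE.isGCE_adjoint σ 𝓕 _, ?_⟩
    rw [← hb, GaussianGCE.divergence_eq, sub_self, norm_zero, hb, hσ.norm_affineObs_sq hq,
      h'.norm_affineObs_sq hp, ← GaussianGCE.dotProduct_kalmanGain_mulVec hσ.1 F R h'.isUnit u,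
      dotProduct_comm (F *ᵥ m + l), sub_add_cancel, zero_add, dotProduct_comm m]
    ring
  · intro Ω _ P _ X Z Y hXm hZm hX hZ hXZ hY
    exact GaussianGCE.condExp_linear_gaussian hσ.posSemidef (h𝓕.posSemidef σ) F h'.isUnit hXm hZm
      hX hZ hXZ hY u
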